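/- Consider instances of the rooted prize-collecting Steiner-tree problem on trees: a finite tree $G=(V,E)$ with a root $r\in V$, edge costs $c(e)>0$ and vertex prizes $p(v)\ge 0$. A rooted subtree is a subtree of $G$ containing $r$; its density is its total prize divided by its total cost (and $0$ if it has no edges). A min-max subtree is an inclusion-wise minimal element among the rooted subtrees of maximum density. The eccentricity of the root is the maximum over $v\in V$ of the minimum cost of an $r$-$v$-path. An incremental solution is an ordering $\pi$ of a subset of $E$ such that every prefix spans a rooted subtree and all vertices of positive prize are reached in the end. For a budget $B\ge 0$, let $\mathrm{Alg}(B)$ be the rooted subtree spanned by the longest prefix of $\pi$ of total cost at most $B$, and let $\mathrm{Opt}(B)$ be a rooted subtree of maximum total prize among those of total cost at most $B$. The density-greedy algorithm starts with $\pi=()$. As long as the graph obtained from $G$ by contracting all edges of $\pi$ into the root (the root then has prize $0$) has non-zero total prize, it fixes an arbitrary min-max subtree of this contracted graph and appends to $\pi$ the unique edge of that subtree incident to the root. For $\chi,\alpha\ge 0$ and $\mu\ge 1$, an algorithm is called $(\alpha,\mu)$-competitive on trees with eccentricity $\chi$ if for every tree instance in which the eccentricity of the root is $\chi$, its solution satisfies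 $\mu\, p(\mathrm{Alg}(B+\alpha))\ge p(\mathrm{Opt}(B))$ for all $B\ge 0$. **Theorem.** (a) On every tree instance, every partial execution of the density-greedy algorithm can be completed, and every output is an incremental solution. (b) On trees, the density-greedy algorithm can be implemented in polynomial time: there is a program for a random access machine with logarithmic cost that, for every tree instance with rational costs and prizes (given as binary fractions of natural numbers), computes a possible output of the algorithm in time polynomial in the number of bits of the input. (c) For every rule for choosing among the min-max subtrees and all real $\chi,\alpha\ge 0$ and $\mu\ge 1$, the density-greedy algorithm is $(\alpha,\mu)$-competitive on trees with eccentricity $\chi$ if and only if $\alpha\ge\chi$. Hence for each $\alpha \ge 0$ it is $(\alpha,\mu)$-competitive for some finite $\mu\ge 1$ if and only if $\alpha\ge\chi$; in particular it is $(\chi,1)$-competitive. -/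

import Mathlib

noncomputable section

namespace PCST

/-! ### Instances of the rooted prize-collecting Steiner-tree problem -/

/-- An undirected, finite multigraph with a root, positive edge costs and non-negative vertex prizes.
Edges are labelled by elements of `E`; `ends e` lists the two endpoints of the edge `e` (the order of
the two plays no role; parallel edges and self-loops are allowed). -/
structure Network (V E : Type) where
  verts : Finset V
  edges : Finset E
  ends : E → V × V
  root : V
  cost : E → ℝ
  prize : V → ℝ
  root_mem : root ∈ verts
  ends_mem : ∀ e ∈ edges, (ends e).1 ∈ verts ∧ (ends e).2 ∈ verts
  cost_pos : ∀ e ∈ edges, 0 < cost e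
  prize_nonneg : ∀ v ∈ verts, 0 ≤ prize v

/-- A set of vertices together with a set of edges (a candidate for a subgraph). -/
@[ext]
structure Sub (V E : Type) where
  verts : Finset V
  edges : Finset E

namespace Network

variable {V E : Type}

/-- The edge `e` joins `u` and `v`. -/
def Joins (G : Network V E) (e : E) (u v : V) : Prop :=
  G.ends e = (u, v) ∨ G.ends e = (v, u)

/-- The edge `e` is incident to the root. -/
def IncidentToRoot (G : Network V E) (e : E) : Prop :=
  (G.ends e).1 = G.root ∨ (G.ends e).2 = G.root

/-- `T` is a subgraph of `G`. -/
def IsSubgraph (G : Network V E) (T : Sub V E) : Prop :=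
  T.verts ⊆ G.verts ∧ T.edges ⊆ G.edges ∧
    ∀ e ∈ T.edges, (G.ends e).1 ∈ T.verts ∧ (G.ends e).2 ∈ T.verts

/-- `T` is a subtree of `G` that contains the root: a subgraph containing the root that is connected
and has exactly one edge less than it has vertices. -/
def IsRootedSubtree (G : Network V E) (T : Sub V E) : Prop :=
  G.IsSubgraph T ∧ G.root ∈ T.verts ∧
    (∀ v ∈ T.verts, Relation.ReflTransGen (fun u w => ∃ e ∈ T.edges, G.Joins e u w) G.root v) ∧
    T.edges.card + 1 = T.verts.card

/-- The graph underlying `G` is a tree. -/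
def IsTree (G : Network V E) : Prop :=
  G.IsRootedSubtree ⟨G.verts, G.edges⟩

/-- Total prize `p(T)`. -/
def prizeOf (G : Network V E) (T : Sub V E) : ℝ := ∑ v ∈ T.verts, G.prize v

/-- Total cost `c(T)`. -/
def costOf (G : Network V E) (T : Sub V E) : ℝ := ∑ e ∈ T.edges, G.cost e

/-! ### Eccentricity of the root -/

/-- A walk from the first to the last argument, recorded as the list of the traversed edges, each
together with the vertex that it leads to. -/
inductive IsWalk (G : Network V E) : V → List (E × V) → V → Prop
  | nil (u : V) (hu : u ∈ G.verts) : IsWalk G u [] u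
  | cons (u w v : V) (e : E) (s : List (E × V)) (he : e ∈ G.edges) (hj : G.Joins e u w)
      (hs : IsWalk G w s v) : IsWalk G u ((e, w) :: s) v

/-- A path is a walk that visits no vertex twice. -/
def IsPath (G : Network V E) (u : V) (s : List (E × V)) (v : V) : Prop :=
  G.IsWalk u s v ∧ (u :: s.map Prod.snd).Nodup

/-- `x = ℓ(v)` is the minimum cost of a path from the root to `v`. -/
def IsRootDist (G : Network V E) (v : V) (x : ℝ) : Prop :=
  IsLeast {c : ℝ | ∃ s, G.IsPath G.root s v ∧ c = (s.map fun a => G.cost a.1).sum} x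

/-- `χ` is the eccentricity of the root: the maximum of `ℓ(v)` over all vertices `v`. -/
def IsEccentricity (G : Network V E) (χ : ℝ) : Prop :=
  IsGreatest {x : ℝ | ∃ v ∈ G.verts, G.IsRootDist v x} χ

/-! ### Density and min-max subtrees -/

/-- The density `p(T) / c(T)`, which is `0` for the subtree without edges. -/
def density (G : Network V E) (T : Sub V E) : ℝ :=
  open Classical in if T.edges = ∅ then 0 else G.prizeOf T / G.costOf T

/-- `T` is a rooted subtree of maximum density. -/
def IsMaxDensity (G : Network V E) (T : Sub V E) : Prop :=
  G.IsRootedSubtree T ∧ ∀ T', G.IsRootedSubtree T' → G.density T' ≤ G.density T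

/-- `T` is an inclusion-wise minimal rooted subtree of maximum density. -/
def IsMinMax (G : Network V E) (T : Sub V E) : Prop :=
  G.IsMaxDensity T ∧
    ∀ T', G.IsMaxDensity T' → T'.verts ⊆ T.verts → T'.edges ⊆ T.edges → T' = T

variable [DecidableEq V] [DecidableEq E]

/-! ### Contraction and the density-greedy algorithm -/

/-- The rooted subgraph spanned by a set of edges: the root, the edges, and their endpoints. -/
def span (G : Network V E) (F : Finset E) : Sub V E where
  verts := insert G.root (F.image (fun e => (G.ends e).1) ∪ F.image (fun e => (G.ends e).2))
  edges := F

/-- The contracted graph `G / T`: all of `T` is contracted into the root, whose prize becomes `0`.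
Every edge outside `T` survives under the same label and with the same cost. -/
def contract (G : Network V E) (T : Sub V E) : Network V E where
  verts := insert G.root (G.verts \ T.verts)
  edges := G.edges \ T.edges
  ends := fun e =>
    (if (G.ends e).1 ∈ T.verts then G.root else (G.ends e).1,
      if (G.ends e).2 ∈ T.verts then G.root else (G.ends e).2)
  root := G.root
  cost := G.cost
  prize := fun v => if v = G.root then 0 else G.prize v
  root_mem := Finset.mem_insert_self _ _
  ends_mem := by
    intro e he
    have h := G.ends_mem e (Finset.mem_sdiff.1 he).1
    constructor
    · by_cases h1 : (G.ends e).1 ∈ T.verts <;> simp [h1, h.1]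
    · by_cases h2 : (G.ends e).2 ∈ T.verts <;> simp [h2, h.2]
  cost_pos := fun e he => G.cost_pos e (Finset.mem_sdiff.1 he).1
  prize_nonneg := by
    intro v hv
    by_cases h : v = G.root
    · simp [h]
    · have : v ∈ G.verts := by
        have := Finset.mem_insert.1 hv
        rcases this with h' | h'
        · exact absurd h' h
        · exact (Finset.mem_sdiff.1 h').1
      simpa [h] using G.prize_nonneg v this

/-- The graph in which all edges of the current solution `π` are contracted. -/
def residual (G : Network V E) (π : List E) : Network V E :=
  G.contract (G.span π.toFinset)

/-- The total prize of the graph. -/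
def totalPrize (G : Network V E) : ℝ := ∑ v ∈ G.verts, G.prize v

/-- The sequences of edges that the density-greedy algorithm can have built after some number of
iterations of its loop. As long as the residual graph has non-zero total prize, an arbitrary min-max
subtree `T` of it is fixed, and the unique edge `e` of `T` that is incident to the root is
appended. -/
inductive GreedyTrace (G : Network V E) : List E → Prop
  | nil : GreedyTrace G []
  | step (π : List E) (T : Sub V E) (e : E) (hπ : GreedyTrace G π)
      (hprize : (G.residual π).totalPrize ≠ 0) (hT : (G.residual π).IsMinMax T)
      (heT : e ∈ T.edges) (hinc : (G.residual π).IncidentToRoot e)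
      (huniq : ∀ e' ∈ T.edges, (G.residual π).IncidentToRoot e' → e' = e) :
      GreedyTrace G (π ++ [e])

/-- `π` is a possible output of the density-greedy algorithm. -/
def IsGreedyOutput (G : Network V E) (π : List E) : Prop :=
  G.GreedyTrace π ∧ (G.residual π).totalPrize = 0

/-! ### Incremental solutions and competitiveness -/

/-- `π` is an ordering of a subset of the edges, every prefix of which spans a rooted subtree, such
that all vertices of positive prize are finally reached. -/
def IsIncrementalSolution (G : Network V E) (π : List E) : Prop :=
  π.Nodup ∧ (∀ σ, σ <+: π → G.IsRootedSubtree (G.span σ.toFinset)) ∧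
    ∀ v ∈ G.verts, 0 < G.prize v → v ∈ (G.span π.toFinset).verts

/-- The rooted subgraph bought with budget `B` when following `π`: it is spanned by those edges of
`π` for which the total cost up to and including this edge is at most `B`. -/
def alg (G : Network V E) (π : List E) (B : ℝ) : Sub V E :=
  open Classical in
  G.span ((Finset.univ.filter fun i : Fin π.length =>
    ((π.take (i.val + 1)).map G.cost).sum ≤ B).image π.get)

/-- `T` is an optimum solution of the problem with budget `B`. -/
def IsOpt (G : Network V E) (B : ℝ) (T : Sub V E) : Prop :=
  (G.IsRootedSubtree T ∧ G.costOf T ≤ B) ∧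
    ∀ T', G.IsRootedSubtree T' → G.costOf T' ≤ B → G.prizeOf T' ≤ G.prizeOf T

/-- `μ · p(Alg(B + α)) ≥ p(Opt(B))` for all budgets `B ≥ 0`. -/
def IsCompetitive (G : Network V E) (π : List E) (α μ : ℝ) : Prop :=
  ∀ B : ℝ, 0 ≤ B → ∀ T, G.IsOpt B T → G.prizeOf T ≤ μ * G.prizeOf (G.alg π (B + α))

end Network

/-- An algorithm, regarded as a function from instances to sequences of edges. -/
def Algorithm : Type 1 :=
  ∀ (V E : Type) [DecidableEq V] [DecidableEq E], Network V E → List E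

/-- On trees, `A` is the density-greedy algorithm with some rule for choosing among the min-max
subtrees. -/
def Algorithm.IsDensityGreedy (A : Algorithm) : Prop :=
  ∀ (V E : Type) [DecidableEq V] [DecidableEq E] (G : Network V E),
    G.IsTree → G.IsGreedyOutput (A V E G)

/-- `A` is `(α, μ)`-competitive on the trees in which the eccentricity of the root is `χ`. -/
def Algorithm.IsCompetitiveOnTrees (A : Algorithm) (χ α μ : ℝ) : Prop :=
  ∀ (V E : Type) [DecidableEq V] [DecidableEq E] (G : Network V E),
    G.IsTree → G.IsEccentricity χ → G.IsCompetitive (A V E G) α μ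

/-! ### Polynomial time

The machine model is a random access machine on natural numbers with logarithmic cost, programmed in
a structured language. Its memory consists of arrays, addressed by their number (which is fixed in
the program text) and an index (which may be computed). Every operation is charged the
number of bits of all numbers that take part in it, addresses and results included. -/

/-- Memory: array number, index, content. -/
abbrev Mem := ℕ → ℕ → ℕ

/-- The binary arithmetic operations; subtraction is truncated at zero, division is rounded down. -/
inductive Op
  | add | sub | mul | div

/-- Value of an arithmetic operation. -/
def Op.apply : Op → ℕ → ℕ → ℕ
  | .add, a, b => a + b
  | .sub, a, b => a - b
  | .mul, a, b => a * b
  | .div, a, b => a / b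

/-- Arithmetic terms: constants, memory accesses, operations. -/
inductive Term
  | const (k : ℕ)
  | read (array : ℕ) (index : Term)
  | op (o : Op) (a b : Term)

/-- Value of a term. -/
def Term.eval (s : Mem) : Term → ℕ
  | .const k => k
  | .read j i => s j (i.eval s)
  | .op o a b => o.apply (a.eval s) (b.eval s)

/-- Time for evaluating a term. -/
def Term.time (s : Mem) : Term → ℕ
  | .const k => k.size + 1
  | .read j i => i.time s + (i.eval s).size + (s j (i.eval s)).size + 1
  | .op o a b =>
      a.time s + b.time s + (a.eval s).size + (b.eval s).size +
        (o.apply (a.eval s) (b.eval s)).size + 1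

/-- Programs. A condition is true if its value is not zero. -/
inductive Prog
  | skip
  | write (array : ℕ) (index value : Term)
  | seq (p q : Prog)
  | ite (cond : Term) (p q : Prog)
  | loop (cond : Term) (p : Prog)

/-- `Exec p s t s'`: started in memory `s`, the program `p` halts after time `t` in memory `s'`. -/
inductive Exec : Prog → Mem → ℕ → Mem → Prop
  | skip (s : Mem) : Exec .skip s 1 s
  | write (s : Mem) (j : ℕ) (i a : Term) :
      Exec (.write j i a) s (i.time s + a.time s + (i.eval s).size + (a.eval s).size + 1)
        (Function.update s j (Function.update (s j) (i.eval s) (a.eval s)))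
  | seq (p q : Prog) (s s' s'' : Mem) (t t' : ℕ) (hp : Exec p s t s') (hq : Exec q s' t' s'') :
      Exec (.seq p q) s (t + t' + 1) s''
  | ite_true (c : Term) (p q : Prog) (s s' : Mem) (t : ℕ) (hc : c.eval s ≠ 0)
      (hp : Exec p s t s') : Exec (.ite c p q) s (c.time s + t + 1) s'
  | ite_false (c : Term) (p q : Prog) (s s' : Mem) (t : ℕ) (hc : c.eval s = 0)
      (hq : Exec q s t s') : Exec (.ite c p q) s (c.time s + t + 1) s'
  | loop_done (c : Term) (p : Prog) (s : Mem) (hc : c.eval s = 0) :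
      Exec (.loop c p) s (c.time s + 1) s
  | loop_step (c : Term) (p : Prog) (s s' s'' : Mem) (t t' : ℕ) (hc : c.eval s ≠ 0)
      (hp : Exec p s t s') (hl : Exec (.loop c p) s' t' s'') :
      Exec (.loop c p) s (c.time s + t + t' + 1) s''

/-- Initial memory: the input is in array `0`, every other cell is `0`. -/
def initial (x : List ℕ) : Mem := fun j i => if j = 0 then x.getD i 0 else 0

/-- The output list `y` is in array `1`: its length in the first cell, then its entries. -/
def IsOutput (s : Mem) (y : List ℕ) : Prop :=
  s 1 0 = y.length ∧ ∀ i : Fin y.length, s 1 (i.val + 1) = y.get i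

/-- Size of an input: the total number of bits, plus one for every number. -/
def inputSize (x : List ℕ) : ℕ := (x.map fun a => a.size + 1).sum

/-- The list `x` encodes the instance `G` with vertices `0, …, n - 1` and edges `0, …, m - 1` and
with rational prizes and costs: it consists of `n`, `m`, the root, for every vertex the numerator and
the denominator of its prize, and for every edge its two endpoints and the numerator and the
denominator of its cost. -/
def Encodes {n m : ℕ} (G : Network (Fin n) (Fin m)) (x : List ℕ) : Prop :=
  G.verts = Finset.univ ∧ G.edges = Finset.univ ∧
  ∃ (a b : Fin n → ℕ) (c d : Fin m → ℕ),
    (∀ v, b v ≠ 0 ∧ G.prize v = (a v : ℝ) / (b v : ℝ)) ∧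
    (∀ e, d e ≠ 0 ∧ G.cost e = (c e : ℝ) / (d e : ℝ)) ∧
    x = [n, m, G.root.val] ++
      (List.finRange n).flatMap (fun v => [a v, b v]) ++
      (List.finRange m).flatMap
        (fun e => [(G.ends e).1.val, (G.ends e).2.val, c e, d e])

/-- On trees, the density-greedy algorithm can be implemented in polynomial time: some program
computes, for every encoded tree instance, a possible output of the density-greedy algorithm, in time
polynomial in the size of the encoding. -/
def GreedyOnTreesInPolyTime : Prop :=
  ∃ (P : Prog) (q : Polynomial ℕ), ∀ (n m : ℕ) (G : Network (Fin n) (Fin m)) (x : List ℕ),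
    G.IsTree → Encodes G x →
      ∃ (t : ℕ) (s : Mem) (π : List (Fin m)),
        Exec P (initial x) t s ∧ t ≤ q.eval (inputSize x) ∧
        IsOutput s (π.map Fin.val) ∧ G.IsGreedyOutput π

end PCST

end

noncomputable section

set_option linter.unusedSectionVars false

namespace PCST

/-! ### Rooted forests -/

/-! Identify every vertex other than the root with the edge to its parent. Rooted subtrees become
parent-closed vertex sets (`Rooting.exists_eq_sub`, `Rooting.isRootedSubtree_sub`). Let `dens v` be
the maximum ratio of prize to cost over the branches with top `v`, the edge above `v` included. In a
contracted graph no subtree is denser than the best `dens` on the frontier of the contracted part.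
Hence the executions of the algorithm are exactly the sequences that keep appending a frontier
vertex of maximum, positive `dens` (`Rooting.greedyTrace_iff`), and contraction disappears from the
problem. Such sequences never repeat a vertex and can be extended until no prize is left, which
gives (a).

The upper bound in (c) is Lagrangian. With a price `l` per unit of cost, the largest gain `pot l v`
of a branch at `v` obeys a recursion that telescopes over vertex sets, and its sign tells on which
side of `l` the number `dens v` lies. Let `w` be the first vertex that the budget `B + α` cannot
pay, `vs` the vertices bought, `P` the path to the parent of `w`, and `l` the smallest `dens` in `vs
++ [w]`, attained at `z`. What was bought before `z` has maximum gain among all closed sets. Of the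
rest of `vs`, the vertices off `P` form complete cores, a core being the part of an optimal branch
that is strictly better than its top, together with this top. Indeed some vertex of the path to `w`
is always available, so a core is finished before the sequence turns to that vertex. Cores have
ratio at least `l` and lose nothing; the path loses at most `l` times its cost. This is
`Arbor.IsGreedy.exists_price`. Since `P` and `w` together cost at most `χ ≤ α`, the purchases cost
more than `B` plus the cost of `P`, which makes up for the loss.

For the lower bound, a star with two leaves suffices: the denser leaf costs `χ` and comes first, so
for `α < χ` the algorithm has nothing at a budget at which the cheap leaf alone earns `1`.

For (b), a greedy run below `v` needs the values `dens` of proper descendants only, and one of its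
prefixes is an optimal branch at `v` (`Arbor.IsGreedy.exists_prefix`). So all values are computed
from the leaves upwards, after scaling to integers and with comparison by cross multiplication; the
run at the root, made last, is the output. -/

/-- A finite rooted forest: `verts` are the vertices below the roots, `par` is the parent function;
costs belong to the edge from a vertex to its parent. -/
structure Arbor (ι : Type) where
  verts : Finset ι
  par : ι → ι
  rank : ι → ℕ
  prize : ι → ℝ
  cost : ι → ℝ
  rank_par_lt : ∀ v ∈ verts, rank (par v) < rank v
  prize_nonneg : ∀ v ∈ verts, 0 ≤ prize v
  cost_pos : ∀ v ∈ verts, 0 < cost v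

namespace Arbor

variable {ι : Type} [DecidableEq ι] (A : Arbor ι)

/-- Prize minus cost, the latter with price `l`. -/
def gain (l : ℝ) (v : ι) : ℝ := A.prize v - l * A.cost v

/-- The maximum total gain of a branch with top vertex `v`. -/
def pot (l : ℝ) (v : ι) : ℝ :=
  A.gain l v + ∑ w ∈ (A.verts.filter fun w => A.par w = v).attach, max 0 (pot l w.1)
termination_by A.verts.sup A.rank + 1 - A.rank v
decreasing_by
  have h := Finset.mem_filter.1 w.2
  have h1 := A.rank_par_lt w.1 h.1
  have h2 : A.rank w.1 ≤ A.verts.sup A.rank := Finset.le_sup (f := A.rank) h.1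
  rw [h.2] at h1
  omega

lemma pot_eq (l : ℝ) (v : ι) :
    A.pot l v = A.gain l v + ∑ w ∈ A.verts.filter (fun w => A.par w = v), max 0 (A.pot l w) := by
  rw [pot, Finset.sum_attach (A.verts.filter fun w => A.par w = v) fun w => max 0 (A.pot l w)]

/-- `T` is a non-empty connected set of vertices with top vertex `v`. -/
def IsBranch (v : ι) (T : Finset ι) : Prop :=
  v ∈ T ∧ T ⊆ A.verts ∧ ∀ u ∈ T, u ≠ v → A.par u ∈ T

/-- Vertices outside of `S` whose parents are in `S`. -/
def frontier (S : Finset ι) : Finset ι := A.verts.filter fun w => w ∉ S ∧ A.par w ∈ S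

lemma mem_frontier {S : Finset ι} {w : ι} :
    w ∈ A.frontier S ↔ w ∈ A.verts ∧ w ∉ S ∧ A.par w ∈ S := by
  simp [frontier]

/-- Solve the recursion of `pot` for the gain and sum over `D`: every child of a vertex of `D` is
subtracted exactly once, at its parent. -/
lemma sum_gain_eq (l : ℝ) (D : Finset ι) :
    ∑ u ∈ D, A.gain l u =
      ∑ u ∈ D, A.pot l u - ∑ w ∈ A.verts.filter (fun w => A.par w ∈ D), max 0 (A.pot l w) := by
  have h : ∑ w ∈ A.verts.filter (fun w => A.par w ∈ D), max 0 (A.pot l w) =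
      ∑ u ∈ D, ∑ w ∈ A.verts.filter (fun w => A.par w = u), max 0 (A.pot l w) := by
    rw [← Finset.sum_fiberwise_of_maps_to (t := D) (g := A.par) (by simp)]
    refine Finset.sum_congr rfl fun u hu => Finset.sum_congr ?_ fun _ _ => rfl
    ext w
    simp only [Finset.mem_filter]
    constructor
    · rintro ⟨⟨h1, _⟩, h3⟩
      exact ⟨h1, h3⟩
    · rintro ⟨h1, h3⟩
      exact ⟨⟨h1, h3 ▸ hu⟩, h3⟩
  rw [h, ← Finset.sum_sub_distrib]
  exact Finset.sum_congr rfl fun u _ => by rw [A.pot_eq l u]; ring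

/-- A vertex of `D` with parent in `D` occurs twice in `sum_gain_eq`, as `pot` and as `-max 0 pot`,
in total at most `0`; only the tops of `D` survive. -/
lemma sum_gain_le {l : ℝ} {D : Finset ι} (hD : D ⊆ A.verts) :
    ∑ u ∈ D, A.gain l u ≤ ∑ u ∈ D.filter (fun u => A.par u ∉ D), A.pot l u := by
  rw [A.sum_gain_eq, ← Finset.sum_filter_add_sum_filter_not D (fun u => A.par u ∉ D)]
  have h1 : ∑ u ∈ D.filter (fun u => ¬ A.par u ∉ D), A.pot l u ≤
      ∑ u ∈ D.filter (fun u => ¬ A.par u ∉ D), max 0 (A.pot l u) :=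
    Finset.sum_le_sum fun _ _ => le_max_right _ _
  have h2 : ∑ u ∈ D.filter (fun u => ¬ A.par u ∉ D), max 0 (A.pot l u) ≤
      ∑ w ∈ A.verts.filter (fun w => A.par w ∈ D), max 0 (A.pot l w) := by
    refine Finset.sum_le_sum_of_subset_of_nonneg ?_ fun _ _ _ => le_max_left _ _
    intro u hu
    simp only [Finset.mem_filter, not_not] at hu ⊢
    exact ⟨hD hu.1, hu.2⟩
  linarith

/-- The case of equality in `sum_gain_le`: paired terms cancel if inner potentials are non-negative,
and the children left out contribute nothing if theirs are non-positive. -/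
lemma le_sum_gain {l : ℝ} {D : Finset ι} (hD : D ⊆ A.verts)
    (hpos : ∀ u ∈ D, A.par u ∈ D → 0 ≤ A.pot l u) (hneg : ∀ w ∈ A.frontier D, A.pot l w ≤ 0) :
    ∑ u ∈ D.filter (fun u => A.par u ∉ D), A.pot l u ≤ ∑ u ∈ D, A.gain l u := by
  rw [A.sum_gain_eq, ← Finset.sum_filter_add_sum_filter_not D (fun u => A.par u ∉ D)]
  have h : ∑ w ∈ A.verts.filter (fun w => A.par w ∈ D), max 0 (A.pot l w) =
      ∑ u ∈ D.filter (fun u => ¬ A.par u ∉ D), A.pot l u := by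
    symm
    rw [Finset.sum_congr rfl (g := fun u => max 0 (A.pot l u))]
    · refine Finset.sum_subset ?_ ?_
      · intro u hu
        simp only [Finset.mem_filter, not_not] at hu ⊢
        exact ⟨hD hu.1, hu.2⟩
      · intro u hu hu'
        simp only [Finset.mem_filter, not_not, not_and] at hu hu'
        exact max_eq_left (hneg u (A.mem_frontier.2 ⟨hu.1, fun h => hu' h hu.2, hu.2⟩))
    · intro u hu
      simp only [Finset.mem_filter, not_not] at hu
      exact (max_eq_right (hpos u hu.1 hu.2)).symm
  linarith

variable {A}

/-- Following parents inside the branch lowers the rank and can stop only at `v`. -/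
lemma IsBranch.rank_le {v : ι} {T : Finset ι} (hT : A.IsBranch v T) :
    ∀ u ∈ T, A.rank v ≤ A.rank u := by
  suffices ∀ n, ∀ u ∈ T, A.rank u = n → A.rank v ≤ n from fun u hu => this _ u hu rfl
  intro n
  induction n using Nat.strong_induction_on with
  | _ n ih =>
    intro u hu hn
    by_cases h : u = v
    · rw [← hn, h]
    · have h1 := A.rank_par_lt u (hT.2.1 hu)
      have := ih _ (hn ▸ h1) _ (hT.2.2 u hu h) rfl
      omega

lemma IsBranch.filter_par {v : ι} {T : Finset ι} (hT : A.IsBranch v T) :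
    T.filter (fun u => A.par u ∉ T) = {v} := by
  ext u
  simp only [Finset.mem_filter, Finset.mem_singleton]
  constructor
  · rintro ⟨h1, h2⟩
    by_contra h
    exact h2 (hT.2.2 u h1 h)
  · rintro rfl
    refine ⟨hT.1, fun h => ?_⟩
    have := hT.rank_le _ h
    have := A.rank_par_lt u (hT.2.1 hT.1)
    omega

lemma IsBranch.sum_gain_le {l : ℝ} {v : ι} {T : Finset ι} (hT : A.IsBranch v T) :
    ∑ u ∈ T, A.gain l u ≤ A.pot l v := by
  simpa [hT.filter_par] using A.sum_gain_le (l := l) hT.2.1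

lemma IsBranch.pot_le {l : ℝ} {v : ι} {T : Finset ι} (hT : A.IsBranch v T)
    (hpos : ∀ u ∈ T, u ≠ v → 0 ≤ A.pot l u) (hneg : ∀ w ∈ A.frontier T, A.pot l w ≤ 0) :
    A.pot l v ≤ ∑ u ∈ T, A.gain l u := by
  have := A.le_sum_gain (l := l) hT.2.1 (fun u hu hp => hpos u hu ?_) hneg
  · simpa [hT.filter_par] using this
  · rintro rfl
    have := hT.rank_le _ hp
    have := A.rank_par_lt u (hT.2.1 hT.1)
    omega

/-! ### Ratios of branches and sign tests for gains -/

variable (A)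

/-- Ratio of total prize and total cost. -/
def ratio (T : Finset ι) : ℝ := (∑ u ∈ T, A.prize u) / ∑ u ∈ T, A.cost u

lemma sum_gain (l : ℝ) (T : Finset ι) :
    ∑ u ∈ T, A.gain l u = ∑ u ∈ T, A.prize u - l * ∑ u ∈ T, A.cost u := by
  simp [gain, Finset.sum_sub_distrib, Finset.mul_sum]

variable {A} in
lemma IsBranch.sum_cost_pos {v : ι} {T : Finset ι} (hT : A.IsBranch v T) :
    0 < ∑ u ∈ T, A.cost u :=
  Finset.sum_pos (fun u hu => A.cost_pos u (hT.2.1 hu)) ⟨v, hT.1⟩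

-- Linearisation of a fractional objective: comparing a ratio with `l` is a sign test for the gain
-- at price `l`.
variable {A} in
lemma IsBranch.le_ratio_iff {l : ℝ} {v : ι} {T : Finset ι} (hT : A.IsBranch v T) :
    l ≤ A.ratio T ↔ 0 ≤ ∑ u ∈ T, A.gain l u := by
  rw [ratio, le_div_iff₀ hT.sum_cost_pos, sum_gain, sub_nonneg]

variable {A} in
lemma IsBranch.ratio_le_iff {l : ℝ} {v : ι} {T : Finset ι} (hT : A.IsBranch v T) :
    A.ratio T ≤ l ↔ ∑ u ∈ T, A.gain l u ≤ 0 := by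
  rw [ratio, div_le_iff₀ hT.sum_cost_pos, sum_gain, sub_nonpos]

open Classical in
/-- The branches with top vertex `v`. -/
def branches (v : ι) : Finset (Finset ι) := A.verts.powerset.filter (A.IsBranch v)

lemma mem_branches {v : ι} {T : Finset ι} : T ∈ A.branches v ↔ A.IsBranch v T := by
  simp only [branches, Finset.mem_filter, Finset.mem_powerset, and_iff_right_iff_imp]
  exact fun h => h.2.1

open Classical in
/-- The maximum ratio of a branch with top vertex `v`. -/
def dens (v : ι) : ℝ :=
  -- The default `0` is taken exactly outside of `A.verts`, where no branch has its top.
  if h : (A.branches v).Nonempty then (A.branches v).sup' h A.ratio else 0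

lemma branches_nonempty {v : ι} (hv : v ∈ A.verts) : (A.branches v).Nonempty :=
  ⟨{v}, A.mem_branches.2 ⟨by simp, by simpa using hv, by simp⟩⟩

variable {A} in
lemma IsBranch.ratio_le_dens {v : ι} {T : Finset ι} (hT : A.IsBranch v T) :
    A.ratio T ≤ A.dens v := by
  have h : T ∈ A.branches v := A.mem_branches.2 hT
  rw [dens, dif_pos ⟨T, h⟩]
  exact Finset.le_sup' A.ratio h

lemma exists_branch {v : ι} (hv : v ∈ A.verts) : ∃ T, A.IsBranch v T ∧ A.ratio T = A.dens v := by
  have h := A.branches_nonempty hv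
  obtain ⟨T, hT, he⟩ := Finset.exists_mem_eq_sup' h A.ratio
  exact ⟨T, A.mem_branches.1 hT, by rw [dens, dif_pos h, he]⟩

lemma dens_nonneg {v : ι} (hv : v ∈ A.verts) : 0 ≤ A.dens v := by
  obtain ⟨T, hT, he⟩ := A.exists_branch hv
  rw [← he]
  exact div_nonneg (Finset.sum_nonneg fun u hu => A.prize_nonneg u (hT.2.1 hu)) hT.sum_cost_pos.le

/-! ### Optimal branches and cores, grown downwards from a vertex -/

open Classical in
/-- The vertices that can be reached downwards from `v` through vertices with property `p`. -/
def reach (p : ι → Prop) (v : ι) : Finset ι :=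
  -- `v` is added by hand, as it need not be in `A.verts`.
  insert v (A.verts.filter
    (Relation.ReflTransGen (fun a b => b ∈ A.verts ∧ A.par b = a ∧ p b) v))

variable {A} {p : ι → Prop} {v w : ι}

lemma mem_reach : w ∈ A.reach p v ↔
    Relation.ReflTransGen (fun a b => b ∈ A.verts ∧ A.par b = a ∧ p b) v w := by
  simp only [reach, Finset.mem_insert, Finset.mem_filter]
  constructor
  · rintro (rfl | h)
    · exact .refl
    · exact h.2
  · intro h
    rcases Relation.ReflTransGen.cases_tail h with h1 | ⟨c, _, hc⟩
    · exact Or.inl h1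
    · exact Or.inr ⟨hc.1, h⟩

lemma self_mem_reach : v ∈ A.reach p v := Finset.mem_insert_self _ _

lemma reach_step (h : A.par w ∈ A.reach p v) (hw : w ∈ A.verts) (hp : p w) : w ∈ A.reach p v :=
  mem_reach.2 ((mem_reach.1 h).tail ⟨hw, rfl, hp⟩)

lemma reach_cases (h : w ∈ A.reach p v) :
    w = v ∨ w ∈ A.verts ∧ A.par w ∈ A.reach p v ∧ p w := by
  rcases Relation.ReflTransGen.cases_tail (mem_reach.1 h) with h1 | ⟨c, hc1, hc2, hc3, hc4⟩
  · exact Or.inl h1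
  · exact Or.inr ⟨hc2, hc3 ▸ mem_reach.2 hc1, hc4⟩

lemma reach_induction {q : ι → Prop} (h0 : q v)
    (h1 : ∀ w ∈ A.verts, A.par w ∈ A.reach p v → p w → q (A.par w) → q w) :
    ∀ w ∈ A.reach p v, q w := by
  intro w hw
  have := mem_reach.1 hw
  induction this with
  | refl => exact h0
  | tail hb hc ih =>
    obtain ⟨h2, rfl, h3⟩ := hc
    exact h1 _ h2 (mem_reach.2 hb) h3 (ih (mem_reach.2 hb))

lemma isBranch_reach (hv : v ∈ A.verts) : A.IsBranch v (A.reach p v) := by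
  refine ⟨self_mem_reach, fun w hw => ?_, fun w hw hne => ?_⟩
  · rcases reach_cases hw with rfl | h
    exacts [hv, h.1]
  · exact ((reach_cases hw).resolve_left hne).2.1

lemma not_of_mem_frontier_reach (h : w ∈ A.frontier (A.reach p v)) : ¬ p w := fun hp =>
  (A.mem_frontier.1 h).2.1 (reach_step (A.mem_frontier.1 h).2.2 (A.mem_frontier.1 h).1 hp)

variable (A)

lemma pot_nonneg {l : ℝ} (hv : v ∈ A.verts) (h : l ≤ A.dens v) : 0 ≤ A.pot l v := by
  obtain ⟨T, hT, he⟩ := A.exists_branch hv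
  exact (hT.le_ratio_iff.1 (he ▸ h)).trans hT.sum_gain_le

/-- The branch grown from `v` through all vertices of non-negative potential has gain at least `pot
l v`; its ratio is at most `dens v`, so at price `l` it gains nothing. -/
lemma pot_nonpos {l : ℝ} (hv : v ∈ A.verts) (h : A.dens v ≤ l) : A.pot l v ≤ 0 := by
  have hT : A.IsBranch v (A.reach (fun w => 0 ≤ A.pot l w) v) := isBranch_reach hv
  refine (hT.pot_le (l := l)
    (fun u hu hne => ((reach_cases (p := fun w => 0 ≤ A.pot l w) hu).resolve_left hne).2.2)
    fun w hw => (not_le.1 (not_of_mem_frontier_reach (p := fun w => 0 ≤ A.pot l w) hw)).le).trans ?_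
  exact hT.ratio_le_iff.1 (hT.ratio_le_dens.trans h)

variable {A} in
/-- A branch all of whose vertices have large and all of whose outer neighbours have small maximum
ratio is optimal. -/
lemma IsBranch.ratio_eq {T : Finset ι} (hT : A.IsBranch v T)
    (hpos : ∀ u ∈ T, u ≠ v → A.dens v ≤ A.dens u)
    (hneg : ∀ w ∈ A.frontier T, A.dens w ≤ A.dens v) : A.ratio T = A.dens v := by
  refine le_antisymm hT.ratio_le_dens (hT.le_ratio_iff.2 ?_)
  -- At price `dens v` the potential of `v` is non-negative, and the two hypotheses make `T` attain
  -- it.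
  exact (A.pot_nonneg (hT.2.1 hT.1) le_rfl).trans (hT.pot_le
    (fun u hu hne => A.pot_nonneg (hT.2.1 hu) (hpos u hu hne))
    fun w hw => A.pot_nonpos (A.mem_frontier.1 hw).1 (hneg w hw))

/-- The part of the optimal branch below `v` that has to be finished once `v` has been picked. -/
def core (v : ι) : Finset ι := A.reach (fun w => A.dens v < A.dens w) v

lemma ratio_core (hv : v ∈ A.verts) : A.ratio (A.core v) = A.dens v :=
  (isBranch_reach hv).ratio_eq (fun _ hu hne => ((reach_cases hu).resolve_left hne).2.2.le)
    fun _ hw => not_lt.1 (not_of_mem_frontier_reach (p := fun w => A.dens v < A.dens w) hw)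

/-- The first vertex outside of `S` on a descent through the core would be a frontier vertex better
than `v`. For greedy sequences: the core of `v` is complete once nothing better than `v` is
available. -/
lemma core_subset {S : Finset ι} (hv : v ∈ S) (hS : ∀ w ∈ A.frontier S, A.dens w ≤ A.dens v) :
    A.core v ⊆ S := by
  refine reach_induction hv fun w hw _ hd hp => ?_
  by_contra h
  exact absurd (hS w (A.mem_frontier.2 ⟨hw, h, hp⟩)) (not_le.2 hd)

/-- The core of `v` can be entered from outside only at `v`, and the ranks forbid a descent from `u`
to arrive there. -/
lemma disjoint_core {u : ι} (hu : u ∉ A.core v) (hr : A.rank v ≤ A.rank u) :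
    ∀ w ∈ A.core u, w ∉ A.core v ∧ A.rank v ≤ A.rank w := by
  refine reach_induction ⟨hu, hr⟩ fun w hw _ _ hp => ?_
  have := A.rank_par_lt w hw
  refine ⟨fun h => ?_, by omega⟩
  rcases reach_cases h with rfl | h
  · omega
  · exact hp.1 h.2.1

/-- `D` is a disjoint union of cores of ratio at least `l`: split off the core of a vertex of
minimum rank; by `disjoint_core` the cores of the remaining vertices stay intact. -/
lemma sum_gain_nonneg_of_core {l : ℝ} (D : Finset ι) (hD : D ⊆ A.verts)
    (h : ∀ u ∈ D, l ≤ A.dens u ∧ A.core u ⊆ D) : 0 ≤ ∑ u ∈ D, A.gain l u := by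
  induction D using Finset.strongInduction with
  | H D ih =>
    rcases D.eq_empty_or_nonempty with rfl | hne
    · simp
    obtain ⟨y, hy, hmin⟩ := D.exists_min_image A.rank hne
    have hyv := hD hy
    have hc := (h y hy).2
    rw [← Finset.sum_sdiff hc]
    refine add_nonneg (ih _ ?_ (Finset.sdiff_subset.trans hD) fun u hu => ?_) ?_
    · exact Finset.sdiff_ssubset hc ⟨y, self_mem_reach⟩
    · obtain ⟨hu1, hu2⟩ := Finset.mem_sdiff.1 hu
      refine ⟨(h u hu1).1, fun w hw => Finset.mem_sdiff.2 ⟨(h u hu1).2 hw, ?_⟩⟩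
      exact (A.disjoint_core hu2 (hmin u hu1) w hw).1
    · refine (isBranch_reach hyv).le_ratio_iff.1 ?_
      change l ≤ A.ratio (A.core y)
      rw [A.ratio_core hyv]
      exact (h y hy).1

/-! ### Greedy sequences -/

/-- Starting with `v`, one always picks a vertex of positive maximum ratio that is best possible
among those that can be appended. -/
def IsGreedy (v : ι) (vs : List ι) : Prop :=
  ∀ σ x τ, vs = σ ++ x :: τ → x ∈ A.frontier (insert v σ.toFinset) ∧
    (∀ y ∈ A.frontier (insert v σ.toFinset), A.dens y ≤ A.dens x) ∧ 0 < A.dens x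

lemma isGreedy_nil (v : ι) : A.IsGreedy v [] := by
  intro σ x τ h
  simp at h

variable {A}

lemma IsGreedy.concat {vs : List ι} {x : ι} (h : A.IsGreedy v vs)
    (hx : x ∈ A.frontier (insert v vs.toFinset))
    (hmax : ∀ y ∈ A.frontier (insert v vs.toFinset), A.dens y ≤ A.dens x) (hpos : 0 < A.dens x) :
    A.IsGreedy v (vs ++ [x]) := by
  intro σ y τ he
  rcases List.eq_nil_or_concat τ with rfl | ⟨τ', z, rfl⟩
  · obtain ⟨rfl, h2⟩ := List.append_inj' he rfl
    simp only [List.cons.injEq, and_true] at h2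
    subst h2
    exact ⟨hx, hmax, hpos⟩
  · rw [List.concat_eq_append, ← List.cons_append, ← List.append_assoc] at he
    exact h σ y τ' (List.append_inj' he rfl).1

lemma IsGreedy.of_append {σ τ : List ι} (h : A.IsGreedy v (σ ++ τ)) : A.IsGreedy v σ := by
  intro σ' x τ' he
  exact h σ' x (τ' ++ τ) (by rw [he]; simp)

lemma IsGreedy.mem_verts {vs : List ι} (h : A.IsGreedy v vs) : vs.toFinset ⊆ A.verts := by
  intro x hx
  obtain ⟨σ, τ, rfl⟩ := List.append_of_mem (List.mem_toFinset.1 hx)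
  exact (A.mem_frontier.1 (h σ x τ rfl).1).1

lemma IsGreedy.nodup {vs : List ι} (h : A.IsGreedy v vs) : vs.Nodup := by
  induction vs using List.reverseRecOn with
  | nil => simp
  | append_singleton vs x ih =>
    have hx := (A.mem_frontier.1 (h vs x [] rfl).1).2.1
    simp only [Finset.mem_insert, List.mem_toFinset, not_or] at hx
    refine List.Nodup.append (ih h.of_append) (by simp) ?_
    intro a ha hb
    rw [List.mem_singleton.1 hb] at ha
    exact hx.2 ha

lemma IsGreedy.not_mem {vs : List ι} (h : A.IsGreedy v vs) : v ∉ vs := by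
  intro hx
  obtain ⟨σ, τ, rfl⟩ := List.append_of_mem hx
  exact (A.mem_frontier.1 (h σ v τ rfl).1).2.1 (Finset.mem_insert_self _ _)

lemma IsGreedy.par_mem {vs : List ι} (h : A.IsGreedy v vs) :
    ∀ x ∈ vs, A.par x ∈ insert v vs.toFinset := by
  intro x hx
  obtain ⟨σ, τ, rfl⟩ := List.append_of_mem hx
  have := (A.mem_frontier.1 (h σ x τ rfl).1).2.2
  simp only [Finset.mem_insert, List.mem_toFinset, List.mem_append] at this ⊢
  tauto

lemma IsGreedy.isBranch {vs : List ι} (h : A.IsGreedy v vs) (hv : v ∈ A.verts) :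
    A.IsBranch v (insert v vs.toFinset) := by
  refine ⟨by simp, fun x hx => ?_, fun x hx hne => ?_⟩
  · rcases Finset.mem_insert.1 hx with rfl | hx
    exacts [hv, h.mem_verts hx]
  · exact h.par_mem x (List.mem_toFinset.1 ((Finset.mem_insert.1 hx).resolve_left hne))

/-- Some prefix of a complete greedy sequence spans an optimal branch. -/
lemma IsGreedy.exists_prefix {vs : List ι} (h : A.IsGreedy v vs) (hv : v ∈ A.verts)
    (hend : ∀ y ∈ A.frontier (insert v vs.toFinset), A.dens y ≤ 0) :
    ∃ σ, σ <+: vs ∧ A.ratio (insert v σ.toFinset) = A.dens v := by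
  -- The prefix ends before the first vertex that is worse than `v`. All its members are at least as
  -- good as `v`, while the greedy choice of that worse vertex bounds the whole frontier, so
  -- `IsBranch.ratio_eq` applies.
  have key : ∀ n ≤ vs.length, (∃ σ, σ <+: vs ∧ A.ratio (insert v σ.toFinset) = A.dens v) ∨
      ∀ x ∈ vs.take n, A.dens v ≤ A.dens x := by
    intro n
    induction n with
    | zero => simp
    | succ n ih =>
      intro hn
      rcases ih (by omega) with h1 | h1
      · exact Or.inl h1
      have hsplit : vs = vs.take n ++ vs[n] :: vs.drop (n + 1) := by simp
      obtain ⟨_, h3, _⟩ := h _ _ _ hsplit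
      by_cases hc : A.dens v ≤ A.dens vs[n]
      · right
        intro x hx
        rw [List.take_succ_eq_append_getElem (by omega)] at hx
        rcases List.mem_append.1 hx with hx | hx
        · exact h1 x hx
        · rwa [List.mem_singleton.1 hx]
      · left
        refine ⟨vs.take n, List.take_prefix _ _, ?_⟩
        rw [hsplit] at h
        refine (h.of_append.isBranch hv).ratio_eq (fun u hu hne => h1 u ?_)
          fun w hw => (h3 w hw).trans (not_le.1 hc).le
        simpa [hne] using hu
  rcases key _ le_rfl with h1 | h1
  · exact h1
  -- No vertex was worse than `v`: the entire sequence works, its frontier having maximum ratios at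
  -- most `0`.
  · rw [List.take_length] at h1
    refine ⟨vs, List.prefix_rfl, (h.isBranch hv).ratio_eq (fun u hu hne => h1 u ?_)
      fun w hw => (hend w hw).trans (A.dens_nonneg hv)⟩
    simpa [hne] using hu

/-! ### Closed sets and the price certificate -/

variable (A)

/-- `S` is, together with the root `v`, closed under parents. -/
def IsClosed (v : ι) (S : Finset ι) : Prop := S ⊆ A.verts ∧ ∀ u ∈ S, A.par u ∈ insert v S

variable {A}

lemma IsGreedy.isClosed {vs : List ι} (h : A.IsGreedy v vs) : A.IsClosed v vs.toFinset :=
  ⟨h.mem_verts, fun u hu => h.par_mem u (List.mem_toFinset.1 hu)⟩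

/-- A descent that starts outside of a parent-closed set never enters it; `v ∉ A.verts` excludes
that the descent passes through the root. -/
lemma IsClosed.disjoint_core {S : Finset ι} (hS : A.IsClosed v S) (hv : v ∉ A.verts) {u : ι}
    (huv : u ∈ A.verts) (hu : u ∉ S) : ∀ w ∈ A.core u, w ∉ S := by
  refine reach_induction hu fun w hw hp _ ih hwS => ?_
  rcases Finset.mem_insert.1 (hS.2 w hwS) with h | h
  · exact hv (h ▸ (isBranch_reach huv).2.1 hp)
  · exact ih h

/-- The tops of `T \ S` are frontier vertices of `S`, so their potentials, which bound the gain, are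
non-positive. -/
lemma sum_gain_le_of_frontier {l : ℝ} {S T : Finset ι} (hT : A.IsClosed v T)
    (hS : ∀ y ∈ A.frontier (insert v S), A.dens y ≤ l) (hv : v ∉ A.verts) :
    ∑ u ∈ T \ S, A.gain l u ≤ 0 := by
  refine (A.sum_gain_le (Finset.sdiff_subset.trans hT.1)).trans (Finset.sum_nonpos fun u hu => ?_)
  simp only [Finset.mem_filter, Finset.mem_sdiff, not_and, not_not] at hu
  obtain ⟨⟨h1, h2⟩, h3⟩ := hu
  have huv := hT.1 h1
  refine A.pot_nonpos huv (hS u (A.mem_frontier.2 ⟨huv, ?_, ?_⟩))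
  · simp only [Finset.mem_insert, not_or]
    exact ⟨fun h => hv (h ▸ huv), h2⟩
  · rcases Finset.mem_insert.1 (hT.2 u h1) with h | h
    · simp [h]
    · exact Finset.mem_insert_of_mem (h3 h)

/-- Exchange argument: `T \ S` gains nothing, and `S \ T` loses nothing, because its members have
non-negative potential and its frontier vertices are also frontier vertices for `S`. The common part
cancels. -/
lemma sum_gain_le_of_greedy {l : ℝ} {S T : Finset ι} (hT : A.IsClosed v T) (hSc : S ⊆ A.verts)
    (hS : ∀ y ∈ A.frontier (insert v S), A.dens y ≤ l) (hl : ∀ u ∈ S, l ≤ A.dens u)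
    (hv : v ∉ A.verts) : ∑ u ∈ T, A.gain l u ≤ ∑ u ∈ S, A.gain l u := by
  have h1 := sum_gain_le_of_frontier hT hS hv
  have h2 : 0 ≤ ∑ u ∈ S \ T, A.gain l u := by
    refine (Finset.sum_nonneg fun u hu => ?_).trans (A.le_sum_gain
      (Finset.sdiff_subset.trans hSc) (fun u hu _ => ?_) fun w hw => ?_)
    · have := (Finset.mem_sdiff.1 (Finset.mem_filter.1 hu).1).1
      exact A.pot_nonneg (hSc this) (hl u this)
    · have := (Finset.mem_sdiff.1 hu).1
      exact A.pot_nonneg (hSc this) (hl u this)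
    · obtain ⟨h3, h4, h5⟩ := A.mem_frontier.1 hw
      obtain ⟨h6, h7⟩ := Finset.mem_sdiff.1 h5
      have hwT : w ∉ T := fun h => by
        rcases Finset.mem_insert.1 (hT.2 w h) with h8 | h8
        · exact hv (h8 ▸ hSc h6)
        · exact h7 h8
      refine A.pot_nonpos h3 (hS w (A.mem_frontier.2 ⟨h3, ?_, by simp [h6]⟩))
      simp only [Finset.mem_insert, not_or]
      exact ⟨fun h => hv (h ▸ h3), fun h => h4 (Finset.mem_sdiff.2 ⟨h, hwT⟩)⟩
  have h3 := Finset.sum_inter_add_sum_sdiff T S (A.gain l)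
  have h4 := Finset.sum_inter_add_sum_sdiff S T (A.gain l)
  rw [Finset.inter_comm] at h4
  linarith

/-- A greedy sequence is best possible up to the cost of the path to its last element. -/
theorem IsGreedy.exists_price {vs : List ι} {w : ι} (h : A.IsGreedy v (vs ++ [w]))
    (hv : v ∉ A.verts) {P : Finset ι} (hP : A.IsClosed v P) (hPvs : P ⊆ vs.toFinset)
    (hw : A.par w ∈ insert v P) :
    ∃ l : ℝ, 0 ≤ l ∧ ∀ T, A.IsClosed v T →
      ∑ u ∈ T, A.gain l u ≤ ∑ u ∈ vs.toFinset, A.gain l u + l * ∑ u ∈ P, A.cost u := by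
  have hne : (vs ++ [w]).toFinset.Nonempty := ⟨w, by simp⟩
  -- The price is the smallest maximum ratio that occurs. As `z` was a best choice when it was
  -- picked, `σ` separates values at least `dens z` inside from values at most `dens z` on the
  -- frontier.
  obtain ⟨z, hz, hmin⟩ := (vs ++ [w]).toFinset.exists_min_image A.dens hne
  obtain ⟨σ, τ, hsplit⟩ := List.append_of_mem (List.mem_toFinset.1 hz)
  obtain ⟨-, hz2, hz3⟩ := h σ z τ hsplit
  have hσ : σ <+: vs := by
    rcases List.eq_nil_or_concat τ with rfl | ⟨τ', y, rfl⟩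
    · rw [(List.append_inj' hsplit rfl).1]
    · rw [List.concat_eq_append, ← List.cons_append, ← List.append_assoc] at hsplit
      exact ⟨_, (List.append_inj' hsplit rfl).1.symm⟩
  have hvs := h.of_append
  have hvsv := hvs.mem_verts
  have hσS : σ.toFinset ⊆ vs.toFinset := fun x hx => by
    simpa using hσ.subset (by simpa using hx)
  have hσc : A.IsClosed v σ.toFinset := by
    obtain ⟨ρ, rfl⟩ := hσ
    exact hvs.of_append.isClosed
  have hwn : w ∉ vs := fun hmem => by
    have := (A.mem_frontier.1 (h vs w [] rfl).1).2.1
    simp [hmem] at this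
  have hwv : w ∈ A.verts := h.mem_verts (by simp)
  refine ⟨A.dens z, hz3.le, fun T hT => ?_⟩
  have h1 := sum_gain_le_of_greedy hT hσc.1 hz2
    (fun u hu => hmin u (by have := hσS hu; simp at this ⊢; tauto)) hv
  have h2 := Finset.sum_sdiff (f := A.gain (A.dens z)) hσS
  have h3 := Finset.sum_inter_add_sum_sdiff (vs.toFinset \ σ.toFinset) P (A.gain (A.dens z))
  -- Off the path, the vertices bought from `z` on consist of complete cores. The point is that each
  -- such core is finished within `vs`.
  have h4 : 0 ≤ ∑ u ∈ (vs.toFinset \ σ.toFinset) \ P, A.gain (A.dens z) u := by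
    refine A.sum_gain_nonneg_of_core _ (fun u hu => hvsv ?_) fun u hu => ?_
    · exact (Finset.mem_sdiff.1 (Finset.mem_sdiff.1 hu).1).1
    simp only [Finset.mem_sdiff] at hu
    obtain ⟨⟨hu1, hu2⟩, hu3⟩ := hu
    have huv := hvsv hu1
    refine ⟨hmin u (by simp at hu1 ⊢; tauto), fun y hy => ?_⟩
    simp only [Finset.mem_sdiff]
    refine ⟨⟨?_, hσc.disjoint_core hv huv hu2 y hy⟩, hP.disjoint_core hv huv hu3 y hy⟩
    revert y
    obtain ⟨σ₁, τ₁, hs1⟩ := List.append_of_mem (List.mem_toFinset.1 hu1)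
    have hs1' : vs ++ [w] = σ₁ ++ u :: (τ₁ ++ [w]) := by rw [hs1]; simp
    obtain ⟨-, hu5, -⟩ := h _ _ _ hs1'
    -- the path contains a vertex `a` that could have been picked instead of `u`
    have hQne : (insert w P \ σ₁.toFinset).Nonempty :=
      ⟨w, by simp; exact fun hm => hwn (by rw [hs1]; simp [hm])⟩
    obtain ⟨a, ha, hamin⟩ := Finset.exists_min_image _ A.rank hQne
    simp only [Finset.mem_sdiff, Finset.mem_insert, List.mem_toFinset] at ha hamin
    have hav : a ∈ A.verts := by
      rcases ha.1 with rfl | ha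
      exacts [hwv, hP.1 ha]
    have hapar : A.par a ∈ insert v P := by
      rcases ha.1 with rfl | ha
      exacts [hw, hP.2 a ha]
    have haf : a ∈ A.frontier (insert v σ₁.toFinset) := by
      refine A.mem_frontier.2 ⟨hav, ?_, ?_⟩
      · simp only [Finset.mem_insert, List.mem_toFinset, not_or]
        exact ⟨fun e => hv (e ▸ hav), ha.2⟩
      -- The parent of `a` is the root or a path vertex of smaller rank; by minimality of `a`, the
      -- latter is already in `σ₁`.
      · by_contra hc
        simp only [Finset.mem_insert, List.mem_toFinset, not_or] at hc hapar
        have := hamin _ ⟨Or.inr (hapar.resolve_left hc.1), hc.2⟩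
        have := A.rank_par_lt a hav
        omega
    have had := hu5 a haf
    have hau : a ≠ u := by
      rintro rfl
      rcases ha.1 with rfl | ha
      · exact hwn (by simpa using hu1)
      · exact hu3 ha
    have hamem : a ∈ τ₁ ++ [w] := by
      rcases ha.1 with rfl | ha1
      · simp
      · have : a ∈ vs := by simpa using hPvs ha1
        rw [hs1] at this
        simp only [List.mem_append, List.mem_cons] at this ⊢
        tauto
    obtain ⟨σ₂, τ₂, hs2⟩ := List.append_of_mem hamem
    have hs2' : vs ++ [w] = (σ₁ ++ u :: σ₂) ++ a :: τ₂ := by rw [hs1', hs2]; simp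
    obtain ⟨-, ha5, -⟩ := h _ _ _ hs2'
    -- When `a` is picked later on, everything available has maximum ratio at most `dens a ≤ dens
    -- u`, so the core of `u` is complete by then; and `a` is picked no later than `w`.
    have hsub := A.core_subset (v := u) (S := insert v (σ₁ ++ u :: σ₂).toFinset) (by simp)
      fun y hy => (ha5 y hy).trans had
    intro y hy
    have hyv : y ≠ v := fun e => hv (e ▸ (isBranch_reach huv).2.1 hy)
    have hy' := hsub hy
    simp only [Finset.mem_insert, hyv, false_or, List.mem_toFinset] at hy'
    have hpre : σ₁ ++ u :: σ₂ <+: vs := by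
      rcases List.eq_nil_or_concat τ₂ with rfl | ⟨τ', y, rfl⟩
      · rw [(List.append_inj' hs2' rfl).1]
      · rw [List.concat_eq_append, ← List.cons_append, ← List.append_assoc] at hs2'
        exact ⟨_, (List.append_inj' hs2' rfl).1.symm⟩
    simpa using hpre.subset hy'
  -- Prizes on the path are non-negative, so the loss there is at most the price of the whole path.
  have h5 : -(A.dens z * ∑ u ∈ P, A.cost u) ≤
      ∑ u ∈ (vs.toFinset \ σ.toFinset) ∩ P, A.gain (A.dens z) u := by
    have h6 : A.dens z * ∑ u ∈ (vs.toFinset \ σ.toFinset) ∩ P, A.cost u ≤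
        A.dens z * ∑ u ∈ P, A.cost u :=
      mul_le_mul_of_nonneg_left (Finset.sum_le_sum_of_subset_of_nonneg Finset.inter_subset_right
        fun u hu _ => (A.cost_pos u (hP.1 hu)).le) hz3.le
    have h7 : 0 ≤ ∑ u ∈ (vs.toFinset \ σ.toFinset) ∩ P, A.prize u :=
      Finset.sum_nonneg fun u hu => A.prize_nonneg u (hP.1 (Finset.mem_inter.1 hu).2)
    rw [A.sum_gain]
    linarith
  linarith

end Arbor

/-! ### Rooted structure of a tree -/

namespace Network

variable {V E : Type} [DecidableEq V] [DecidableEq E]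

/-- Parents of the vertices of a rooted tree and the edges to them. -/
structure Rooting (G : Network V E) where
  par : V → V
  up : V → E
  rank : V → ℕ
  par_mem : ∀ v ∈ G.verts.erase G.root, par v ∈ G.verts
  up_mem : ∀ v ∈ G.verts.erase G.root, up v ∈ G.edges
  joins : ∀ v ∈ G.verts.erase G.root, G.Joins (up v) (par v) v
  rank_par_lt : ∀ v ∈ G.verts.erase G.root, rank (par v) < rank v
  up_inj : Set.InjOn up (G.verts.erase G.root)
  up_surj : ∀ e ∈ G.edges, ∃ v ∈ G.verts.erase G.root, up v = e

variable {G : Network V E}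

lemma Joins.unique {e : E} {a b c d : V} (h : G.Joins e a b) (h' : G.Joins e c d) :
    (a = c ∧ b = d) ∨ (a = d ∧ b = c) := by
  rcases h with h | h <;> rcases h' with h' | h' <;> rw [h] at h' <;>
    simp only [Prod.mk.injEq] at h' <;> tauto

lemma incidentToRoot_iff {e : E} {a b : V} (h : G.Joins e a b) :
    G.IncidentToRoot e ↔ a = G.root ∨ b = G.root := by
  rcases h with h | h <;> rw [IncidentToRoot, h]
  exact or_comm

namespace Rooting

/-- If the graph has one edge less than vertices, it suffices to find a parent for every vertex. -/
def ofCard (par : V → V) (up : V → E) (rank : V → ℕ)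
    (par_mem : ∀ v ∈ G.verts.erase G.root, par v ∈ G.verts)
    (up_mem : ∀ v ∈ G.verts.erase G.root, up v ∈ G.edges)
    (joins : ∀ v ∈ G.verts.erase G.root, G.Joins (up v) (par v) v)
    (rank_par_lt : ∀ v ∈ G.verts.erase G.root, rank (par v) < rank v)
    (hcard : G.edges.card + 1 = G.verts.card) : G.Rooting :=
  -- Two vertices with the same parent edge would be parents of each other, against the ranks.
  have up_inj : Set.InjOn up (G.verts.erase G.root) := by
    intro v hv w hw h
    have h1 := joins v hv
    rw [h] at h1
    rcases h1.unique (joins w hw) with h2 | h2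
    · exact h2.2
    · have h3 := rank_par_lt v hv
      have h4 := rank_par_lt w hw
      rw [h2.1] at h3
      rw [← h2.2] at h4
      omega
  { par, up, rank, par_mem, up_mem, joins, rank_par_lt, up_inj
    up_surj := by
      have h1 : (G.verts.erase G.root).image up = G.edges := by
        refine Finset.eq_of_subset_of_card_le (fun e he => ?_) ?_
        · obtain ⟨v, hv, rfl⟩ := Finset.mem_image.1 he
          exact up_mem v hv
        · rw [Finset.card_image_of_injOn up_inj, Finset.card_erase_of_mem G.root_mem]
          omega
      intro e he
      rw [← h1] at he
      simpa only [Finset.mem_image] using he }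

/-- Every tree has a rooted structure. -/
theorem nonempty [Nonempty E] (hG : G.IsTree) : Nonempty G.Rooting := by
  obtain ⟨⟨-, -, hends⟩, -, hconn, hcard⟩ := hG
  dsimp only at hends hconn hcard
  -- `near k` contains the ends of the walks with `k` edges from the root. The least such `k` serves
  -- as rank, and the last vertex but one of a shortest walk as parent.
  let near : ℕ → Set V := fun k => Nat.rec {G.root}
    (fun _ S => {w | ∃ u ∈ S, ∃ e ∈ G.edges, G.Joins e u w}) k
  have hnear : ∀ v ∈ G.verts, ∃ k, v ∈ near k := by
    intro v hv
    induction hconn v hv with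
    | refl => exact ⟨0, rfl⟩
    | @tail b c h1 h2 ih =>
      obtain ⟨e, he, hj⟩ := h2
      have hm : b ∈ G.verts := by
        rcases hj with h | h <;> have := hends e he <;> rw [h] at this
        exacts [this.1, this.2]
      obtain ⟨k, hk⟩ := ih hm
      exact ⟨k + 1, _, hk, e, he, hj⟩
  let rank : V → ℕ := fun v => sInf {k | v ∈ near k}
  have key : ∀ v ∈ G.verts.erase G.root, ∃ u e, u ∈ G.verts ∧ e ∈ G.edges ∧ G.Joins e u v ∧
      rank u < rank v := by
    intro v hv
    obtain ⟨hne, hv⟩ := Finset.mem_erase.1 hv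
    have hs : v ∈ near (rank v) := Nat.sInf_mem (hnear v hv)
    rcases hk : rank v with _ | k
    · rw [hk] at hs
      exact absurd hs hne
    · rw [hk] at hs
      obtain ⟨u, hu, e, he, hj⟩ := hs
      refine ⟨u, e, ?_, he, hj, ?_⟩
      · rcases hj with h | h <;> have := hends e he <;> rw [h] at this
        exacts [this.1, this.2]
      · exact Nat.lt_succ_of_le (Nat.sInf_le hu)
  choose! par up h using key
  exact ⟨ofCard par up rank (fun v hv => (h v hv).1) (fun v hv => (h v hv).2.1)
    (fun v hv => (h v hv).2.2.1) (fun v hv => (h v hv).2.2.2) hcard⟩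

/-- The forest of the vertices other than the root. -/
def arbor (R : G.Rooting) : Arbor V where
  verts := G.verts.erase G.root
  par := R.par
  rank := R.rank
  prize := G.prize
  cost := fun v => G.cost (R.up v)
  rank_par_lt := R.rank_par_lt
  prize_nonneg := fun v hv => G.prize_nonneg v (Finset.mem_of_mem_erase hv)
  cost_pos := fun v hv => G.cost_pos _ (R.up_mem v hv)

variable (R : G.Rooting)

lemma root_not_mem : G.root ∉ R.arbor.verts := Finset.notMem_erase _ _

/-- The rooted subgraph whose vertices other than the root are those in `S`. -/
def sub (S : Finset V) : Sub V E := ⟨insert G.root S, S.image R.up⟩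

variable {R} {S : Finset V}

lemma isClosed_verts : R.arbor.IsClosed G.root R.arbor.verts := by
  refine ⟨subset_rfl, fun u hu => ?_⟩
  rw [arbor, Finset.insert_erase G.root_mem]
  exact R.par_mem u hu

lemma isClosed_empty : R.arbor.IsClosed G.root ∅ := ⟨by simp, by simp⟩

lemma prizeOf_sub (hS : R.arbor.IsClosed G.root S) :
    G.prizeOf (R.sub S) = G.prize G.root + ∑ v ∈ S, R.arbor.prize v := by
  rw [prizeOf, sub, Finset.sum_insert fun h => R.root_not_mem (hS.1 h)]
  rfl

lemma costOf_sub (hS : R.arbor.IsClosed G.root S) :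
    G.costOf (R.sub S) = ∑ v ∈ S, R.arbor.cost v := by
  rw [costOf, sub, Finset.sum_image (R.up_inj.mono hS.1)]
  rfl

lemma isRootedSubtree_sub (hS : R.arbor.IsClosed G.root S) : G.IsRootedSubtree (R.sub S) := by
  refine ⟨⟨?_, ?_, ?_⟩, Finset.mem_insert_self _ _, ?_, ?_⟩
  · exact Finset.insert_subset G.root_mem (hS.1.trans (Finset.erase_subset _ _))
  · intro e he
    obtain ⟨v, hv, rfl⟩ := Finset.mem_image.1 he
    exact R.up_mem v (hS.1 hv)
  · intro e he
    obtain ⟨v, hv, rfl⟩ := Finset.mem_image.1 he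
    have h1 := hS.2 v hv
    have h2 : v ∈ insert G.root S := Finset.mem_insert_of_mem hv
    rcases R.joins v (hS.1 hv) with h | h <;> rw [h]
    exacts [⟨h1, h2⟩, ⟨h2, h1⟩]
  · suffices ∀ n, ∀ v ∈ insert G.root S, R.rank v = n → Relation.ReflTransGen
        (fun u w => ∃ e ∈ S.image R.up, G.Joins e u w) G.root v from fun v hv => this _ v hv rfl
    intro n
    induction n using Nat.strong_induction_on with
    | _ n ih =>
      intro v hv hn
      rcases Finset.mem_insert.1 hv with rfl | hv
      · exact .refl
      · exact (ih _ (hn ▸ R.rank_par_lt v (hS.1 hv)) _ (hS.2 v hv) rfl).tail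
          ⟨R.up v, Finset.mem_image_of_mem _ hv, R.joins v (hS.1 hv)⟩
  · rw [sub, Finset.card_image_of_injOn (R.up_inj.mono hS.1),
      Finset.card_insert_of_notMem fun h => R.root_not_mem (hS.1 h)]

/-- Every edge of `T` is the parent edge of its lower end, which lies in `T`. As `T` has one edge
less than vertices, counting forces the parent edges of all its vertices other than the root into
`T`, and with them the parents. -/
lemma exists_eq_sub {T : Sub V E} (hT : G.IsRootedSubtree T) :
    ∃ S, R.arbor.IsClosed G.root S ∧ T = R.sub S := by
  obtain ⟨⟨h1, h2, h3⟩, h4, -, h6⟩ := hT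
  have hsub : T.verts.erase G.root ⊆ G.verts.erase G.root := Finset.erase_subset_erase _ h1
  have himg : (T.verts.erase G.root).image R.up = T.edges := by
    symm
    refine Finset.eq_of_subset_of_card_le (fun e he => ?_) ?_
    · obtain ⟨v, hv, rfl⟩ := R.up_surj e (h2 he)
      have h7 : v ∈ T.verts := by
        have := h3 _ he
        rcases R.joins v hv with h | h <;> rw [h] at this
        exacts [this.2, this.1]
      exact Finset.mem_image_of_mem _ (Finset.mem_erase.2 ⟨(Finset.mem_erase.1 hv).1, h7⟩)
    · rw [Finset.card_image_of_injOn (R.up_inj.mono hsub), Finset.card_erase_of_mem h4]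
      omega
  refine ⟨T.verts.erase G.root, ⟨hsub, fun u hu => ?_⟩, ?_⟩
  · rw [Finset.insert_erase h4]
    have h7 : R.up u ∈ T.edges := himg ▸ Finset.mem_image_of_mem _ hu
    have := h3 _ h7
    rcases R.joins u (hsub hu) with h | h <;> rw [h] at this
    exacts [this.1, this.2]
  · rw [sub, Finset.insert_erase h4, himg]

lemma span_image (hS : R.arbor.IsClosed G.root S) : G.span (S.image R.up) = R.sub S := by
  ext v
  · simp only [span, sub, Finset.mem_insert, Finset.mem_union, Finset.mem_image,
      exists_exists_and_eq_and]
    constructor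
    · rintro (h | ⟨u, hu, rfl⟩ | ⟨u, hu, rfl⟩)
      · exact Or.inl h
      all_goals
        have := Finset.mem_insert.1 (hS.2 u hu)
        rcases R.joins u (hS.1 hu) with h | h <;> rw [h] <;>
          first | exact this | exact Or.inr hu
    · rintro (h | h)
      · exact Or.inl h
      · right
        rcases R.joins v (hS.1 h) with h1 | h1
        · exact Or.inr ⟨v, h, by rw [h1]⟩
        · exact Or.inl ⟨v, h, by rw [h1]⟩
  · rfl

/-! ### Contraction -/

variable (R) in
/-- The rooted structure after contraction of a subtree into the root. -/
def contract (hS : R.arbor.IsClosed G.root S) : (G.contract (R.sub S)).Rooting :=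
  have hm : ∀ v, v ∈ (insert G.root (G.verts \ insert G.root S)).erase G.root ↔
      v ∈ G.verts.erase G.root ∧ v ∉ S := by
    intro v
    simp only [Finset.mem_erase, Finset.mem_insert, Finset.mem_sdiff]
    tauto
  have hm' : ∀ v, v ∈ (insert G.root (G.verts \ insert G.root S)).erase G.root →
      v ∈ G.verts.erase G.root ∧ v ∉ S := fun v => (hm v).1
  { par := fun v => if R.par v ∈ insert G.root S then G.root else R.par v
    up := R.up
    -- Contracted parents are replaced by the root, which therefore gets a rank below all others.
    rank := fun v => if v = G.root then 0 else R.rank v + 1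
    par_mem := by
      intro v hv
      have h := R.par_mem v (hm' v hv).1
      by_cases h1 : R.par v ∈ insert G.root S
      · simp [h1, Network.contract]
      · simp only [h1, if_false, Network.contract, sub]
        exact Finset.mem_insert_of_mem (Finset.mem_sdiff.2 ⟨h, h1⟩)
    up_mem := by
      intro v hv
      have hv' := hm' v hv
      refine Finset.mem_sdiff.2 ⟨R.up_mem v hv'.1, fun h => hv'.2 ?_⟩
      obtain ⟨u, hu, he⟩ := Finset.mem_image.1 h
      rwa [← R.up_inj (hS.1 hu) hv'.1 he]
    joins := by
      intro v hv
      have hv' := hm' v hv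
      have h0 : v ∉ insert G.root S := by
        simp only [Finset.mem_insert, not_or]
        exact ⟨(Finset.mem_erase.1 hv'.1).1, hv'.2⟩
      rcases R.joins v hv'.1 with h | h
      · left
        simp only [Network.contract, sub, h, if_neg h0]
      · right
        simp only [Network.contract, sub, h, if_neg h0]
    rank_par_lt := by
      intro v hv
      have hv' := hm' v hv
      have h0 := (Finset.mem_erase.1 hv'.1).1
      have := R.rank_par_lt v hv'.1
      rw [if_neg h0]
      by_cases h1 : (if R.par v ∈ insert G.root S then G.root else R.par v) = G.root
      · rw [if_pos h1]
        omega
      · have h2 : R.par v ∉ insert G.root S := fun h => h1 (if_pos h)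
        rw [if_neg h1, if_neg h2]
        omega
    up_inj := R.up_inj.mono fun v hv => (hm' v hv).1
    up_surj := by
      intro e he
      obtain ⟨he1, he2⟩ := Finset.mem_sdiff.1 he
      obtain ⟨v, hv, rfl⟩ := R.up_surj e he1
      exact ⟨v, (hm v).2 ⟨hv, fun h => he2 (Finset.mem_image_of_mem _ h)⟩, rfl⟩ }

lemma mem_contract_verts (hS : R.arbor.IsClosed G.root S) {v : V} :
    v ∈ (R.contract hS).arbor.verts ↔ v ∈ R.arbor.verts ∧ v ∉ S := by
  simp only [arbor, Network.contract, sub, Finset.mem_erase, Finset.mem_insert, Finset.mem_sdiff]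
  tauto

lemma contract_par (hS : R.arbor.IsClosed G.root S) (v : V) :
    (R.contract hS).par v = if R.par v ∈ insert G.root S then G.root else R.par v := rfl

lemma contract_sub (hS : R.arbor.IsClosed G.root S) (D : Finset V) :
    (R.contract hS).sub D = R.sub D := rfl

/-- Closed sets of the contracted graph. -/
lemma isClosed_contract_iff (hS : R.arbor.IsClosed G.root S) {D : Finset V} :
    (R.contract hS).arbor.IsClosed (G.contract (R.sub S)).root D ↔
      D ⊆ R.arbor.verts ∧ Disjoint D S ∧ ∀ u ∈ D, R.par u ∈ insert G.root S ∨ R.par u ∈ D := by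
  have hr : (G.contract (R.sub S)).root = G.root := rfl
  rw [hr, Arbor.IsClosed]
  change D ⊆ _ ∧ (∀ u ∈ D, (R.contract hS).par u ∈ _) ↔ _
  simp only [contract_par]
  constructor
  · rintro ⟨h1, h2⟩
    refine ⟨fun v hv => ((mem_contract_verts hS).1 (h1 hv)).1,
      Finset.disjoint_left.2 fun v hv => ((mem_contract_verts hS).1 (h1 hv)).2, fun u hu => ?_⟩
    by_contra hc
    rw [not_or] at hc
    have := h2 u hu
    rw [if_neg hc.1, Finset.mem_insert] at this
    rcases this with h | h
    · exact hc.1 (by simp [h])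
    · exact hc.2 h
  · rintro ⟨h1, h2, h3⟩
    refine ⟨fun v hv => (mem_contract_verts hS).2 ⟨h1 hv, Finset.disjoint_left.1 h2 hv⟩,
      fun u hu => ?_⟩
    by_cases h : R.par u ∈ insert G.root S
    · simp [h]
    · rw [if_neg h]
      exact Finset.mem_insert_of_mem ((h3 u hu).resolve_left h)

/-- The contracted root carries no prize, so the density is a ratio in the original forest. For
empty `D` the right side is `0` by division by zero. -/
lemma density_contract (hS : R.arbor.IsClosed G.root S) {D : Finset V}
    (hD : (R.contract hS).arbor.IsClosed (G.contract (R.sub S)).root D) :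
    (G.contract (R.sub S)).density (R.sub D) = R.arbor.ratio D := by
  change (G.contract (R.sub S)).density ((R.contract hS).sub D) = _
  rw [density, prizeOf_sub hD, costOf_sub hD]
  have h1 : (G.contract (R.sub S)).prize (G.contract (R.sub S)).root = 0 := if_pos rfl
  have h2 : ∑ v ∈ D, (R.contract hS).arbor.prize v = ∑ v ∈ D, R.arbor.prize v := by
    refine Finset.sum_congr rfl fun v hv => if_neg ?_
    exact (Finset.mem_erase.1 (((isClosed_contract_iff hS).1 hD).1 hv)).1
  rw [h1, h2, zero_add]
  split_ifs with h
  · have h3 : D = ∅ := Finset.image_eq_empty.1 h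
    simp [h3, Arbor.ratio]
  · rfl

lemma totalPrize_contract (R : G.Rooting) (S : Finset V) :
    (G.contract (R.sub S)).totalPrize = ∑ v ∈ R.arbor.verts \ S, R.arbor.prize v := by
  have h0 : G.root ∉ G.verts \ insert G.root S := by simp
  have h : R.arbor.verts \ S = G.verts \ insert G.root S := by
    ext v
    simp only [arbor, Finset.mem_sdiff, Finset.mem_erase, Finset.mem_insert]
    tauto
  rw [totalPrize, h]
  simp only [Network.contract, sub]
  rw [Finset.sum_insert h0, if_pos rfl, zero_add]
  exact Finset.sum_congr rfl fun v hv => if_neg fun e : v = G.root => h0 (e ▸ hv)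

/-- A common vertex of minimum rank is not `y`, so its parent would be in `T` and in `S` as well. -/
lemma disjoint_of_isBranch (hS : R.arbor.IsClosed G.root S) {y : V} (hy : y ∉ S) {T : Finset V}
    (hT : R.arbor.IsBranch y T) : Disjoint T S := by
  rw [Finset.disjoint_iff_inter_eq_empty, ← Finset.not_nonempty_iff_eq_empty]
  intro hne
  obtain ⟨u, hu, hmin⟩ := (T ∩ S).exists_min_image R.rank hne
  obtain ⟨h1, h2⟩ := Finset.mem_inter.1 hu
  have h3 := hT.2.2 u h1 fun e => hy (e ▸ h2)
  have h4 := (Finset.mem_insert.1 (hS.2 u h2)).resolve_left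
    fun e : R.arbor.par u = G.root => R.root_not_mem (by rw [← e]; exact hT.2.1 h3)
  exact absurd (hmin _ (Finset.mem_inter.2 ⟨h3, h4⟩)) (not_le.2 (R.rank_par_lt u (hS.1 h2)))

lemma isClosed_contract_of_isBranch (hS : R.arbor.IsClosed G.root S) {y : V}
    (hy : y ∈ R.arbor.frontier (insert G.root S)) {T : Finset V} (hT : R.arbor.IsBranch y T) :
    (R.contract hS).arbor.IsClosed (G.contract (R.sub S)).root T := by
  obtain ⟨-, h2, h3⟩ := R.arbor.mem_frontier.1 hy
  refine (isClosed_contract_iff hS).2 ⟨hT.2.1, disjoint_of_isBranch hS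
    (fun h => h2 (Finset.mem_insert_of_mem h)) hT, fun u hu => ?_⟩
  by_cases h : u = y
  · exact Or.inl (h ▸ h3)
  · exact Or.inr (hT.2.2 u hu h)

lemma joins_contract (hS : R.arbor.IsClosed G.root S) {u : V} (hu : u ∈ R.arbor.verts)
    (huS : u ∉ S) : (G.contract (R.sub S)).IncidentToRoot (R.up u) ↔
      R.par u ∈ insert G.root S := by
  have h := (R.contract hS).joins u ((mem_contract_verts hS).2 ⟨hu, huS⟩)
  have h1 : u ≠ G.root := (Finset.mem_erase.1 hu).1
  change (G.contract (R.sub S)).Joins (R.up u) _ u at h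
  rw [incidentToRoot_iff h, contract_par]
  change _ = G.root ∨ u = G.root ↔ _
  simp only [h1, or_false]
  constructor
  · intro h2
    by_contra hc
    rw [if_neg hc] at h2
    exact hc (by simp [h2])
  · intro h2
    rw [if_pos h2]

/-- The edge to the root in a min-max subtree leads to a vertex whose branches have maximum ratio. -/
lemma frontier_of_isMinMax (hS : R.arbor.IsClosed G.root S) {T : Sub V E} {e : E}
    (hT : (G.contract (R.sub S)).IsMinMax T) (heT : e ∈ T.edges)
    (hinc : (G.contract (R.sub S)).IncidentToRoot e)
    (huniq : ∀ e' ∈ T.edges, (G.contract (R.sub S)).IncidentToRoot e' → e' = e) :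
    ∃ w ∈ R.arbor.frontier (insert G.root S), e = R.up w ∧
      ∀ y ∈ R.arbor.frontier (insert G.root S), R.arbor.dens y ≤ R.arbor.dens w := by
  obtain ⟨⟨h1, h2⟩, -⟩ := hT
  obtain ⟨D, hD, rfl⟩ := exists_eq_sub (R := R.contract hS) h1
  rw [contract_sub] at *
  obtain ⟨hD1, hD2, hD3⟩ := (isClosed_contract_iff hS).1 hD
  obtain ⟨w, hw, rfl⟩ := Finset.mem_image.1 heT
  have hwS := Finset.disjoint_left.1 hD2 hw
  have hwv := hD1 hw
  have hwp := (joins_contract hS hwv hwS).1 hinc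
  have hwr : w ≠ G.root := (Finset.mem_erase.1 hwv).1
  refine ⟨w, R.arbor.mem_frontier.2 ⟨hwv, by simp [hwS, hwr], hwp⟩, rfl, fun y hy => ?_⟩
  -- As `R.up w` is the only edge at the contracted root, no other vertex of `D` has its parent in
  -- the contracted part: `D` is a single branch.
  have hb : R.arbor.IsBranch w D := by
    refine ⟨hw, hD1, fun u hu hne => (hD3 u hu).resolve_left fun hp => hne ?_⟩
    exact R.up_inj (hD1 hu) hwv (huniq _ (Finset.mem_image_of_mem _ hu)
      ((joins_contract hS (hD1 hu) (Finset.disjoint_left.1 hD2 hu)).2 hp))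
  obtain ⟨Ty, hTy, he⟩ := R.arbor.exists_branch (R.arbor.mem_frontier.1 hy).1
  have hc := isClosed_contract_of_isBranch hS hy hTy
  have := h2 _ (isRootedSubtree_sub hc)
  rw [contract_sub, density_contract hS hc, density_contract hS hD, he] at this
  exact this.trans hb.ratio_le_dens

/-- If all frontier vertices have small maximum ratio, so have all subtrees. -/
lemma ratio_le_of_frontier (hS : R.arbor.IsClosed G.root S) {l : ℝ} (hl : 0 ≤ l)
    (hfr : ∀ y ∈ R.arbor.frontier (insert G.root S), R.arbor.dens y ≤ l) {D : Finset V}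
    (hD : (R.contract hS).arbor.IsClosed (G.contract (R.sub S)).root D) :
    R.arbor.ratio D ≤ l := by
  obtain ⟨hD1, hD2, hD3⟩ := (isClosed_contract_iff hS).1 hD
  -- `D` need not be closed before the contraction, but `D ∪ S` is, and removing `S` from it leaves
  -- `D`.
  have hc : R.arbor.IsClosed G.root (D ∪ S) := by
    refine ⟨Finset.union_subset hD1 hS.1, fun u hu => ?_⟩
    rcases Finset.mem_union.1 hu with h | h
    · have := hD3 u h
      simp only [Finset.mem_insert, Finset.mem_union] at this ⊢
      change R.par u = _ ∨ R.par u ∈ _ ∨ R.par u ∈ _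
      tauto
    · have := hS.2 u h
      simp only [Finset.mem_insert, Finset.mem_union] at this ⊢
      tauto
  have h := Arbor.sum_gain_le_of_frontier hc hfr R.root_not_mem
  rw [Finset.union_sdiff_right, Finset.sdiff_eq_self_of_disjoint hD2, Arbor.sum_gain] at h
  rw [Arbor.ratio]
  refine div_le_of_le_mul₀ (Finset.sum_nonneg fun u hu => (R.arbor.cost_pos u (hD1 hu)).le) hl ?_
  linarith

/-- Conversely, such a vertex comes from a min-max subtree. -/
lemma exists_isMinMax (hS : R.arbor.IsClosed G.root S) {w : V}
    (hw : w ∈ R.arbor.frontier (insert G.root S))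
    (hmax : ∀ y ∈ R.arbor.frontier (insert G.root S), R.arbor.dens y ≤ R.arbor.dens w)
    (hpos : 0 < R.arbor.dens w) :
    ∃ T, (G.contract (R.sub S)).IsMinMax T ∧ R.up w ∈ T.edges ∧
      (G.contract (R.sub S)).IncidentToRoot (R.up w) ∧
      ∀ e' ∈ T.edges, (G.contract (R.sub S)).IncidentToRoot e' → e' = R.up w := by
  classical
  obtain ⟨hwv, hwS, hwp⟩ := R.arbor.mem_frontier.1 hw
  have hwS' : w ∉ S := fun h => hwS (Finset.mem_insert_of_mem h)
  have hne : ((R.arbor.branches w).filter fun T => R.arbor.ratio T = R.arbor.dens w).Nonempty := by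
    obtain ⟨T, hT, he⟩ := R.arbor.exists_branch hwv
    exact ⟨T, Finset.mem_filter.2 ⟨R.arbor.mem_branches.2 hT, he⟩⟩
  -- Minimum cardinality among the optimal branches at `w` suffices for inclusion-wise minimality: a
  -- subtree inside `D` of the same positive density must contain `w`, so it is again a branch with
  -- top `w`.
  obtain ⟨D, hD, hmin⟩ := Finset.exists_min_image _ Finset.card hne
  obtain ⟨hD1, hD2⟩ := Finset.mem_filter.1 hD
  have hDb := R.arbor.mem_branches.1 hD1
  have hDc := isClosed_contract_of_isBranch hS hw hDb
  obtain ⟨-, hDS, -⟩ := (isClosed_contract_iff hS).1 hDc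
  have hle : ∀ T', (G.contract (R.sub S)).IsRootedSubtree T' →
      (G.contract (R.sub S)).density T' ≤ R.arbor.dens w := by
    intro T' hT'
    obtain ⟨D', hD', rfl⟩ := exists_eq_sub (R := R.contract hS) hT'
    rw [contract_sub, density_contract hS hD']
    exact ratio_le_of_frontier hS hpos.le hmax hD'
  have hroot : ∀ u ∈ D, R.par u ∈ insert G.root S → u = w := by
    intro u hu hp
    by_contra hc
    have h1 := hDb.2.2 u hu hc
    rcases Finset.mem_insert.1 hp with h | h
    · exact R.root_not_mem (h ▸ hDb.2.1 h1)
    · exact Finset.disjoint_left.1 hDS h1 h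
  refine ⟨R.sub D, ⟨⟨isRootedSubtree_sub hDc, fun T' hT' => ?_⟩, fun T' hT' hv _ => ?_⟩,
    Finset.mem_image_of_mem _ hDb.1, (joins_contract hS hwv hwS').2 hwp, fun e' he' hi => ?_⟩
  · rw [density_contract hS hDc, hD2]
    exact hle T' hT'
  · obtain ⟨D', hD', rfl⟩ := exists_eq_sub (R := R.contract hS) hT'.1
    rw [contract_sub] at *
    have hden : R.arbor.ratio D' = R.arbor.dens w := by
      rw [← density_contract hS hD']
      refine le_antisymm (hle _ hT'.1) ?_
      have := hT'.2 _ (isRootedSubtree_sub hDc)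
      rwa [contract_sub, density_contract hS hDc, hD2] at this
    obtain ⟨hD'1, hD'2, hD'3⟩ := (isClosed_contract_iff hS).1 hD'
    have hsub : D' ⊆ D := fun u hu => (Finset.mem_insert.1 (hv (Finset.mem_insert_of_mem hu))
      ).resolve_left fun e => R.root_not_mem (e ▸ hD'1 hu)
    have hD'ne : D'.Nonempty := by
      rw [Finset.nonempty_iff_ne_empty]
      rintro rfl
      simp only [Arbor.ratio, Finset.sum_empty, div_zero] at hden
      exact hpos.ne hden
    have hwD' : w ∈ D' := by
      obtain ⟨u, hu, hum⟩ := D'.exists_min_image R.rank hD'ne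
      have : R.par u ∈ insert G.root S := (hD'3 u hu).resolve_right fun h =>
        absurd (hum _ h) (not_le.2 (R.rank_par_lt u (hD'1 hu)))
      rwa [← hroot u (hsub hu) this]
    have hD'b : R.arbor.IsBranch w D' := ⟨hwD', hD'1, fun u hu hne =>
      (hD'3 u hu).resolve_left fun h => hne (hroot u (hsub hu) h)⟩
    have := hmin D' (Finset.mem_filter.2 ⟨R.arbor.mem_branches.2 hD'b, hden⟩)
    rw [Finset.eq_of_subset_of_card_le hsub this]
  · obtain ⟨u, hu, rfl⟩ := Finset.mem_image.1 he'
    rw [hroot u hu ((joins_contract hS (hDb.2.1 hu) (Finset.disjoint_left.1 hDS hu)).1 hi)]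

/-- At price `0` gains are prizes: if all frontier vertices had maximum ratio at most `0`, the total
prize left would be at most `0`. -/
lemma exists_dens_pos
    (h : (G.contract (R.sub S)).totalPrize ≠ 0) :
    ∃ y ∈ R.arbor.frontier (insert G.root S), 0 < R.arbor.dens y := by
  by_contra! hc
  have h1 := Arbor.sum_gain_le_of_frontier isClosed_verts hc R.root_not_mem
  rw [Arbor.sum_gain, zero_mul, sub_zero, ← totalPrize_contract R S] at h1
  refine h (le_antisymm h1 ?_)
  rw [totalPrize_contract R S]
  exact Finset.sum_nonneg fun u hu => R.arbor.prize_nonneg u (Finset.mem_sdiff.1 hu).1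

lemma totalPrize_ne_zero (hS : R.arbor.IsClosed G.root S) {y : V}
    (hy : y ∈ R.arbor.frontier (insert G.root S)) (hpos : 0 < R.arbor.dens y) :
    (G.contract (R.sub S)).totalPrize ≠ 0 := by
  obtain ⟨hyv, hyS, -⟩ := R.arbor.mem_frontier.1 hy
  obtain ⟨T, hT, he⟩ := R.arbor.exists_branch hyv
  rw [totalPrize_contract R S]
  have h1 : 0 < ∑ u ∈ T, R.arbor.prize u := by
    rw [← he, Arbor.ratio] at hpos
    exact (div_pos_iff_of_pos_right hT.sum_cost_pos).1 hpos
  have h2 : ∑ u ∈ T, R.arbor.prize u ≤ ∑ u ∈ R.arbor.verts \ S, R.arbor.prize u := by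
    refine Finset.sum_le_sum_of_subset_of_nonneg (fun u hu => Finset.mem_sdiff.2
      ⟨hT.2.1 hu, ?_⟩) fun u hu _ => R.arbor.prize_nonneg u (Finset.mem_sdiff.1 hu).1
    exact Finset.disjoint_left.1 (disjoint_of_isBranch hS
      (fun h => hyS (Finset.mem_insert_of_mem h)) hT) hu
  linarith

/-! ### Executions of the algorithm -/

lemma toFinset_map_up (vs : List V) : (vs.map R.up).toFinset = vs.toFinset.image R.up := by
  ext e
  simp

lemma span_greedy {vs : List V} (h : R.arbor.IsGreedy G.root vs) :
    G.span (vs.map R.up).toFinset = R.sub vs.toFinset := by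
  rw [toFinset_map_up, span_image h.isClosed]

lemma residual_greedy {vs : List V} (h : R.arbor.IsGreedy G.root vs) :
    G.residual (vs.map R.up) = G.contract (R.sub vs.toFinset) := by
  rw [residual, span_greedy h]

/-- The executions of the density-greedy algorithm are the greedy sequences of vertices. -/
theorem greedyTrace_iff {π : List E} :
    G.GreedyTrace π ↔ ∃ vs, R.arbor.IsGreedy G.root vs ∧ π = vs.map R.up := by
  constructor
  · intro h
    induction h with
    | nil => exact ⟨[], R.arbor.isGreedy_nil _, rfl⟩
    | step π T e hπ hprize hT heT hinc huniq ih =>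
      obtain ⟨vs, hvs, rfl⟩ := ih
      rw [residual_greedy hvs] at *
      obtain ⟨w, hw, rfl, hmax⟩ := frontier_of_isMinMax hvs.isClosed hT heT hinc huniq
      -- The remaining prize makes some frontier vertex positive, hence also the best one, `w`.
      obtain ⟨y, hy, hpos⟩ := exists_dens_pos hprize
      exact ⟨vs ++ [w], hvs.concat hw hmax (hpos.trans_le (hmax y hy)), by simp⟩
  · rintro ⟨vs, hvs, rfl⟩
    induction vs using List.reverseRecOn with
    | nil => exact .nil
    | append_singleton vs w ih =>
      obtain ⟨hw, hmax, hpos⟩ := hvs vs w [] rfl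
      have hvs' := hvs.of_append
      obtain ⟨T, hT, h1, h2, h3⟩ := exists_isMinMax hvs'.isClosed hw hmax hpos
      rw [List.map_append, List.map_singleton]
      rw [← residual_greedy hvs'] at hT h2 h3
      refine .step _ T _ (ih hvs') ?_ hT h1 h2 h3
      rw [residual_greedy hvs']
      exact totalPrize_ne_zero hvs'.isClosed hw hpos

/-- Complete executions of the algorithm. -/
theorem isGreedyOutput_of_frontier {vs : List V} (hvs : R.arbor.IsGreedy G.root vs)
    (h : ∀ y ∈ R.arbor.frontier (insert G.root vs.toFinset), R.arbor.dens y ≤ 0) :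
    G.IsGreedyOutput (vs.map R.up) := by
  refine ⟨greedyTrace_iff.2 ⟨vs, hvs, rfl⟩, ?_⟩
  by_contra hc
  rw [residual_greedy hvs] at hc
  obtain ⟨y, hy, hpos⟩ := exists_dens_pos hc
  exact absurd (h y hy) (not_le.2 hpos)

end Rooting

end Network

/-- Appending best frontier vertices must stop, since greedy sequences have no repetitions and stay
in `A.verts`. -/
lemma Arbor.IsGreedy.exists_complete {ι : Type} [DecidableEq ι] {A : Arbor ι} {v : ι}
    {vs : List ι} (h : A.IsGreedy v vs) :
    ∃ τ, A.IsGreedy v (vs ++ τ) ∧ ∀ y ∈ A.frontier (insert v (vs ++ τ).toFinset), A.dens y ≤ 0 := by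
  induction hn : A.verts.card - vs.length using Nat.strong_induction_on generalizing vs with
  | _ n ih =>
    by_cases hc : ∀ y ∈ A.frontier (insert v vs.toFinset), A.dens y ≤ 0
    · exact ⟨[], by simpa using h, by simpa using hc⟩
    · push Not at hc
      obtain ⟨y, hy, hpos⟩ := hc
      obtain ⟨x, hx, hmax⟩ := Finset.exists_max_image _ A.dens ⟨y, hy⟩
      have h1 := h.concat hx hmax (hpos.trans_le (hmax y hy))
      have h2 : (vs ++ [x]).length ≤ A.verts.card := by
        rw [← List.toFinset_card_of_nodup h1.nodup]
        exact Finset.card_le_card h1.mem_verts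
      rw [List.length_append, List.length_singleton] at h2
      obtain ⟨τ, h3, h4⟩ := ih (A.verts.card - (vs ++ [x]).length)
        (by rw [List.length_append, List.length_singleton]; omega) h1 rfl
      rw [List.append_assoc] at h3 h4
      exact ⟨[x] ++ τ, h3, h4⟩

namespace Network

variable {V E : Type} [DecidableEq V] [DecidableEq E] {G : Network V E}

namespace Rooting

variable {R : G.Rooting}

theorem exists_greedyOutput (R : G.Rooting) {σ : List E} (hσ : G.GreedyTrace σ) :
    ∃ τ, G.IsGreedyOutput (σ ++ τ) := by
  obtain ⟨vs, hvs, rfl⟩ := (greedyTrace_iff (R := R)).1 hσ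
  obtain ⟨τ, h1, h2⟩ := hvs.exists_complete
  exact ⟨τ.map R.up, by rw [← List.map_append]; exact isGreedyOutput_of_frontier h1 h2⟩

lemma exists_of_greedyOutput (R : G.Rooting) {π : List E} (hπ : G.IsGreedyOutput π) :
    ∃ vs, R.arbor.IsGreedy G.root vs ∧ π = vs.map R.up ∧
      ∀ v ∈ R.arbor.verts, v ∉ vs → R.arbor.prize v = 0 := by
  obtain ⟨vs, hvs, rfl⟩ := (greedyTrace_iff (R := R)).1 hπ.1
  refine ⟨vs, hvs, rfl, fun v hv hn => ?_⟩
  have h := hπ.2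
  rw [residual_greedy hvs, totalPrize_contract, Finset.sum_eq_zero_iff_of_nonneg
    fun u hu => R.arbor.prize_nonneg u (Finset.mem_sdiff.1 hu).1] at h
  exact h v (Finset.mem_sdiff.2 ⟨hv, by simpa using hn⟩)

theorem isIncrementalSolution (R : G.Rooting) {π : List E} (hπ : G.IsGreedyOutput π) :
    G.IsIncrementalSolution π := by
  obtain ⟨vs, hvs, rfl, hz⟩ := R.exists_of_greedyOutput hπ
  refine ⟨?_, fun σ hσ => ?_, fun v hv hp => ?_⟩
  · exact hvs.nodup.map_on fun x hx y hy h => R.up_inj (hvs.mem_verts (by simpa using hx))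
      (hvs.mem_verts (by simpa using hy)) h
  · have h1 := List.prefix_iff_eq_take.1 hσ
    rw [← List.map_take] at h1
    rw [h1]
    have h2 : R.arbor.IsGreedy G.root (vs.take σ.length) :=
      Arbor.IsGreedy.of_append (τ := vs.drop σ.length) (by rwa [List.take_append_drop])
    rw [span_greedy h2]
    exact isRootedSubtree_sub h2.isClosed
  · rw [span_greedy hvs, sub]
    by_contra hc
    simp only [Finset.mem_insert, List.mem_toFinset, not_or] at hc
    exact hp.ne' (hz v (Finset.mem_erase.2 ⟨hc.1, hv⟩) hc.2)

/-! ### Distances from the root -/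

/-- The cost of the path from the root to `v`. -/
def height (R : G.Rooting) (v : V) : ℝ :=
  if _h : v ∈ G.verts.erase G.root then G.cost (R.up v) + R.height (R.par v) else 0
termination_by R.rank v
decreasing_by exact R.rank_par_lt v _h

lemma height_root (R : G.Rooting) : R.height G.root = 0 := by
  rw [height, dif_neg (Finset.notMem_erase _ _)]

lemma height_eq {v : V} (hv : v ∈ G.verts.erase G.root) :
    R.height v = G.cost (R.up v) + R.height (R.par v) := by
  rw [height, dif_pos hv]

lemma isWalk_concat {u v w : V} {s : List (E × V)} {e : E} (h : G.IsWalk u s v)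
    (hw : w ∈ G.verts) (he : e ∈ G.edges) (hj : G.Joins e v w) :
    G.IsWalk u (s ++ [(e, w)]) w := by
  induction h with
  | nil u hu => exact .cons u w w e [] he hj (.nil w hw)
  | cons u x v e' s he' hj' _ ih => exact .cons u x w e' _ he' hj' (ih hj)

/-- The bound on the ranks is carried along to keep the path simple: it shows that the new end has
not been visited before. -/
lemma exists_path (R : G.Rooting) {v : V} (hv : v ∈ G.verts) : ∃ s, G.IsPath G.root s v ∧
    (∀ w ∈ G.root :: s.map Prod.snd, w = G.root ∨ R.rank w ≤ R.rank v) ∧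
    R.height v = (s.map fun a => G.cost a.1).sum := by
  induction hn : R.rank v using Nat.strong_induction_on generalizing v with
  | _ n ih =>
    by_cases h : v = G.root
    · subst h
      exact ⟨[], ⟨.nil _ hv, by simp⟩, by simp, by simp [height_root]⟩
    · have hv' : v ∈ G.verts.erase G.root := Finset.mem_erase.2 ⟨h, hv⟩
      have hr := R.rank_par_lt v hv'
      obtain ⟨s, ⟨h1, h2⟩, h3, h4⟩ := ih _ (hn ▸ hr) (R.par_mem v hv') rfl
      have hnot : v ∉ G.root :: s.map Prod.snd := fun hm => by
        rcases h3 v hm with h5 | h5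
        · exact h h5
        · omega
      refine ⟨s ++ [(R.up v, v)], ⟨isWalk_concat h1 hv (R.up_mem v hv') (R.joins v hv'), ?_⟩,
        fun w hw => ?_, ?_⟩
      · rw [List.map_append, ← List.cons_append]
        refine List.Nodup.append h2 (by simp) fun a ha hb => ?_
        simp only [List.map_cons, List.map_nil, List.mem_singleton] at hb
        exact hnot (hb ▸ ha)
      · rw [List.map_append, ← List.cons_append] at hw
        rcases List.mem_append.1 hw with hw | hw
        · rcases h3 w hw with h5 | h5
          · exact Or.inl h5
          · right
            omega
        · simp only [List.map_cons, List.map_nil, List.mem_singleton] at hw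
          right
          rw [hw, hn]
      · rw [height_eq hv', h4]
        simp [add_comm]

/-- The heights of the two ends of an edge differ by its cost, so no walk is cheaper than the
difference in height. -/
lemma height_le_of_isWalk {u v : V} {s : List (E × V)} (h : G.IsWalk u s v) :
    R.height v ≤ R.height u + (s.map fun a => G.cost a.1).sum := by
  induction h with
  | nil u hu => simp
  | cons u w v e s he hj _ ih =>
    have h1 : R.height w ≤ R.height u + G.cost e := by
      obtain ⟨x, hx, rfl⟩ := R.up_surj e he
      have h2 := height_eq (R := R) hx
      have h3 := G.cost_pos _ he
      rcases hj.unique (R.joins x hx) with ⟨h4, h5⟩ | ⟨h4, h5⟩ <;> rw [h4, h5] <;> linarith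
    simp only [List.map_cons, List.sum_cons]
    linarith

lemma isRootDist (R : G.Rooting) {v : V} (hv : v ∈ G.verts) : G.IsRootDist v (R.height v) := by
  obtain ⟨s, h1, -, h2⟩ := R.exists_path hv
  refine ⟨⟨s, h1, h2⟩, ?_⟩
  rintro c ⟨s', h3, rfl⟩
  have := height_le_of_isWalk (R := R) h3.1
  rwa [R.height_root, zero_add] at this

/-- `P` consists of the vertices other than the root on the path to `v`. Its minimality among the
closed sets reaching `v` later places it inside what the algorithm has bought. -/
lemma exists_closed_path (R : G.Rooting) {v : V} (hv : v ∈ G.verts) :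
    ∃ P, R.arbor.IsClosed G.root P ∧ v ∈ insert G.root P ∧
      (∀ S, R.arbor.IsClosed G.root S → v ∈ insert G.root S → P ⊆ S) ∧
      (∀ u ∈ P, R.rank u ≤ R.rank v) ∧ ∑ u ∈ P, R.arbor.cost u = R.height v := by
  induction hn : R.rank v using Nat.strong_induction_on generalizing v with
  | _ n ih =>
    by_cases h : v = G.root
    · subst h
      exact ⟨∅, isClosed_empty, by simp, by simp, by simp, by simp [height_root]⟩
    · have hv' : v ∈ G.verts.erase G.root := Finset.mem_erase.2 ⟨h, hv⟩
      have hr := R.rank_par_lt v hv'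
      obtain ⟨P, h1, h2, h3, h4, h5⟩ := ih _ (hn ▸ hr) (R.par_mem v hv') rfl
      have hvP : v ∉ P := fun hm => by
        have := h4 v hm
        omega
      refine ⟨insert v P, ⟨Finset.insert_subset hv' h1.1, fun u hu => ?_⟩, by simp,
        fun S hS hvS => ?_, fun u hu => ?_, ?_⟩
      · have : R.arbor.par u ∈ insert G.root P := by
          rcases Finset.mem_insert.1 hu with rfl | hu
          exacts [h2, h1.2 u hu]
        simp only [Finset.mem_insert] at this ⊢
        tauto
      · have hvS' := (Finset.mem_insert.1 hvS).resolve_left h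
        exact Finset.insert_subset hvS' (h3 S hS (hS.2 v hvS'))
      · rcases Finset.mem_insert.1 hu with rfl | hu
        · exact hn.le
        · have := h4 u hu
          omega
      · rw [Finset.sum_insert hvP, h5, height_eq hv']
        rfl

end Rooting

/-! ### Competitiveness -/

/-- The algorithm buys a maximal affordable prefix. -/
lemma exists_alg_eq {π : List E} (hπ : ∀ e ∈ π, 0 < G.cost e) {B : ℝ} (hB : 0 ≤ B) :
    ∃ k ≤ π.length, G.alg π B = G.span (π.take k).toFinset ∧ ((π.take k).map G.cost).sum ≤ B ∧
      (k < π.length → B < ((π.take (k + 1)).map G.cost).sum) := by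
  classical
  let p : ℕ → Prop := fun k => ((π.take k).map G.cost).sum ≤ B
  have h0 : p 0 := by simpa [p] using hB
  -- Costs are positive, so the affordable positions form an initial segment.
  have hmono : ∀ i j, i ≤ j → p j → p i := by
    intro i j hij hj
    refine le_trans ?_ hj
    obtain ⟨d, rfl⟩ := Nat.exists_eq_add_of_le hij
    rw [List.take_add, List.map_append, List.sum_append]
    refine le_add_of_nonneg_right (List.sum_nonneg ?_)
    intro x hx
    obtain ⟨e, he, rfl⟩ := List.mem_map.1 hx
    exact (hπ e (List.mem_of_mem_drop (List.mem_of_mem_take he))).le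
  let k := Nat.findGreatest p π.length
  have hk : p k := Nat.findGreatest_spec (Nat.zero_le _) h0
  have hkl : k ≤ π.length := Nat.findGreatest_le _
  have hlt : ∀ i < π.length, (p (i + 1) ↔ i < k) := by
    intro i hi
    constructor
    · intro h
      by_contra hc
      exact Nat.findGreatest_is_greatest (P := p) (n := π.length) (k := i + 1)
        (Nat.lt_succ_of_le (not_lt.1 hc)) hi h
    · intro h
      exact hmono _ _ h hk
  refine ⟨k, hkl, ?_, hk, fun h => ?_⟩
  · rw [alg]
    congr 1
    ext e
    simp only [Finset.mem_image, Finset.mem_filter, Finset.mem_univ, true_and, List.mem_toFinset,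
      List.mem_take_iff_getElem]
    constructor
    · rintro ⟨i, hi, rfl⟩
      exact ⟨i, by have := (hlt i i.2).1 hi; omega, rfl⟩
    · rintro ⟨i, hi, rfl⟩
      exact ⟨⟨i, by omega⟩, (hlt i (by omega)).2 (by omega), rfl⟩
  · by_contra hc
    exact absurd ((hlt k h).1 (not_lt.1 hc)) (lt_irrefl _)

/-- Let `w = vs[k]` be the first vertex beyond the budget `B + α`. As `α` covers the whole path to
`w`, the purchases cost more than `B` plus the path to the parent of `w`, and this surplus pays for
the loss in `IsGreedy.exists_price`. The bound holds with factor `1`, hence with any `μ ≥ 1`. -/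
theorem Rooting.isCompetitive (R : G.Rooting) {π : List E} (hπ : G.IsGreedyOutput π)
    {χ α μ : ℝ} (hχ : G.IsEccentricity χ) (hα : χ ≤ α) (hμ : 1 ≤ μ) : G.IsCompetitive π α μ := by
  have hheight : ∀ v ∈ G.verts, R.height v ≤ χ := fun v hv => hχ.2 ⟨v, hv, R.isRootDist hv⟩
  have hχ0 : 0 ≤ χ := R.height_root ▸ hheight _ G.root_mem
  obtain ⟨vs, hvs, rfl, hz⟩ := R.exists_of_greedyOutput hπ
  intro B hB T hT
  have hcost : ∀ e ∈ vs.map R.up, 0 < G.cost e := by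
    intro e he
    obtain ⟨v, hv, rfl⟩ := List.mem_map.1 he
    exact R.arbor.cost_pos v (hvs.mem_verts (by simpa using hv))
  obtain ⟨k, hk, halg, -, hnext⟩ := exists_alg_eq hcost (show 0 ≤ B + α by linarith)
  rw [List.length_map] at hk hnext
  obtain ⟨S, hS, rfl⟩ := exists_eq_sub (R := R) hT.1.1
  have hgr : R.arbor.IsGreedy G.root (vs.take k) :=
    Arbor.IsGreedy.of_append (τ := vs.drop k) (by rwa [List.take_append_drop])
  have hcS := hT.1.2
  rw [costOf_sub hS] at hcS
  rw [halg, ← List.map_take, span_greedy hgr, prizeOf_sub hgr.isClosed, prizeOf_sub hS]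
  have h0 : 0 ≤ G.prize G.root + ∑ v ∈ (vs.take k).toFinset, R.arbor.prize v :=
    add_nonneg (G.prize_nonneg _ G.root_mem)
      (Finset.sum_nonneg fun v hv => R.arbor.prize_nonneg v (hgr.mem_verts hv))
  refine le_trans ?_ (le_mul_of_one_le_left h0 hμ)
  refine add_le_add le_rfl ?_
  rcases hk.lt_or_eq with hlt | rfl
  · have hsplit : vs.take k ++ [vs[k]] = vs.take (k + 1) :=
      (List.take_succ_eq_append_getElem hlt).symm
    have hgr' : R.arbor.IsGreedy G.root (vs.take k ++ [vs[k]]) := by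
      rw [hsplit]
      exact Arbor.IsGreedy.of_append (τ := vs.drop (k + 1)) (by rwa [List.take_append_drop])
    obtain ⟨hw, -⟩ := hgr' _ _ _ rfl
    obtain ⟨hwv, -, hwp⟩ := R.arbor.mem_frontier.1 hw
    obtain ⟨P, hP1, hP2, hP3, -, hP5⟩ := R.exists_closed_path (R.par_mem _ hwv)
    obtain ⟨l, hl, hle⟩ := hgr'.exists_price R.root_not_mem hP1 (hP3 _ hgr.isClosed hwp) hP2
    have h1 := hle S hS
    rw [Arbor.sum_gain, Arbor.sum_gain, hP5] at h1
    have h2 := hheight _ (Finset.mem_of_mem_erase hwv)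
    rw [height_eq hwv] at h2
    have h3 : B + α < ∑ v ∈ (vs.take k).toFinset, R.arbor.cost v + G.cost (R.up vs[k]) := by
      have h4 := hnext hlt
      rw [← List.map_take, ← hsplit, List.map_append, List.map_append, List.sum_append,
        List.map_map] at h4
      rw [List.sum_toFinset _ hgr.nodup]
      change B + α < ((vs.take k).map (G.cost ∘ R.up)).sum + G.cost (R.up vs[k])
      simpa using h4
    -- By `h2`, `α` is at least the height of the parent plus the cost of the last edge. The latter
    -- cancels in `h3`, and `S` costs at most `B`.
    have h5 : l * (∑ v ∈ S, R.arbor.cost v + R.height (R.par vs[k]) -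
        ∑ v ∈ (vs.take k).toFinset, R.arbor.cost v) ≤ 0 :=
      mul_nonpos_of_nonneg_of_nonpos hl (by linarith)
    linarith
  -- The whole sequence was bought, and vertices outside of it have prize `0`.
  · rw [List.take_length]
    rw [← Finset.sum_inter_add_sum_sdiff S vs.toFinset]
    have h1 : ∑ v ∈ S \ vs.toFinset, R.arbor.prize v = 0 := Finset.sum_eq_zero fun v hv => by
      obtain ⟨h2, h3⟩ := Finset.mem_sdiff.1 hv
      exact hz v (hS.1 h2) (by simpa using h3)
    rw [h1, add_zero]
    exact Finset.sum_le_sum_of_subset_of_nonneg Finset.inter_subset_right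
      fun v hv _ => R.arbor.prize_nonneg v (hvs.mem_verts hv)

/-! ### Trees without edges -/

section NoEdges

variable [IsEmpty E]

/-- An empty type `E` needs its own treatment because a `Rooting` contains a function from the
non-empty type `V` to `E`. -/
lemma verts_eq_of_isEmpty (hG : G.IsTree) : G.verts = {G.root} := by
  obtain ⟨-, -, -, h⟩ := hG
  dsimp only at h
  rw [Finset.eq_empty_of_isEmpty G.edges, Finset.card_empty] at h
  obtain ⟨a, ha⟩ := Finset.card_eq_one.1 h.symm
  have := G.root_mem
  rw [ha, Finset.mem_singleton] at this
  rw [ha, this]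

lemma span_of_isEmpty (F : Finset E) : G.span F = ⟨{G.root}, ∅⟩ := by
  rw [Finset.eq_empty_of_isEmpty F]
  simp [span]

lemma isGreedyOutput_of_isEmpty (hG : G.IsTree) (π : List E) : G.IsGreedyOutput π := by
  obtain rfl : π = [] := List.eq_nil_iff_forall_not_mem.2 fun e => isEmptyElim e
  refine ⟨.nil, ?_⟩
  rw [residual, span_of_isEmpty, totalPrize]
  simp [contract, verts_eq_of_isEmpty hG]

lemma isIncrementalSolution_of_isEmpty (hG : G.IsTree) (π : List E) :
    G.IsIncrementalSolution π := by
  have h := verts_eq_of_isEmpty hG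
  obtain rfl : π = [] := List.eq_nil_iff_forall_not_mem.2 fun e => isEmptyElim e
  refine ⟨List.nodup_nil, fun σ _ => ?_, fun v hv _ => ?_⟩
  · rw [span_of_isEmpty]
    rw [IsTree, h, Finset.eq_empty_of_isEmpty G.edges] at hG
    exact hG
  · rw [span_of_isEmpty]
    rwa [h] at hv

lemma isCompetitive_of_isEmpty (hG : G.IsTree) (π : List E) {α μ : ℝ} (hμ : 1 ≤ μ) :
    G.IsCompetitive π α μ := by
  intro B _ T hT
  have h1 : T.verts ⊆ {G.root} := verts_eq_of_isEmpty hG ▸ hT.1.1.1.1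
  have h2 : G.prizeOf T ≤ G.prize G.root := by
    have : T.verts = {G.root} := Finset.Subset.antisymm h1 (by simpa using hT.1.1.2.1)
    simp [prizeOf, this]
  rw [alg, span_of_isEmpty]
  have h3 := G.prize_nonneg _ G.root_mem
  simp only [prizeOf, Finset.sum_singleton] at h2 ⊢
  nlinarith

end NoEdges

theorem exists_greedyOutput (hG : G.IsTree) {σ : List E} (hσ : G.GreedyTrace σ) :
    ∃ τ, G.IsGreedyOutput (σ ++ τ) := by
  cases isEmpty_or_nonempty E
  · exact ⟨[], isGreedyOutput_of_isEmpty hG _⟩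
  · obtain ⟨R⟩ := Rooting.nonempty hG
    exact R.exists_greedyOutput hσ

theorem isIncrementalSolution (hG : G.IsTree) {π : List E} (hπ : G.IsGreedyOutput π) :
    G.IsIncrementalSolution π := by
  cases isEmpty_or_nonempty E
  · exact isIncrementalSolution_of_isEmpty hG _
  · obtain ⟨R⟩ := Rooting.nonempty hG
    exact R.isIncrementalSolution hπ

theorem isCompetitive (hG : G.IsTree) {π : List E} (hπ : G.IsGreedyOutput π)
    {χ α μ : ℝ} (hχ : G.IsEccentricity χ) (hα : χ ≤ α) (hμ : 1 ≤ μ) : G.IsCompetitive π α μ := by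
  cases isEmpty_or_nonempty E
  · exact isCompetitive_of_isEmpty hG _ hμ
  · obtain ⟨R⟩ := Rooting.nonempty hG
    exact R.isCompetitive hπ hχ hα hμ

/-! ### The lower bound -/

/-- A star with two leaves, of which the first one is more expensive and has a larger prize. -/
def star (χ ε M : ℝ) (hχ : 0 < χ) (hε : 0 < ε) (hM : 0 ≤ M) : Network (Fin 3) (Fin 2) where
  verts := Finset.univ
  edges := Finset.univ
  ends := fun e => (0, e.succ)
  root := 0
  cost := ![χ, ε]
  prize := ![0, M, 1]
  root_mem := Finset.mem_univ _
  ends_mem := by simp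
  cost_pos := by
    intro e _
    fin_cases e
    exacts [hχ, hε]
  prize_nonneg := by
    intro v _
    fin_cases v
    exacts [le_rfl, hM, zero_le_one]

section Star

variable {χ ε M : ℝ} {hχ : 0 < χ} {hε : 0 < ε} {hM : 0 ≤ M}

variable (χ ε M hχ hε hM) in
/-- The rooted structure of the star. -/
def starRooting : (star χ ε M hχ hε hM).Rooting :=
  Rooting.ofCard (fun _ => 0) ![0, 0, 1] ![0, 1, 1] (by simp [star]) (by simp [star])
    (by
      intro v hv
      have h : v ≠ 0 := (Finset.mem_erase.1 hv).1
      left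
      fin_cases v
      · exact absurd rfl h
      · rfl
      · rfl)
    (by
      intro v hv
      have h : v ≠ 0 := (Finset.mem_erase.1 hv).1
      fin_cases v
      · exact absurd rfl h
      · simp
      · simp)
    (by simp [star])

lemma star_arbor_verts : (starRooting χ ε M hχ hε hM).arbor.verts = {1, 2} := by
  change Finset.univ.erase 0 = _
  decide

lemma star_isTree : (star χ ε M hχ hε hM).IsTree := by
  have h := Rooting.isRootedSubtree_sub
    (Rooting.isClosed_verts (R := starRooting χ ε M hχ hε hM))
  have h1 : (starRooting χ ε M hχ hε hM).sub (starRooting χ ε M hχ hε hM).arbor.verts =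
      ⟨Finset.univ, Finset.univ⟩ := by
    rw [star_arbor_verts, Rooting.sub]
    change (⟨insert 0 {1, 2}, Finset.image ![0, 0, 1] {1, 2}⟩ : Sub (Fin 3) (Fin 2)) = _
    congr 1
  rw [h1] at h
  exact h

lemma star_isEccentricity (h : ε ≤ χ) : (star χ ε M hχ hε hM).IsEccentricity χ := by
  let R := starRooting χ ε M hχ hε hM
  have hr : ∀ v, R.par v = (star χ ε M hχ hε hM).root := fun _ => rfl
  have h1 : ∀ v ∈ (star χ ε M hχ hε hM).verts.erase (star χ ε M hχ hε hM).root,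
      R.height v = (star χ ε M hχ hε hM).cost (R.up v) := fun v hv => by
    rw [Rooting.height_eq hv, hr, R.height_root, add_zero]
  have hm : ∀ v : Fin 3, v ≠ 0 → v ∈
      (star χ ε M hχ hε hM).verts.erase (star χ ε M hχ hε hM).root := fun v hv =>
    Finset.mem_erase.2 ⟨hv, Finset.mem_univ _⟩
  constructor
  · refine ⟨1, Finset.mem_univ _, ?_⟩
    have := R.isRootDist (v := 1) (Finset.mem_univ _)
    rwa [h1 1 (hm 1 (by decide))] at this
  · rintro x ⟨v, hv, hx⟩
    rw [hx.unique (R.isRootDist hv)]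
    fin_cases v
    · exact R.height_root.le.trans hχ.le
    · exact (h1 1 (hm 1 (by decide))).le
    · exact (h1 2 (hm 2 (by decide))).le.trans h

/-- By `χ < ε * M` the expensive leaf is denser and comes first in every output. The budget `ε + α <
χ` does not pay for it, so the algorithm earns `0`, whereas the budget `ε` buys the other leaf, of
prize `1`. No factor `μ` helps. -/
lemma star_not_isCompetitive {α μ : ℝ} (hα : 0 ≤ α) (h : ε + α < χ) (hd : χ < ε * M)
    {π : List (Fin 2)} (hπ : (star χ ε M hχ hε hM).IsGreedyOutput π) :
    ¬ (star χ ε M hχ hε hM).IsCompetitive π α μ := by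
  intro hc
  let R := starRooting χ ε M hχ hε hM
  have hv : R.arbor.verts = {1, 2} := star_arbor_verts
  have hpar : ∀ v, R.arbor.par v = 0 := fun _ => rfl
  have hp1 : R.arbor.prize 1 = M := rfl
  have hp2 : R.arbor.prize 2 = 1 := rfl
  have hc1 : R.arbor.cost 1 = χ := rfl
  have hc2 : R.arbor.cost 2 = ε := rfl
  have hd1 : M / χ ≤ R.arbor.dens 1 := by
    have : R.arbor.IsBranch 1 {1} := ⟨by simp, by simp [hv], by simp⟩
    simpa [Arbor.ratio, hp1, hc1] using this.ratio_le_dens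
  have hd2 : R.arbor.dens 2 = 1 / ε := by
    obtain ⟨T, hT, he⟩ := R.arbor.exists_branch (v := 2) (by simp [hv])
    have : T = {2} := by
      refine Finset.eq_singleton_iff_unique_mem.2 ⟨hT.1, fun u hu => ?_⟩
      by_contra hne
      have := hT.2.1 (hT.2.2 u hu hne)
      rw [hpar, hv] at this
      revert this
      decide
    rw [← he, this]
    simp [Arbor.ratio, hp2, hc2]
  have hd12 : R.arbor.dens 2 < R.arbor.dens 1 := by
    refine lt_of_lt_of_le ?_ hd1
    rw [hd2, div_lt_div_iff₀ hε hχ]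
    linarith
  obtain ⟨vs, hvs, rfl, hz⟩ := R.exists_of_greedyOutput hπ
  have hcost : ∀ e ∈ vs.map R.up, 0 < (star χ ε M hχ hε hM).cost e := by
    intro e _
    exact (star χ ε M hχ hε hM).cost_pos e (Finset.mem_univ _)
  obtain ⟨k, hk, halg, hbudget, -⟩ := exists_alg_eq hcost (show 0 ≤ ε + α by linarith)
  have hk0 : k = 0 := by
    by_contra hk0
    rcases vs with _ | ⟨x, τ⟩
    · simp at hk
      exact hk0 hk
    obtain ⟨hx, hmax, -⟩ := hvs [] x τ rfl
    obtain ⟨hxv, -, -⟩ := R.arbor.mem_frontier.1 hx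
    have h1 : (1 : Fin 3) ∈ R.arbor.frontier (insert (star χ ε M hχ hε hM).root [].toFinset) := by
      refine R.arbor.mem_frontier.2 ⟨by simp [hv], ?_, ?_⟩
      · change (1 : Fin 3) ∉ insert 0 [].toFinset
        decide
      · change (0 : Fin 3) ∈ insert 0 [].toFinset
        decide
    have hx1 : x = 1 := by
      rw [hv] at hxv
      simp only [Finset.mem_insert, Finset.mem_singleton] at hxv
      refine hxv.resolve_right ?_
      rintro rfl
      exact absurd (hmax 1 h1) (not_le.2 hd12)
    obtain ⟨j, rfl⟩ := Nat.exists_eq_succ_of_ne_zero hk0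
    rw [hx1, List.map_cons, List.take_succ_cons, List.map_cons, List.sum_cons] at hbudget
    have h2 : 0 ≤ (((τ.map R.up).take j).map (star χ ε M hχ hε hM).cost).sum := by
      refine List.sum_nonneg fun y hy => ?_
      obtain ⟨e, -, rfl⟩ := List.mem_map.1 hy
      exact ((star χ ε M hχ hε hM).cost_pos e (Finset.mem_univ _)).le
    have h3 : (star χ ε M hχ hε hM).cost (R.up 1) = χ := rfl
    linarith
  have hS : R.arbor.IsClosed (star χ ε M hχ hε hM).root {2} :=
    ⟨by simp [hv], fun u _ => Finset.mem_insert.2 (Or.inl (hpar u))⟩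
  have hopt : (star χ ε M hχ hε hM).IsOpt ε (R.sub {2}) := by
    refine ⟨⟨Rooting.isRootedSubtree_sub hS, ?_⟩, fun T' hT' hle => ?_⟩
    · rw [Rooting.costOf_sub hS, Finset.sum_singleton, hc2]
    · obtain ⟨S', hS', rfl⟩ := Rooting.exists_eq_sub (R := R) hT'
      rw [Rooting.costOf_sub hS'] at hle
      rw [Rooting.prizeOf_sub hS', Rooting.prizeOf_sub hS]
      refine add_le_add le_rfl ?_
      refine Finset.sum_le_sum_of_subset_of_nonneg (fun u hu => ?_) fun u hu _ => ?_
      · have h1 := hS'.1 hu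
        rw [hv] at h1
        simp only [Finset.mem_insert, Finset.mem_singleton] at h1 ⊢
        refine h1.resolve_left ?_
        rintro rfl
        have := Finset.single_le_sum (f := R.arbor.cost)
          (fun v hv => (R.arbor.cost_pos v (hS'.1 hv)).le) hu
        linarith
      · exact R.arbor.prize_nonneg u (hS.1 hu)
  have h1 := hc ε hε.le _ hopt
  rw [halg, hk0, Rooting.prizeOf_sub hS, Finset.sum_singleton, hp2] at h1
  have h2 : (star χ ε M hχ hε hM).prize (star χ ε M hχ hε hM).root = 0 := rfl
  simp [prizeOf, span, h2] at h1
  linarith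

end Star

end Network

/-- The characterisation of competitiveness, for every rule of choosing among the min-max subtrees. -/
theorem Algorithm.IsDensityGreedy.isCompetitiveOnTrees_iff {A : Algorithm}
    (hA : A.IsDensityGreedy) {χ α μ : ℝ} (hα : 0 ≤ α) (hμ : 1 ≤ μ) :
    A.IsCompetitiveOnTrees χ α μ ↔ χ ≤ α := by
  constructor
  · intro h
    by_contra! hlt
    -- With `ε` half the gap, `ε + α < χ`; the choice `M = χ / ε + 1` gives `ε * M = χ + ε`.
    have hε : 0 < (χ - α) / 2 := by linarith
    have hχ : 0 < χ := by linarith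
    have hM : 0 ≤ χ / ((χ - α) / 2) + 1 := by positivity
    refine Network.star_not_isCompetitive (hχ := hχ) (hε := hε) (hM := hM) (μ := μ) hα (by linarith)
      ?_ (hA _ _ _ Network.star_isTree)
      (h _ _ _ Network.star_isTree (Network.star_isEccentricity (by linarith)))
    rw [mul_add, mul_div_cancel₀ _ hε.ne']
    linarith
  · intro h V E _ _ G hG hχ
    exact Network.isCompetitive hG (hA V E G hG) hχ h hμ

/-! ### Reasoning about programs -/

/-- All numbers in the memory have at most `b` bits. -/
def Bounded (b : ℕ) (s : Mem) : Prop := ∀ j i, (s j i).size ≤ b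

/-- Memory with one cell changed. -/
def Mem.set (s : Mem) (j i a : ℕ) : Mem := Function.update s j (Function.update (s j) i a)

lemma Mem.set_apply (s : Mem) (j i a j' i' : ℕ) :
    s.set j i a j' i' = if j' = j ∧ i' = i then a else s j' i' := by
  by_cases h : j' = j
  · subst h
    by_cases h' : i' = i
    · subst h'
      simp [Mem.set]
    · simp [Mem.set, h']
  · simp [Mem.set, h]

lemma Mem.set_other (s : Mem) (j i a : ℕ) {j' : ℕ} (h : j' ≠ j) : s.set j i a j' = s j' := by
  simp [Mem.set, h]

lemma Bounded.set {b : ℕ} {s : Mem} (hs : Bounded b s) {j i a : ℕ} (ha : a.size ≤ b) :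
    Bounded b (s.set j i a) := by
  intro j' i'
  rw [Mem.set_apply]
  split_ifs
  exacts [ha, hs j' i']

/-- Up to a factor `b + 1`, the number of bits of the value of a term in a memory with `b`-bit
numbers. -/
def Term.valueWeight : Term → ℕ
  | .const k => k.size
  | .read _ _ => 1
  | .op _ a b => a.valueWeight + b.valueWeight + 1

/-- Up to a factor `b + 1`, the time for evaluating a term in a memory with `b`-bit numbers. -/
def Term.timeWeight : Term → ℕ
  | .const k => k.size + 1
  | .read _ i => i.timeWeight + i.valueWeight + 2
  | .op _ a b => a.timeWeight + b.timeWeight + a.valueWeight + b.valueWeight +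
      (a.valueWeight + b.valueWeight + 1) + 1

lemma Op.size_apply_le (o : Op) (a b : ℕ) : (o.apply a b).size ≤ a.size + b.size + 1 := by
  have ha := Nat.lt_size_self a
  have hb := Nat.lt_size_self b
  cases o with
  | add =>
    refine Nat.size_le.2 ?_
    have h1 : (2 : ℕ) ^ a.size ≤ 2 ^ (a.size + b.size) := Nat.pow_le_pow_right (by norm_num) (by omega)
    have h2 : (2 : ℕ) ^ b.size ≤ 2 ^ (a.size + b.size) := Nat.pow_le_pow_right (by norm_num) (by omega)
    rw [pow_succ]
    simp only [Op.apply]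
    omega
  | sub => exact (Nat.size_le_size (Nat.sub_le a b)).trans (by omega)
  | mul =>
    refine Nat.size_le.2 ?_
    rw [pow_succ, pow_add]
    have := Nat.mul_lt_mul'' ha hb
    simp only [Op.apply]
    omega
  | div => exact (Nat.size_le_size (Nat.div_le_self a b)).trans (by omega)

lemma Term.size_eval_le {b : ℕ} {s : Mem} (hs : Bounded b s) (t : Term) :
    (t.eval s).size ≤ t.valueWeight * (b + 1) := by
  induction t with
  | const k => exact Nat.le_mul_of_pos_right _ (Nat.succ_pos b)
  | read j i => exact (hs j _).trans (by simp [valueWeight])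
  | op o x y hx hy =>
    refine (o.size_apply_le _ _).trans ?_
    simp only [valueWeight, add_mul]
    omega

lemma Term.time_le {b : ℕ} {s : Mem} (hs : Bounded b s) (t : Term) :
    t.time s ≤ t.timeWeight * (b + 1) := by
  induction t with
  | const k => exact Nat.le_mul_of_pos_right _ (Nat.succ_pos b)
  | read j i hi =>
    have h1 := i.size_eval_le hs
    have h2 := hs j (i.eval s)
    simp only [time, timeWeight, add_mul]
    omega
  | op o x y hx hy =>
    have h1 := x.size_eval_le hs
    have h2 := y.size_eval_le hs
    have h3 := Term.size_eval_le hs (.op o x y)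
    simp only [time, timeWeight, add_mul, eval, valueWeight] at *
    omega

open Polynomial in
/-- Up to a factor `b + 1`, the time of a program in which every execution of a loop makes at most
`X` iterations and in which all numbers have at most `b` bits. -/
def Prog.bound : Prog → Polynomial ℕ
  | .skip => 1
  | .write _ i a => C (i.timeWeight + a.timeWeight + i.valueWeight + a.valueWeight + 1)
  | .seq p q => p.bound + q.bound + 1
  | .ite c p q => C c.timeWeight + p.bound + q.bound + 1
  | .loop c p => (X + 1) * C (c.timeWeight + 1) + X * p.bound

/-- The program `p`, started in `s`, halts in a memory with property `Q`, in the time that is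
guaranteed if all loops make at most `m` iterations and all numbers have at most `b` bits. -/
def Runs (m b : ℕ) (p : Prog) (s : Mem) (Q : Mem → Prop) : Prop :=
  Bounded b s → ∃ t s', Exec p s t s' ∧ t ≤ p.bound.eval m * (b + 1) ∧ Bounded b s' ∧ Q s'

section Runs

variable {m b : ℕ} {p q : Prog} {s : Mem} {Q Q' : Mem → Prop}

lemma Runs.mono (h : Runs m b p s Q) (hQ : ∀ s', Q s' → Q' s') : Runs m b p s Q' := by
  intro hs
  obtain ⟨t, s', h1, h2, h3, h4⟩ := h hs
  exact ⟨t, s', h1, h2, h3, hQ _ h4⟩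

lemma runs_skip (h : Q s) : Runs m b .skip s Q := fun hs =>
  ⟨1, s, .skip s, by simp [Prog.bound], hs, h⟩

lemma runs_write {j : ℕ} {i a : Term} (ha : (a.eval s).size ≤ b)
    (h : Q (s.set j (i.eval s) (a.eval s))) : Runs m b (.write j i a) s Q := by
  intro hs
  refine ⟨_, _, .write s j i a, ?_, hs.set ha, h⟩
  have h1 := i.time_le hs
  have h2 := a.time_le hs
  have h3 := i.size_eval_le hs
  have h4 := a.size_eval_le hs
  simp only [Prog.bound, Polynomial.eval_C, add_mul]
  omega

lemma runs_seq (h : Runs m b p s fun s' => Runs m b q s' Q) : Runs m b (.seq p q) s Q := by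
  intro hs
  obtain ⟨t, s', h1, h2, h3, h4⟩ := h hs
  obtain ⟨t', s'', h5, h6, h7, h8⟩ := h4 h3
  refine ⟨_, s'', .seq p q s s' s'' t t' h1 h5, ?_, h7, h8⟩
  simp only [Prog.bound, Polynomial.eval_add, Polynomial.eval_one, add_mul]
  omega

lemma runs_ite {c : Term} (h1 : c.eval s ≠ 0 → Runs m b p s Q)
    (h2 : c.eval s = 0 → Runs m b q s Q) : Runs m b (.ite c p q) s Q := by
  intro hs
  have hc := c.time_le hs
  by_cases h : c.eval s = 0
  · obtain ⟨t, s', h3, h4, h5, h6⟩ := h2 h hs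
    refine ⟨_, s', .ite_false c p q s s' t h h3, ?_, h5, h6⟩
    simp only [Prog.bound, Polynomial.eval_add, Polynomial.eval_one, Polynomial.eval_C, add_mul]
    omega
  · obtain ⟨t, s', h3, h4, h5, h6⟩ := h1 h hs
    refine ⟨_, s', .ite_true c p q s s' t h h3, ?_, h5, h6⟩
    simp only [Prog.bound, Polynomial.eval_add, Polynomial.eval_one, Polynomial.eval_C, add_mul]
    omega

/-- `I k` is the invariant with at most `k` rounds to go. Stopping while `k` is still positive is
allowed, so the number of rounds need not be known in advance. -/
lemma runs_loop {c : Term} (I : ℕ → Mem → Prop)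
    (hI : ∀ k s, I k s → (c.eval s = 0 ∧ Q s) ∨
      (c.eval s ≠ 0 ∧ ∃ k', k = k' + 1 ∧ Runs m b p s (I k')))
    {k : ℕ} (hk : k ≤ m) (h : I k s) : Runs m b (.loop c p) s Q := by
  have key : ∀ k s, I k s → Bounded b s → ∃ t s', Exec (.loop c p) s t s' ∧
      t ≤ ((k + 1) * (c.timeWeight + 1) + k * p.bound.eval m) * (b + 1) ∧ Bounded b s' ∧ Q s' := by
    intro k
    induction k with
    | zero =>
      intro s h hs
      rcases hI 0 s h with ⟨h1, h2⟩ | ⟨-, k', hk', -⟩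
      · refine ⟨_, s, .loop_done c p s h1, ?_, hs, h2⟩
        have := c.time_le hs
        simp only [add_mul, one_mul]
        omega
      · omega
    | succ k ih =>
      intro s h hs
      have hc := c.time_le hs
      rcases hI _ s h with ⟨h1, h2⟩ | ⟨h1, k', hk', h2⟩
      · refine ⟨_, s, .loop_done c p s h1, ?_, hs, h2⟩
        simp only [add_mul, one_mul]
        omega
      · obtain rfl : k = k' := by omega
        obtain ⟨t, s', h3, h4, h5, h6⟩ := h2 hs
        obtain ⟨t', s'', h7, h8, h9, h10⟩ := ih s' h6 h5
        refine ⟨_, s'', .loop_step c p s s' s'' t t' h1 h3 h7, ?_, h9, h10⟩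
        simp only [add_mul, one_mul] at *
        omega
  intro hs
  obtain ⟨t, s', h1, h2, h3, h4⟩ := key k s h hs
  refine ⟨t, s', h1, h2.trans (Nat.mul_le_mul_right _ ?_), h3, h4⟩
  simp only [Prog.bound, Polynomial.eval_add, Polynomial.eval_mul, Polynomial.eval_X,
    Polynomial.eval_one, Polynomial.eval_C]
  gcongr

end Runs

/-! ### Notation for terms and programs -/

instance : Add Term := ⟨.op .add⟩
instance : _root_.Sub Term := ⟨.op .sub⟩
instance : Mul Term := ⟨.op .mul⟩
instance : Div Term := ⟨.op .div⟩
instance (k : ℕ) : OfNat Term k := ⟨.const k⟩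

section Eval

variable (s : Mem) (x y : Term)

lemma Term.eval_add : (x + y).eval s = x.eval s + y.eval s := rfl
lemma Term.eval_sub : (x - y).eval s = x.eval s - y.eval s := rfl
lemma Term.eval_mul : (x * y).eval s = x.eval s * y.eval s := rfl
lemma Term.eval_div : (x / y).eval s = x.eval s / y.eval s := rfl
lemma Term.eval_ofNat (k : ℕ) : (no_index (OfNat.ofNat k) : Term).eval s = k := rfl
lemma Term.eval_read (j : ℕ) : (Term.read j x).eval s = s j (x.eval s) := rfl

end Eval

/-- The value of the variable with number `j`: the first cell of array `j`. -/
def var (j : ℕ) : Term := .read j 0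

/-- Assignment to a variable. -/
def assign (j : ℕ) (a : Term) : Prog := .write j 0 a

lemma eval_var (s : Mem) (j : ℕ) : (var j).eval s = s j 0 := rfl

lemma runs_assign {m b : ℕ} {s : Mem} {Q : Mem → Prop} {j : ℕ} {a : Term} {x : ℕ}
    (hx : a.eval s = x) (ha : x.size ≤ b) (h : Q (s.set j 0 x)) : Runs m b (assign j a) s Q := by
  subst hx
  exact runs_write ha h

lemma runs_write' {m b : ℕ} {s : Mem} {Q : Mem → Prop} {j : ℕ} {i a : Term} {y x : ℕ}
    (hy : i.eval s = y) (hx : a.eval s = x) (ha : x.size ≤ b) (h : Q (s.set j y x)) :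
    Runs m b (.write j i a) s Q := by
  subst hx hy
  exact runs_write ha h

/-- Counting loop: the variable `j` runs from `0` to `N - 1`. -/
def forLoop (j : ℕ) (N : Term) (p : Prog) : Prog :=
  .seq (assign j 0) (.loop (N - var j) (.seq p (assign j (var j + 1))))

/-- The counter lives in memory: the body has to leave it as it was, and the invariant is demanded
after the increment. -/
lemma runs_for {m b : ℕ} {s : Mem} {Q : Mem → Prop} {j : ℕ} {N : Term} {p : Prog} {n : ℕ}
    (hn : n ≤ m) (hb : n.size ≤ b) (I : ℕ → Mem → Prop) (h0 : I 0 (s.set j 0 0))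
    (hN : ∀ i s, I i s → N.eval s = n)
    (hI : ∀ i s, i < n → s j 0 = i → I i s →
      Runs m b p s fun s' => s' j 0 = i ∧ I (i + 1) (s'.set j 0 (i + 1)))
    (hQ : ∀ s, I n s → Q s) : Runs m b (forLoop j N p) s Q := by
  refine runs_seq (runs_assign (x := 0) rfl (by simp) ?_)
  refine runs_loop (fun k s => k ≤ n ∧ s j 0 = n - k ∧ I (n - k) s) (k := n) ?_ hn
    ⟨le_rfl, by simp [Mem.set_apply], by simpa using h0⟩
  rintro k s ⟨hk, hj, hs⟩
  rw [Term.eval_sub, hN _ _ hs, eval_var, hj]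
  rcases k with _ | k
  · left
    exact ⟨by omega, hQ _ (by simpa using hs)⟩
  · right
    refine ⟨by omega, k, rfl, runs_seq ((hI _ s (by omega) hj hs).mono ?_)⟩
    rintro s' ⟨h1, h2⟩
    have h3 : n - (k + 1) + 1 = n - k := by omega
    rw [h3] at h2
    refine runs_assign (x := n - k) ?_ ((Nat.size_le_size (Nat.sub_le _ _)).trans hb)
      ⟨by omega, ?_, h2⟩
    · rw [Term.eval_add, eval_var, h1, ← h3]
      rfl
    · simp [Mem.set_apply]

/-- Makes the bound on all cells available while `p` is verified, for instance when a cell is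
copied. -/
lemma Runs.of_bounded {m b : ℕ} {p : Prog} {s : Mem} {Q : Mem → Prop}
    (h : Bounded b s → Runs m b p s Q) : Runs m b p s Q := fun hs => h hs hs

/-- Only the arrays in `F` have been changed. -/
def Frame (F : List ℕ) (s s' : Mem) : Prop := ∀ j, j ∉ F → s' j = s j

section Frame

variable {F F' : List ℕ} {s s' s'' : Mem}

lemma Frame.refl (F : List ℕ) (s : Mem) : Frame F s s := fun _ _ => rfl

lemma Frame.trans (h : Frame F s s') (h' : Frame F' s' s'') (hF : F' ⊆ F) : Frame F s s'' :=
  fun j hj => (h' j fun hm => hj (hF hm)).trans (h j hj)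

lemma Frame.mono (h : Frame F s s') (hF : F ⊆ F') : Frame F' s s' :=
  fun j hj => h j fun hm => hj (hF hm)

lemma Frame.set (h : Frame F s s') {j : ℕ} (hj : j ∈ F) (i a : ℕ) : Frame F s (s'.set j i a) :=
  fun j' hj' => by rw [Mem.set_other _ _ _ _ (fun e => hj' (by rwa [e])), h j' hj']

end Frame

/-- Non-zero if the values are different. -/
def neT (a b : Term) : Term := a - b + (b - a)

/-- Non-zero if the values are equal. -/
def eqT (a b : Term) : Term := 1 - neT a b

/-- Non-zero if the value of `a` is smaller. -/
def ltT (a b : Term) : Term := b - a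

lemma eval_neT (s : Mem) (a b : Term) :
    (neT a b).eval s = a.eval s - b.eval s + (b.eval s - a.eval s) := rfl

lemma eval_eqT (s : Mem) (a b : Term) : (eqT a b).eval s = 1 - (neT a b).eval s := rfl

lemma eval_ltT (s : Mem) (a b : Term) : (ltT a b).eval s = b.eval s - a.eval s := rfl

/-! ### Computing the maximum ratios and the greedy sequence

Use of the memory: the number of vertices is in the first cell of array `0`; the arrays `4`, `5`,
`6`, `7` contain, for every vertex, the parent, the edge to the parent, the prize, and the cost;
array `8` lists the vertices such that parents precede their children. Numerators and denominators
of the maximum ratios are in the arrays `10` and `11`. Array `12` marks the vertices that have been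
reached from the current vertex, which is in variable `25`. Variables `16`, `17`, `18` contain the
best candidate (plus one) and its ratio, variables `19` and `20` total prize and cost of the current
branch, variables `21` and `22` those of the best branch, variable `23` the number of vertices that
have been appended, and variable `24` is zero at the end. -/

/-- Selection of the best vertex that can be appended. -/
def selectProg : Prog :=
  -- The initial fraction is `0 / 1`, so only vertices of positive ratio can be selected.
  .seq (assign 16 0) <| .seq (assign 17 0) <| .seq (assign 18 1) <|
  forLoop 15 (.read 0 0)
    -- A product of tests is their conjunction: the parent is marked, the vertex is not, and its
    -- ratio beats the best one so far by cross multiplication.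
    (.ite (eqT (.read 12 (.read 4 (var 15))) (var 25 + 1) * neT (.read 12 (var 15)) (var 25 + 1) *
        ltT (var 17 * .read 11 (var 15)) (.read 10 (var 15) * var 18))
      (.seq (assign 16 (var 15 + 1)) (.seq (assign 17 (.read 10 (var 15)))
        (assign 18 (.read 11 (var 15)))))
      .skip)

/-- One step of the greedy procedure. -/
def extendProg : Prog :=
  .seq selectProg (.ite (var 16)
    (.seq (assign 23 (var 23 + 1)) <| .seq (.write 12 (var 16 - 1) (var 25 + 1)) <|
      .seq (assign 19 (var 19 + .read 6 (var 16 - 1))) <|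
      .seq (assign 20 (var 20 + .read 7 (var 16 - 1))) <|
      .seq (.write 1 (var 23) (.read 5 (var 16 - 1))) <|
      .ite (ltT (var 21 * var 20) (var 19 * var 22))
        (.seq (assign 21 (var 19)) (assign 22 (var 20))) .skip)
    (assign 24 0))

/-- The greedy procedure for the branches below the current vertex. -/
def greedyProg : Prog :=
  -- The mark is specific to the current vertex and never `0`, so array `12` need not be cleared
  -- between runs.
  .seq (.write 12 (var 25) (var 25 + 1)) <| .seq (assign 19 (.read 6 (var 25))) <|
  .seq (assign 20 (.read 7 (var 25))) <| .seq (assign 21 (var 19)) <| .seq (assign 22 (var 20)) <|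
  .seq (assign 23 0) <| .seq (assign 24 1) <| .seq (.loop (var 24) extendProg) <|
  .seq (.write 10 (var 25) (var 21)) (.write 11 (var 25) (var 22))

/-- The greedy procedure for all vertices in reverse order. -/
def orderProg : Prog :=
  -- Reverse order: descendants come before their ancestors, and the root comes last, so that its
  -- sequence is what remains in array `1`.
  .seq (forLoop 13 (.read 0 0) (.seq (assign 25 (.read 8 (.read 0 0 - 1 - var 13))) greedyProg))
    (.write 1 0 (var 23))

/-! ### Verification of the greedy procedure -/

section Greedy

variable {n m b : ℕ} {A : Arbor (Fin n)} {s : Mem}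

/-- Invariant of the scan: the fraction in variables `17` and `18` is the maximum of `0` and the
values `dens` of the frontier vertices seen so far. -/
lemma runs_select {root v : Fin n} {S : Finset (Fin n)} (hnm : n ≤ m) (hnb : n.size ≤ b)
    (hA : A.verts = Finset.univ.erase root) (hn : s 0 0 = n) (hv : s 25 0 = v)
    (hpar : ∀ x ∈ A.verts, s 4 x = A.par x) (hmark : ∀ x : Fin n, s 12 x = v + 1 ↔ x ∈ S)
    (hroot : s 10 root = 0)
    (hd : ∀ x ∈ A.frontier S, 0 < s 11 x ∧ (s 10 x : ℝ) = A.dens x * s 11 x) :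
    Runs m b selectProg s fun s' => Frame [15, 16, 17, 18] s s' ∧
      ((s' 16 0 = 0 ∧ ∀ y ∈ A.frontier S, A.dens y ≤ 0) ∨
        ∃ x ∈ A.frontier S, s' 16 0 = x + 1 ∧ 0 < A.dens x ∧
          ∀ y ∈ A.frontier S, A.dens y ≤ A.dens x) := by
  refine Runs.of_bounded fun hbd => ?_
  have hb1 : Nat.size 1 ≤ b := (Nat.size_le_size (Nat.succ_le_of_lt v.pos)).trans hnb
  refine runs_seq (runs_assign (x := 0) rfl (by simp) ?_)
  refine runs_seq (runs_assign (x := 0) rfl (by simp) ?_)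
  refine runs_seq (runs_assign (x := 1) rfl hb1 ?_)
  let I : ℕ → Mem → Prop := fun i s' => Frame [15, 16, 17, 18] s s' ∧ ∃ σ : ℝ,
    (s' 17 0 : ℝ) = σ * s' 18 0 ∧ 0 < s' 18 0 ∧
    (∀ y ∈ A.frontier S, y.val < i → A.dens y ≤ σ) ∧
    ((s' 16 0 = 0 ∧ σ = 0) ∨ ∃ x ∈ A.frontier S, s' 16 0 = x + 1 ∧ σ = A.dens x ∧ 0 < σ)
  refine runs_for hnm hnb I ?_ ?_ ?_ ?_
  · refine ⟨((((Frame.refl _ s).set (by decide) _ _).set (by decide) _ _).set (by decide) _ _).set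
      (by decide) _ _, 0, ?_⟩
    simp [Mem.set_apply]
  · rintro i s' ⟨hF, -⟩
    change s' 0 0 = n
    rw [hF 0 (by decide), hn]
  · rintro i s' hi hsi ⟨hF, σ, h1, h2, h3, h4⟩
    obtain ⟨x, rfl⟩ : ∃ x : Fin n, x.val = i := ⟨⟨i, hi⟩, rfl⟩
    have hcond : ∀ a b c d e f : ℕ, (1 - (a - b + (b - a))) * (c - d + (d - c)) * (f - e) ≠ 0 ↔
        a = b ∧ c ≠ d ∧ e < f := by
      intro a b c d e f
      simp only [mul_ne_zero_iff]
      omega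
    have hx11 : s' 11 x = s 11 x := by rw [hF 11 (by decide)]
    have hx10 : s' 10 x = s 10 x := by rw [hF 10 (by decide)]
    have hev : (eqT (.read 12 (.read 4 (var 15))) (var 25 + 1) *
        neT (.read 12 (var 15)) (var 25 + 1) *
        ltT (var 17 * .read 11 (var 15)) (.read 10 (var 15) * var 18)).eval s' ≠ 0 ↔
        s 12 (s 4 x) = v + 1 ∧ x ∉ S ∧ s' 17 0 * s 11 x < s 10 x * s' 18 0 := by
      simp only [eval_neT, eval_eqT, eval_ltT, Term.eval_mul, Term.eval_add, Term.eval_read,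
        eval_var, Term.eval_ofNat, hsi]
      rw [hcond, hF 12 (by decide), hF 4 (by decide), hF 25 (by decide), hx11, hx10, hv,
        ← hmark, Ne]
    have hfr : x ∈ A.frontier S → ((eqT (.read 12 (.read 4 (var 15))) (var 25 + 1) *
        neT (.read 12 (var 15)) (var 25 + 1) *
        ltT (var 17 * .read 11 (var 15)) (.read 10 (var 15) * var 18)).eval s' ≠ 0 ↔
        σ < A.dens x) := by
      intro hx
      obtain ⟨hx1, hx2, hx3⟩ := A.mem_frontier.1 hx
      obtain ⟨hd1, hd2⟩ := hd x hx
      have h5 : (0 : ℝ) < s 11 x * s' 18 0 := by positivity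
      rw [hev, hpar x hx1, hmark, ← Nat.cast_lt (α := ℝ)]
      push_cast
      rw [h1, hd2]
      constructor
      · rintro ⟨-, -, h6⟩
        by_contra hc
        have := mul_le_mul_of_nonneg_right (not_lt.1 hc) h5.le
        linarith
      · intro h6
        have := mul_lt_mul_of_pos_right h6 h5
        exact ⟨hx3, hx2, by linarith⟩
    refine runs_ite (fun hc => ?_) fun hc => ?_
    · have hx : x ∈ A.frontier S := by
        obtain ⟨h5, h6, h7⟩ := hev.1 hc
        -- The parent entry of the root is meaningless; the zero numerator keeps the root from
        -- winning a strict comparison.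
        have hxr : x ≠ root := by
          rintro rfl
          simp [hroot] at h7
        have hxv : x ∈ A.verts := hA ▸ Finset.mem_erase.2 ⟨hxr, Finset.mem_univ _⟩
        rw [hpar x hxv, hmark] at h5
        exact A.mem_frontier.2 ⟨hxv, h6, h5⟩
      have hlt := (hfr hx).1 hc
      have hσ : 0 ≤ σ := by
        rcases h4 with ⟨-, h4⟩ | ⟨-, -, -, -, h4⟩
        exacts [h4.ge, h4.le]
      have hxb : (x.val + 1).size ≤ b := (Nat.size_le_size x.isLt).trans hnb
      refine runs_seq (runs_assign (x := x + 1) ?_ hxb ?_)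
      · simp only [Term.eval_add, eval_var, hsi, Term.eval_ofNat]
      refine runs_seq (runs_assign (x := s 10 x) ?_ (hbd _ _) ?_)
      · simp [Term.eval_read, eval_var, Mem.set_apply, hsi, hx10]
      refine runs_assign (x := s 11 x) ?_ (hbd _ _) ?_
      · simp [Term.eval_read, eval_var, Mem.set_apply, hsi, hx11]
      refine ⟨by simp [Mem.set_apply, hsi], (((hF.set (by decide) _ _).set (by decide) _ _).set
        (by decide) _ _).set (by decide) _ _, A.dens x, ?_⟩
      obtain ⟨hd1, hd2⟩ := hd x hx
      simp only [Mem.set_apply]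
      norm_num
      refine ⟨hd2, hd1, fun y hy hyx => ?_, x, hx, rfl, rfl, hσ.trans_lt hlt⟩
      rcases lt_or_eq_of_le hyx with h | h
      · exact (h3 y hy h).trans hlt.le
      · rw [h]
    · refine runs_skip ⟨hsi, hF.set (by decide) _ _, σ, ?_⟩
      simp only [Mem.set_apply]
      norm_num
      refine ⟨h1, h2, fun y hy hyx => ?_, by simpa using h4⟩
      rcases lt_or_eq_of_le hyx with h | h
      · exact h3 y hy h
      · subst h
        exact not_lt.1 fun h5 => (hfr hy).2 h5 hc
  · rintro s' ⟨hF, σ, -, -, h3, h4⟩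
    refine ⟨hF, ?_⟩
    rcases h4 with ⟨h4, rfl⟩ | ⟨x, hx, h4, rfl, h5⟩
    · exact Or.inl ⟨h4, fun y hy => h3 y hy y.isLt⟩
    · exact Or.inr ⟨x, hx, h4, h5, fun y hy => h3 y hy y.isLt⟩

/-- The memory `s` contains the rooted tree `A` with labels `lab`, prizes `p` and costs `c`. -/
structure Layout (A : Arbor (Fin n)) (lab p c : Fin n → ℕ) (s : Mem) : Prop where
  card : s 0 0 = n
  par : ∀ x ∈ A.verts, s 4 x = A.par x
  lab : ∀ x ∈ A.verts, s 5 x = lab x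
  prize : ∀ x : Fin n, s 6 x = p x
  cost : ∀ x : Fin n, s 7 x = c x

lemma Layout.of_frame {lab p c : Fin n → ℕ} {s s' : Mem} (h : Layout A lab p c s) {F : List ℕ}
    (hF : Frame F s s') (h0 : ∀ j ∈ [0, 4, 5, 6, 7], j ∉ F) : Layout A lab p c s' where
  card := by rw [hF 0 (h0 0 (by decide)), h.card]
  par x hx := by rw [hF 4 (h0 4 (by decide)), h.par x hx]
  lab x hx := by rw [hF 5 (h0 5 (by decide)), h.lab x hx]
  prize x := by rw [hF 6 (h0 6 (by decide)), h.prize]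
  cost x := by rw [hF 7 (h0 7 (by decide)), h.cost]

/-- The numbers `p` and `c` are the prizes and costs of `A`, scaled by a common factor. -/
structure Scaled (A : Arbor (Fin n)) (p c : Fin n → ℕ) (D : ℝ) : Prop where
  pos : 0 < D
  prize : ∀ x ∈ A.verts, (p x : ℝ) = D * A.prize x
  cost : ∀ x ∈ A.verts, (c x : ℝ) = D * A.cost x

lemma Scaled.sum_prize {p c : Fin n → ℕ} {D : ℝ} (h : Scaled A p c D) {T : Finset (Fin n)}
    (hT : T ⊆ A.verts) : ((∑ x ∈ T, p x : ℕ) : ℝ) = D * ∑ x ∈ T, A.prize x := by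
  rw [Nat.cast_sum, Finset.mul_sum]
  exact Finset.sum_congr rfl fun x hx => h.prize x (hT hx)

lemma Scaled.sum_cost {p c : Fin n → ℕ} {D : ℝ} (h : Scaled A p c D) {T : Finset (Fin n)}
    (hT : T ⊆ A.verts) : ((∑ x ∈ T, c x : ℕ) : ℝ) = D * ∑ x ∈ T, A.cost x := by
  rw [Nat.cast_sum, Finset.mul_sum]
  exact Finset.sum_congr rfl fun x hx => h.cost x (hT hx)

lemma Scaled.sum_cost_pos {p c : Fin n → ℕ} {D : ℝ} (h : Scaled A p c D) {v : Fin n}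
    {T : Finset (Fin n)} (hT : A.IsBranch v T) : 0 < ∑ x ∈ T, c x := by
  rw [← Nat.cast_pos (α := ℝ), h.sum_cost hT.2.1]
  exact mul_pos h.pos hT.sum_cost_pos

lemma Scaled.ratio_mul {p c : Fin n → ℕ} {D : ℝ} (h : Scaled A p c D) {v : Fin n}
    {T : Finset (Fin n)} (hT : A.IsBranch v T) :
    ((∑ x ∈ T, p x : ℕ) : ℝ) = A.ratio T * (∑ x ∈ T, c x : ℕ) := by
  have := hT.sum_cost_pos
  rw [h.sum_prize hT.2.1, h.sum_cost hT.2.1, Arbor.ratio]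
  field_simp

lemma Scaled.lt_iff {p c : Fin n → ℕ} {D : ℝ} (h : Scaled A p c D) {v : Fin n}
    {T T' : Finset (Fin n)} (hT : A.IsBranch v T) (hT' : A.IsBranch v T') :
    (∑ x ∈ T, p x) * ∑ x ∈ T', c x < (∑ x ∈ T', p x) * ∑ x ∈ T, c x ↔
      A.ratio T < A.ratio T' := by
  have h1 : (0 : ℝ) < ((∑ x ∈ T, c x : ℕ) : ℝ) * (∑ x ∈ T', c x : ℕ) := by
    exact_mod_cast Nat.mul_pos (h.sum_cost_pos hT) (h.sum_cost_pos hT')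
  rw [← Nat.cast_lt (α := ℝ), Nat.cast_mul, Nat.cast_mul, h.ratio_mul hT, h.ratio_mul hT']
  constructor
  · intro h2
    by_contra hc
    have := mul_le_mul_of_nonneg_right (not_lt.1 hc) h1.le
    linarith
  · intro h2
    have := mul_lt_mul_of_pos_right h2 h1
    linarith

/-- The greedy procedure for the branches below `v`, started in `s₀`, has appended the vertices `vs`;
the best branch is the one that consists of `v` and `σ`. -/
structure Growing (A : Arbor (Fin n)) (lab p c : Fin n → ℕ) (v : Fin n) (s₀ : Mem)
    (vs σ : List (Fin n)) (s : Mem) : Prop where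
  greedy : A.IsGreedy v vs
  pre : σ <+: vs
  best : v ∈ A.verts → ∀ τ, τ <+: vs →
    A.ratio (insert v τ.toFinset) ≤ A.ratio (insert v σ.toFinset)
  frame : Frame [1, 12, 15, 16, 17, 18, 19, 20, 21, 22, 23, 24] s₀ s
  mark : ∀ x : Fin n, s 12 x = v + 1 ↔ x ∈ insert v vs.toFinset
  keep : ∀ x : Fin n, s 12 x = v + 1 ∨ s 12 x = s₀ 12 x
  len : s 23 0 = vs.length
  out : ∀ i (h : i < vs.length), s 1 (i + 1) = lab vs[i]
  sumP : s 19 0 = ∑ x ∈ insert v vs.toFinset, p x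
  sumC : s 20 0 = ∑ x ∈ insert v vs.toFinset, c x
  bestP : s 21 0 = ∑ x ∈ insert v σ.toFinset, p x
  bestC : s 22 0 = ∑ x ∈ insert v σ.toFinset, c x

lemma Arbor.IsGreedy.length_lt {v : Fin n} {vs : List (Fin n)} (h : A.IsGreedy v vs) :
    vs.length < n := by
  have h1 : (v :: vs).Nodup := List.nodup_cons.2 ⟨h.not_mem, h.nodup⟩
  have := h1.length_le_card
  simpa using this

/-- All candidates have larger rank than `v`, so their ratios are known if vertices are treated by
decreasing rank. -/
lemma Arbor.IsGreedy.rank_lt {v : Fin n} {vs : List (Fin n)} (h : A.IsGreedy v vs) :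
    ∀ x ∈ A.frontier (insert v vs.toFinset), A.rank v < A.rank x := by
  induction vs using List.reverseRecOn with
  | nil =>
    intro x hx
    obtain ⟨h1, -, h2⟩ := A.mem_frontier.1 hx
    have := A.rank_par_lt x h1
    simp only [List.toFinset_nil, insert_empty_eq, Finset.mem_singleton] at h2
    rwa [h2] at this
  | append_singleton vs w ih =>
    intro x hx
    obtain ⟨h1, h2, h3⟩ := A.mem_frontier.1 hx
    have h4 := ih h.of_append
    simp only [List.toFinset_append, List.toFinset_cons, List.toFinset_nil, Finset.mem_insert,
      Finset.mem_union, not_or] at h2 h3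
    have h5 := A.rank_par_lt x h1
    by_cases hw : A.par x = w
    · have := h4 w (h vs w [] rfl).1
      rw [hw] at h5
      omega
    · refine h4 x (A.mem_frontier.2 ⟨h1, ?_, ?_⟩)
      · simp only [Finset.mem_insert, not_or]
        exact ⟨h2.1, h2.2.1⟩
      · simp only [Finset.mem_insert]
        rcases h3 with h3 | h3 | h3 | h3
        · exact Or.inl h3
        · exact Or.inr h3
        · exact absurd h3 hw
        · exact absurd h3 (by simp)

variable {root v : Fin n} {lab p c : Fin n → ℕ} {D : ℝ} {s₀ : Mem} {vs σ : List (Fin n)}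

lemma runs_extend (hnm : n ≤ m) (hnb : n.size ≤ b) (hA : A.verts = Finset.univ.erase root)
    (hsc : Scaled A p c D) (hpb : (∑ x, p x).size ≤ b) (hcb : (∑ x, c x).size ≤ b)
    (hL : Layout A lab p c s₀) (hv : s₀ 25 0 = v) (hroot : s₀ 10 root = 0)
    (hd : ∀ x ∈ A.verts, A.rank v < A.rank x → 0 < s₀ 11 x ∧
      (s₀ 10 x : ℝ) = A.dens x * s₀ 11 x)
    (hG : Growing A lab p c v s₀ vs σ s) (hgo : s 24 0 = 1) :
    Runs m b extendProg s fun s' =>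
      (s' 24 0 = 1 ∧ ∃ w σ', Growing A lab p c v s₀ (vs ++ [w]) σ' s') ∨
      (s' 24 0 = 0 ∧ Growing A lab p c v s₀ vs σ s' ∧
        ∀ y ∈ A.frontier (insert v vs.toFinset), A.dens y ≤ 0) := by
  refine Runs.of_bounded fun hbd => ?_
  have hLs := hL.of_frame hG.frame (by decide)
  have hF := hG.frame
  have hs25 : s 25 0 = v := by rw [hF 25 (by decide), hv]
  refine runs_seq ((runs_select (S := insert v vs.toFinset) hnm hnb hA hLs.card hs25 hLs.par
    hG.mark (by rw [hF 10 (by decide), hroot]) fun x hx => ?_).mono ?_)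
  · rw [hF 10 (by decide), hF 11 (by decide)]
    exact hd x (A.mem_frontier.1 hx).1 (hG.greedy.rank_lt x hx)
  rintro s' ⟨hF', h⟩
  refine runs_ite (fun hc => ?_) fun hc => ?_
  · rw [eval_var] at hc
    obtain ⟨x, hx, hsel, hpos, hmax⟩ := h.resolve_left fun h => hc h.1
    have hgr := hG.greedy.concat hx hmax hpos
    obtain ⟨hxv, hxS, hxp⟩ := A.mem_frontier.1 hx
    have hLs' := hLs.of_frame hF' (by decide)
    have hset : insert v (vs ++ [x]).toFinset = insert x (insert v vs.toFinset) := by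
      ext y
      simp only [List.toFinset_append, List.toFinset_cons, List.toFinset_nil, Finset.mem_insert,
        Finset.mem_union, Finset.notMem_empty]
      tauto
    have hs25' : s' 25 0 = v := by rw [hF' 25 (by decide), hs25]
    have h23 : s' 23 0 = vs.length := by rw [hF' 23 (by decide), hG.len]
    have h19 : s' 19 0 + p x = ∑ y ∈ insert v (vs ++ [x]).toFinset, p y := by
      rw [hset, Finset.sum_insert hxS, hF' 19 (by decide), hG.sumP, add_comm]
    have h20 : s' 20 0 + c x = ∑ y ∈ insert v (vs ++ [x]).toFinset, c y := by
      rw [hset, Finset.sum_insert hxS, hF' 20 (by decide), hG.sumC, add_comm]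
    have h21 : s' 21 0 = ∑ y ∈ insert v σ.toFinset, p y := by
      rw [hF' 21 (by decide), hG.bestP]
    have h22 : s' 22 0 = ∑ y ∈ insert v σ.toFinset, c y := by
      rw [hF' 22 (by decide), hG.bestC]
    have hlen : (vs.length + 1).size ≤ b := (Nat.size_le_size hG.greedy.length_lt).trans hnb
    have hvb : (v.val + 1).size ≤ b := (Nat.size_le_size v.isLt).trans hnb
    have hb19 : (s' 19 0 + p x).size ≤ b := by
      rw [h19]
      exact (Nat.size_le_size (Finset.sum_le_sum_of_subset (Finset.subset_univ _))).trans hpb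
    have hb20 : (s' 20 0 + c x).size ≤ b := by
      rw [h20]
      exact (Nat.size_le_size (Finset.sum_le_sum_of_subset (Finset.subset_univ _))).trans hcb
    have hlab : (lab x).size ≤ b := by
      rw [← hLs.lab x hxv]
      exact hbd _ _
    refine runs_seq (runs_assign (x := vs.length + 1) ?_ hlen ?_)
    · simp only [Term.eval_add, eval_var, Term.eval_ofNat, h23]
    refine runs_seq (runs_write' (y := x) (x := v + 1) ?_ ?_ hvb ?_)
    · simp [Term.eval_sub, eval_var, Term.eval_ofNat, Mem.set_apply, hsel]
    · simp [Term.eval_add, eval_var, Term.eval_ofNat, Mem.set_apply, hs25']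
    refine runs_seq (runs_assign (x := s' 19 0 + p x) ?_ hb19 ?_)
    · simp [Term.eval_sub, Term.eval_add, Term.eval_read, eval_var, Term.eval_ofNat, Mem.set_apply,
        hsel, hLs'.prize]
    refine runs_seq (runs_assign (x := s' 20 0 + c x) ?_ hb20 ?_)
    · simp [Term.eval_sub, Term.eval_add, Term.eval_read, eval_var, Term.eval_ofNat, Mem.set_apply,
        hsel, hLs'.cost]
    refine runs_seq (runs_write' (y := vs.length + 1) (x := lab x) ?_ ?_ hlab ?_)
    · simp [eval_var, Mem.set_apply]
    · simp [Term.eval_sub, Term.eval_read, eval_var, Term.eval_ofNat, Mem.set_apply,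
        hsel, hLs'.lab x hxv]
    -- Bookkeeping shared by both outcomes of the final comparison, in which the best prefix becomes
    -- the new one or stays the old one.
    have key : ∀ σ' s'', σ' <+: vs ++ [x] →
        (v ∈ A.verts → A.ratio (insert v (vs ++ [x]).toFinset) ≤ A.ratio (insert v σ'.toFinset) ∧
          A.ratio (insert v σ.toFinset) ≤ A.ratio (insert v σ'.toFinset)) →
        Frame [21, 22] (((((s'.set 23 0 (vs.length + 1)).set 12 x (v + 1)).set 19 0
          (s' 19 0 + p x)).set 20 0 (s' 20 0 + c x)).set 1 (vs.length + 1) (lab x)) s'' →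
        s'' 21 0 = ∑ y ∈ insert v σ'.toFinset, p y → s'' 22 0 = ∑ y ∈ insert v σ'.toFinset, c y →
        s'' 24 0 = 1 ∧ Growing A lab p c v s₀ (vs ++ [x]) σ' s'' := by
      intro σ' s'' hσ' hbest hF'' hP hC
      refine ⟨?_, hgr, hσ', fun hvA τ hτ => ?_, ?_, fun y => ?_, fun y => ?_, ?_, fun i hi => ?_,
        ?_, ?_, hP, hC⟩
      · rw [hF'' 24 (by decide)]
        simp [Mem.set_apply, hF' 24 (by decide), hgo]
      · rcases List.prefix_concat_iff.1 hτ with rfl | hτ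
        · exact (hbest hvA).1
        · exact (hG.best hvA τ hτ).trans (hbest hvA).2
      · refine Frame.trans (Frame.set (Frame.set (Frame.set (Frame.set (Frame.set
          (hF.trans hF' (by decide)) (by decide) _ _) (by decide) _ _) (by decide) _ _)
          (by decide) _ _) (by decide) _ _) hF'' (by decide)
      · rw [hF'' 12 (by decide), hset, Finset.mem_insert, ← hG.mark y]
        simp only [Mem.set_apply]
        norm_num
        by_cases hyx : y = x
        · simp [hyx]
        · have : y.val ≠ x.val := fun h => hyx (Fin.ext h)
          simp [hyx, this, hF' 12 (by decide)]
      · rw [hF'' 12 (by decide)]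
        simp only [Mem.set_apply]
        norm_num
        by_cases hyx : y.val = x.val
        · simp [hyx]
        · simpa [hyx, hF' 12 (by decide)] using hG.keep y
      · rw [hF'' 23 (by decide)]
        simp [Mem.set_apply]
      · rw [hF'' 1 (by decide)]
        simp only [Mem.set_apply]
        norm_num
        rw [List.length_append, List.length_singleton] at hi
        by_cases hix : i = vs.length
        · subst hix
          simp
        · rw [if_neg hix, List.getElem_append_left (by omega), hF' 1 (by decide)]
          exact hG.out i (by omega)
      · rw [hF'' 19 (by decide), ← h19]
        simp [Mem.set_apply]
      · rw [hF'' 20 (by decide), ← h20]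
        simp [Mem.set_apply]
    have hcond : (ltT (var 21 * var 20) (var 19 * var 22)).eval (((((s'.set 23 0
        (vs.length + 1)).set 12 x (v + 1)).set 19 0 (s' 19 0 + p x)).set 20 0
        (s' 20 0 + c x)).set 1 (vs.length + 1) (lab x)) =
        (∑ y ∈ insert v (vs ++ [x]).toFinset, p y) * (∑ y ∈ insert v σ.toFinset, c y) -
        (∑ y ∈ insert v σ.toFinset, p y) * (∑ y ∈ insert v (vs ++ [x]).toFinset, c y) := by
      rw [← h19, ← h20, ← h21, ← h22]
      simp [eval_ltT, Term.eval_mul, eval_var, Mem.set_apply]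
    have hσbr : v ∈ A.verts → A.IsBranch v (insert v σ.toFinset) := fun hvA => by
      obtain ⟨ρ, hρ⟩ := hG.pre
      exact Arbor.IsGreedy.isBranch (hρ ▸ hG.greedy).of_append hvA
    refine runs_ite (fun hc => ?_) fun hc => ?_
    · rw [hcond] at hc
      refine runs_seq (runs_assign (x := ∑ y ∈ insert v (vs ++ [x]).toFinset, p y) ?_
        (h19 ▸ hb19) ?_)
      · rw [← h19]
        simp [eval_var, Mem.set_apply]
      refine runs_assign (x := ∑ y ∈ insert v (vs ++ [x]).toFinset, c y) ?_ (h20 ▸ hb20) ?_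
      · rw [← h20]
        simp [eval_var, Mem.set_apply]
      left
      obtain ⟨h5, h6⟩ := key (vs ++ [x]) _ List.prefix_rfl (fun hvA => ⟨le_rfl,
        ((hsc.lt_iff (hσbr hvA) (hgr.isBranch hvA)).1 (by omega)).le⟩)
        (((Frame.refl _ _).set (j := 21) (by decide) 0
          (∑ y ∈ insert v (vs ++ [x]).toFinset, p y)).set (j := 22) (by decide) 0
          (∑ y ∈ insert v (vs ++ [x]).toFinset, c y))
        (by simp [Mem.set_apply]) (by simp [Mem.set_apply])
      exact ⟨h5, x, _, h6⟩
    · rw [hcond] at hc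
      refine runs_skip (Or.inl ?_)
      obtain ⟨h5, h6⟩ := key σ _ (hG.pre.trans (List.prefix_append _ _))
        (fun hvA => ⟨not_lt.1 fun h7 => absurd hc (Nat.sub_pos_of_lt
          ((hsc.lt_iff (hσbr hvA) (hgr.isBranch hvA)).2 h7)).ne', le_rfl⟩) (Frame.refl _ _)
        (by simp [Mem.set_apply, h21]) (by simp [Mem.set_apply, h22])
      exact ⟨h5, x, _, h6⟩
  · rw [eval_var] at hc
    rcases h with ⟨-, h⟩ | ⟨x, -, h, -⟩
    · refine runs_assign (x := 0) rfl (by simp) (Or.inr ⟨by simp [Mem.set_apply], ?_, h⟩)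
      have hFF : Frame [15, 16, 17, 18, 24] s (s'.set 24 0 0) :=
        (hF'.mono (by decide)).set (by decide) _ _
      exact ⟨hG.greedy, hG.pre, hG.best, hF.trans hFF (by decide),
        by rw [hFF 12 (by decide)]; exact hG.mark, by rw [hFF 12 (by decide)]; exact hG.keep,
        by rw [hFF 23 (by decide)]; exact hG.len, by rw [hFF 1 (by decide)]; exact hG.out,
        by rw [hFF 19 (by decide)]; exact hG.sumP, by rw [hFF 20 (by decide)]; exact hG.sumC,
        by rw [hFF 21 (by decide)]; exact hG.bestP, by rw [hFF 22 (by decide)]; exact hG.bestC⟩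
    · omega

/-- By `IsGreedy.exists_prefix` some prefix of the complete run is an optimal branch, so the best
prefix recorded has ratio `dens v`. For the root, which is not in `A.verts`, only the sequence
matters. -/
lemma runs_greedy (hnm : n ≤ m) (hnb : n.size ≤ b) (hA : A.verts = Finset.univ.erase root)
    (hsc : Scaled A p c D) (hpb : (∑ x, p x).size ≤ b) (hcb : (∑ x, c x).size ≤ b)
    (hL : Layout A lab p c s) (hv : s 25 0 = v) (hmark : ∀ x : Fin n, s 12 x ≠ v + 1)
    (hroot : s 10 root = 0)
    (hd : ∀ x ∈ A.verts, A.rank v < A.rank x → 0 < s 11 x ∧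
      (s 10 x : ℝ) = A.dens x * s 11 x) :
    Runs m b greedyProg s fun s' =>
      Frame [1, 10, 11, 12, 15, 16, 17, 18, 19, 20, 21, 22, 23, 24] s s' ∧
      (∀ x : Fin n, x ≠ v → s' 10 x = s 10 x ∧ s' 11 x = s 11 x) ∧
      (v ∈ A.verts → 0 < s' 11 v ∧ (s' 10 v : ℝ) = A.dens v * s' 11 v) ∧
      (∀ x : Fin n, s' 12 x = v + 1 ∨ s' 12 x = s 12 x) ∧
      ∃ vs, A.IsGreedy v vs ∧ (∀ y ∈ A.frontier (insert v vs.toFinset), A.dens y ≤ 0) ∧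
        s' 23 0 = vs.length ∧ ∀ i (h : i < vs.length), s' 1 (i + 1) = lab vs[i] := by
  have hvb : (v.val + 1).size ≤ b := (Nat.size_le_size v.isLt).trans hnb
  have hb1 : Nat.size 1 ≤ b := (Nat.size_le_size (Nat.succ_le_of_lt v.pos)).trans hnb
  have hpv : (p v).size ≤ b :=
    (Nat.size_le_size (Finset.single_le_sum (fun _ _ => Nat.zero_le _) (Finset.mem_univ v))).trans hpb
  have hcv : (c v).size ≤ b :=
    (Nat.size_le_size (Finset.single_le_sum (fun _ _ => Nat.zero_le _) (Finset.mem_univ v))).trans hcb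
  refine runs_seq (runs_write' (y := v) (x := v + 1) ?_ ?_ hvb ?_)
  · simp [eval_var, hv]
  · simp [Term.eval_add, eval_var, Term.eval_ofNat, hv]
  refine runs_seq (runs_assign (x := p v) ?_ hpv ?_)
  · simp [Term.eval_read, eval_var, Mem.set_apply, hv, hL.prize]
  refine runs_seq (runs_assign (x := c v) ?_ hcv ?_)
  · simp [Term.eval_read, eval_var, Mem.set_apply, hv, hL.cost]
  refine runs_seq (runs_assign (x := p v) ?_ hpv ?_)
  · simp [eval_var, Mem.set_apply]
  refine runs_seq (runs_assign (x := c v) ?_ hcv ?_)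
  · simp [eval_var, Mem.set_apply]
  refine runs_seq (runs_assign (x := 0) rfl (by simp) ?_)
  refine runs_seq (runs_assign (x := 1) rfl hb1 ?_)
  -- While the procedure is active, `vs.length < n` leaves at least one round, which also pays for
  -- the final unsuccessful search.
  refine runs_seq (runs_loop (fun k s' => ∃ vs σ, Growing A lab p c v s vs σ s' ∧
    ((s' 24 0 = 1 ∧ k + vs.length = n) ∨ (s' 24 0 = 0 ∧
      ∀ y ∈ A.frontier (insert v vs.toFinset), A.dens y ≤ 0))) ?_ hnm ?_)
  · rintro k s' ⟨vs, σ, hG, ⟨hgo, hk⟩ | ⟨hgo, hend⟩⟩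
    · right
      refine ⟨by rw [eval_var, hgo]; exact one_ne_zero, ?_⟩
      have hlt := hG.greedy.length_lt
      obtain ⟨k, rfl⟩ : ∃ k', k = k' + 1 := ⟨k - 1, by omega⟩
      refine ⟨k, rfl, (runs_extend hnm hnb hA hsc hpb hcb hL hv hroot hd hG hgo).mono ?_⟩
      rintro s'' (⟨h1, w, σ', h2⟩ | ⟨h1, h2, h3⟩)
      · refine ⟨vs ++ [w], σ', h2, Or.inl ⟨h1, ?_⟩⟩
        rw [List.length_append, List.length_singleton]
        omega
      · exact ⟨vs, σ, h2, Or.inr ⟨h1, h3⟩⟩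
    · left
      refine ⟨by rw [eval_var, hgo], ?_⟩
      have hF := hG.frame
      have hs25 : s' 25 0 = v := by rw [hF 25 (by decide), hv]
      refine Runs.of_bounded fun hbd => ?_
      refine runs_seq (runs_write' (y := v) (x := s' 21 0) ?_ ?_ (hbd _ _) ?_)
      · simp [eval_var, hs25]
      · simp [eval_var]
      refine runs_write' (y := v) (x := s' 22 0) ?_ ?_ (hbd _ _) ?_
      · simp [eval_var, Mem.set_apply, hs25]
      · simp [eval_var, Mem.set_apply]
      refine ⟨((hF.mono (by decide)).set (by decide) _ _).set (by decide) _ _, fun x hx => ?_,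
        fun hvA => ?_, fun x => ?_, vs, hG.greedy, hend, ?_, fun i hi => ?_⟩
      · have hxv : x.val ≠ v.val := fun h => hx (Fin.ext h)
        simp [Mem.set_apply, hxv, hF 10 (by decide), hF 11 (by decide)]
      · simp only [Mem.set_apply]
        norm_num
        obtain ⟨ρ, hρ⟩ := hG.pre
        have hbr : A.IsBranch v (insert v σ.toFinset) :=
          Arbor.IsGreedy.isBranch (hρ ▸ hG.greedy).of_append hvA
        obtain ⟨τ, hτ, he⟩ := hG.greedy.exists_prefix hvA hend
        have hden : A.ratio (insert v σ.toFinset) = A.dens v :=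
          le_antisymm hbr.ratio_le_dens (he ▸ hG.best hvA τ hτ)
        rw [hG.bestP, hG.bestC, ← hden]
        exact ⟨hsc.sum_cost_pos hbr, hsc.ratio_mul hbr⟩
      · simpa [Mem.set_apply] using hG.keep x
      · simpa [Mem.set_apply] using hG.len
      · simpa [Mem.set_apply] using hG.out i hi
  · refine ⟨[], [], ⟨A.isGreedy_nil v, List.prefix_rfl, ?_, ?_, fun x => ?_, fun x => ?_, ?_, ?_, ?_,
      ?_, ?_, ?_⟩, Or.inl ⟨by simp [Mem.set_apply], by simp⟩⟩
    · rintro - τ hτ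
      rw [List.prefix_nil.1 hτ]
    · exact (((((((Frame.refl _ s).set (by decide) _ _).set (by decide) _ _).set (by decide) _ _).set
        (by decide) _ _).set (by decide) _ _).set (by decide) _ _).set (by decide) _ _
    · have := hmark x
      by_cases hx : x = v
      · simp [Mem.set_apply, hx]
      · have hxv : x.val ≠ v.val := fun h => hx (Fin.ext h)
        simp [Mem.set_apply, hx, hxv, this]
    · by_cases hx : x.val = v.val
      · simp [Mem.set_apply, hx]
      · simp [Mem.set_apply, hx]
    · simp [Mem.set_apply]
    · simp
    all_goals simp [Mem.set_apply]

/-- After `i` rounds the ratios of all non-root vertices of rank at least `n - i` are known. The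
root has rank `0`, so the last round produces the sequence sought. -/
theorem runs_order (hnm : n ≤ m) (hnb : n.size ≤ b) (hA : A.verts = Finset.univ.erase root)
    (hsc : Scaled A p c D) (hpb : (∑ x, p x).size ≤ b) (hcb : (∑ x, c x).size ≤ b)
    (hL : Layout A lab p c s) (hord : ∀ k < n, ∃ u : Fin n, s 8 k = u ∧ A.rank u = k)
    (hinj : Function.Injective A.rank) (hr : A.rank root = 0) (h10 : s 10 root = 0)
    (h12 : ∀ x : Fin n, s 12 x = 0) :
    Runs m b orderProg s fun s' =>
      ∃ vs, A.IsGreedy root vs ∧ (∀ y ∈ A.frontier (insert root vs.toFinset), A.dens y ≤ 0) ∧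
        s' 1 0 = vs.length ∧ ∀ i (h : i < vs.length), s' 1 (i + 1) = lab vs[i] := by
  have hn := root.pos
  refine runs_seq (runs_for hnm hnb (fun i s' =>
    Frame [1, 10, 11, 12, 13, 15, 16, 17, 18, 19, 20, 21, 22, 23, 24, 25] s s' ∧
    (∀ x ∈ A.verts, n ≤ A.rank x + i → 0 < s' 11 x ∧ (s' 10 x : ℝ) = A.dens x * s' 11 x) ∧
    -- Not claimed after the last round, which overwrites this entry.
    (i < n → s' 10 root = 0) ∧
    (∀ x : Fin n, s' 12 x = 0 ∨ ∃ u : Fin n, n ≤ A.rank u + i ∧ s' 12 x = u + 1) ∧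
    (i = n → ∃ vs, A.IsGreedy root vs ∧
      (∀ y ∈ A.frontier (insert root vs.toFinset), A.dens y ≤ 0) ∧
      s' 23 0 = vs.length ∧ ∀ i (h : i < vs.length), s' 1 (i + 1) = lab vs[i])) ?_ ?_ ?_ ?_)
  -- The `n` ranks below `n` are taken by `n` different vertices, hence by all; so initially there
  -- is no vertex of rank `n` or more.
  · have hlt : ∀ x : Fin n, A.rank x < n := by
      have h1 : ∀ k : Fin n, ∃ u : Fin n, A.rank u = k := fun k => by
        obtain ⟨u, -, hu⟩ := hord k k.isLt
        exact ⟨u, hu⟩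
      choose f hf using h1
      have hfi : Function.Injective f := fun a b h => Fin.ext (by rw [← hf a, ← hf b, h])
      intro x
      obtain ⟨k, rfl⟩ := (Finite.injective_iff_surjective.1 hfi) x
      rw [hf]
      exact k.isLt
    refine ⟨(Frame.refl _ s).set (by decide) _ _, fun x _ h => ?_, fun _ => ?_, fun x => ?_,
      fun h => ?_⟩
    · have := hlt x
      omega
    · simp [Mem.set_apply, h10]
    · simp [Mem.set_apply, h12]
    · omega
  · rintro i s' ⟨hF, -⟩
    change s' 0 0 = n
    rw [hF 0 (by decide), hL.card]
  · rintro i s' hi hsi ⟨hF, h1, h2, h3, -⟩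
    obtain ⟨v, hv1, hv2⟩ := hord (n - 1 - i) (by omega)
    refine Runs.of_bounded fun hbd => ?_
    refine runs_seq (runs_assign (x := v) ?_
      ((Nat.size_le_size v.isLt.le).trans hnb) ?_)
    · simp only [Term.eval_read, Term.eval_sub, eval_var, Term.eval_ofNat]
      rw [hF 8 (by decide), hF 0 (by decide), hL.card, hsi, hv1]
    have hF25 : Frame [25] s' (s'.set 25 0 v) := (Frame.refl _ s').set (by decide) _ _
    have hFs := hF.trans hF25 (by decide)
    refine (runs_greedy hnm hnb hA hsc hpb hcb (hL.of_frame hFs (by decide))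
      (v := v) (root := root) (by simp [Mem.set_apply]) (fun x => ?_) ?_ fun x hx hlt => ?_).mono ?_
    · rw [hF25 12 (by decide)]
      -- Marks from earlier rounds name vertices of larger rank, never `v`.
      rcases h3 x with h | ⟨u, hu1, hu2⟩
      · omega
      · intro h
        have : u = v := Fin.ext (by omega)
        subst this
        omega
    · rw [hF25 10 (by decide)]
      exact h2 hi
    · rw [hF25 10 (by decide), hF25 11 (by decide)]
      exact h1 x hx (by omega)
    rintro s'' ⟨hF', g1, g2, g3, vs, g4, g5, g6, g7⟩
    refine ⟨?_, (hFs.trans hF' (by decide)).set (by decide) _ _, fun x hx hxi => ?_, fun hin => ?_,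
      fun x => ?_, fun hin => ?_⟩
    · rw [hF' 13 (by decide), hF25 13 (by decide), hsi]
    · simp only [Mem.set_apply]
      norm_num
      by_cases hxv : x = v
      · subst hxv
        exact g2 hx
      · have hne : A.rank x ≠ A.rank v := fun h => hxv (hinj h)
        obtain ⟨h4, h5⟩ := g1 x hxv
        rw [h4, h5, hF25 10 (by decide), hF25 11 (by decide)]
        exact h1 x hx (by omega)
    · simp only [Mem.set_apply]
      norm_num
      have hne : root ≠ v := by
        rintro rfl
        omega
      rw [(g1 root hne).1, hF25 10 (by decide)]
      exact h2 hi
    · simp only [Mem.set_apply]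
      norm_num
      rcases g3 x with h | h
      · exact Or.inr ⟨v, by omega, h⟩
      · rw [hF25 12 (by decide)] at h
        rcases h3 x with h' | ⟨u, hu1, hu2⟩
        · exact Or.inl (h.trans h')
        · exact Or.inr ⟨u, by omega, h.trans hu2⟩
    · have hvr : v = root := hinj (by omega)
      subst hvr
      refine ⟨vs, g4, g5, ?_, fun j hj => ?_⟩
      · simpa [Mem.set_apply] using g6
      · simpa [Mem.set_apply] using g7 j hj
  · rintro s' ⟨-, -, -, -, h⟩
    obtain ⟨vs, h1, h2, h3, h4⟩ := h rfl
    refine Runs.of_bounded fun hbd => ?_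
    refine runs_write' (y := 0) (x := s' 23 0) rfl rfl (hbd _ _) ⟨vs, h1, h2, ?_, fun i hi => ?_⟩
    · simp [Mem.set_apply, h3]
    · simpa [Mem.set_apply] using h4 i hi

end Greedy

/-! ### Scaling and orientation of the tree

The product of all non-zero numbers in the input is computed in variable `3`; prizes and costs are
multiplied by it. Then the tree is explored from the root; array `9` marks the vertices that have been
found. -/

/-- The product of the non-zero numbers in the input. -/
def scaleProg : Prog :=
  .seq (assign 3 1) (forLoop 15 (3 + 2 * .read 0 0 + 4 * .read 0 1)
    -- `x + (1 - x)` with truncated subtraction is `x`, except that `0` is replaced by `1`.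
    (assign 3 (var 3 * (.read 0 (var 15) + (1 - .read 0 (var 15))))))

/-- Position of the current edge in the input. -/
def edgeT : Term := 3 + 2 * .read 0 0 + 4 * (var 15 / 2)

/-- Search for an edge that leaves the set of marked vertices; both orientations of all edges are
tried. -/
def crossProg : Prog :=
  forLoop 15 (2 * .read 0 1)
    -- Round `i` treats edge `i / 2`; the parity of `i` selects the end that should be marked
    -- already.
    (.ite (.read 9 (.read 0 (edgeT + (var 15 - 2 * (var 15 / 2)))) *
        (1 - .read 9 (.read 0 (edgeT + (1 - (var 15 - 2 * (var 15 / 2)))))))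
      (.seq (assign 25 (.read 0 (edgeT + (1 - (var 15 - 2 * (var 15 / 2))))))
        (.seq (assign 26 (.read 0 (edgeT + (var 15 - 2 * (var 15 / 2)))))
          (assign 27 (var 15 / 2))))
      .skip)

/-- Appending the vertex that has been found. -/
def appendProg : Prog :=
  .seq (.write 4 (var 25) (var 26)) <| .seq (.write 5 (var 25) (var 27)) <|
  .seq (.write 6 (var 25) (.read 0 (3 + 2 * var 25) * (var 3 / .read 0 (4 + 2 * var 25)))) <|
  .seq (.write 7 (var 25) (.read 0 (5 + 2 * .read 0 0 + 4 * var 27) *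
    (var 3 / .read 0 (6 + 2 * .read 0 0 + 4 * var 27)))) <|
  .seq (.write 9 (var 25) 1) (.write 8 (var 13 + 1) (var 25))

/-- Exploration of the tree. -/
def exploreProg : Prog :=
  .seq (.write 9 (.read 0 2) 1) <| .seq (.write 8 0 (.read 0 2)) <|
  forLoop 13 (.read 0 0 - 1) (.seq crossProg appendProg)

/-- The implementation of the density-greedy algorithm. -/
def treeProg : Prog := .seq scaleProg (.seq exploreProg orderProg)

/-! ### Verification of scaling and exploration -/

section Explore

variable {n q m b : ℕ} {s : Mem}

lemma runs_scale {k D : ℕ} (hk : 3 + 2 * s 0 0 + 4 * s 0 1 = k) (hkm : k ≤ m) (hkb : k.size ≤ b)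
    (hD : ∏ i ∈ Finset.range k, (s 0 i + (1 - s 0 i)) = D) (hDb : D.size ≤ b) :
    Runs m b scaleProg s fun s' => Frame [3, 15] s s' ∧ s' 3 0 = D := by
  -- All factors are at least `1`, so partial products do not exceed the full product.
  have hle : ∀ i ≤ k, (∏ i ∈ Finset.range i, (s 0 i + (1 - s 0 i))).size ≤ b := by
    intro i hi
    refine (Nat.size_le_size ?_).trans (hD ▸ hDb)
    exact Finset.prod_le_prod_of_subset_of_one_le' (by simpa using hi) fun j _ _ => by omega
  have h1b : Nat.size 1 ≤ b := (Nat.size_le_size (by omega)).trans hkb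
  refine runs_seq (runs_assign (x := 1) rfl h1b ?_)
  refine runs_for hkm hkb (fun i s' => Frame [3, 15] s s' ∧
    s' 3 0 = ∏ i ∈ Finset.range i, (s 0 i + (1 - s 0 i))) ?_ ?_ ?_ ?_
  · exact ⟨((Frame.refl _ s).set (by decide) _ _).set (by decide) _ _, by simp [Mem.set_apply]⟩
  · rintro i s' ⟨hF, -⟩
    simp only [Term.eval_add, Term.eval_mul, Term.eval_read, Term.eval_ofNat, hF 0 (by decide), hk]
  · rintro i s' hi hsi ⟨hF, h⟩
    refine runs_assign (x := ∏ i ∈ Finset.range (i + 1), (s 0 i + (1 - s 0 i))) ?_ (hle _ hi)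
      ⟨by simp [Mem.set_apply, hsi], (hF.set (by decide) _ _).set (by decide) _ _, ?_⟩
    · simp only [Term.eval_add, Term.eval_sub, Term.eval_mul, Term.eval_read, Term.eval_ofNat,
        eval_var, hF 0 (by decide), hsi, h, Finset.prod_range_succ]
    · simp [Mem.set_apply]
  · rintro s' ⟨hF, h⟩
    exact ⟨hF, by rw [h, hD]⟩

/-- The memory contains the encoding of the instance. -/
structure Input (G : Network (Fin n) (Fin q)) (pa pb : Fin n → ℕ) (ca cb : Fin q → ℕ) (s : Mem) :
    Prop where
  card : s 0 0 = n
  size : s 0 1 = q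
  root : s 0 2 = G.root
  pnum : ∀ v : Fin n, s 0 (3 + 2 * v) = pa v
  pden : ∀ v : Fin n, s 0 (4 + 2 * v) = pb v
  fst : ∀ e : Fin q, s 0 (3 + 2 * n + 4 * e) = (G.ends e).1
  snd : ∀ e : Fin q, s 0 (4 + 2 * n + 4 * e) = (G.ends e).2
  cnum : ∀ e : Fin q, s 0 (5 + 2 * n + 4 * e) = ca e
  cden : ∀ e : Fin q, s 0 (6 + 2 * n + 4 * e) = cb e

variable {G : Network (Fin n) (Fin q)} {pa pb : Fin n → ℕ} {ca cb : Fin q → ℕ}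

lemma Input.of_frame {s s' : Mem} (h : Input G pa pb ca cb s) {F : List ℕ} (hF : Frame F s s')
    (h0 : 0 ∉ F) : Input G pa pb ca cb s' := by
  obtain ⟨h1, h2, h3, h4, h5, h6, h7, h8, h9⟩ := h
  constructor <;> rw [hF 0 h0] <;> assumption

/-- The scan does not stop at a success; later crossing edges overwrite earlier ones. If none had
been recorded, no edge would leave `L`, against `hex`. -/
lemma runs_cross {L : List (Fin n)} (hqm : 2 * q ≤ m) (hqb : (2 * q).size ≤ b) (hnb : n.size ≤ b)
    (hI : Input G pa pb ca cb s) (hseen : ∀ x : Fin n, s 9 x = if x ∈ L then 1 else 0)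
    (hex : ∃ e x y, G.Joins e x y ∧ x ∈ L ∧ y ∉ L) :
    Runs m b crossProg s fun s' => Frame [15, 25, 26, 27] s s' ∧ ∃ e x y, G.Joins e x y ∧ x ∈ L ∧
      y ∉ L ∧ s' 25 0 = Fin.val y ∧ s' 26 0 = Fin.val x ∧ s' 27 0 = Fin.val e := by
  refine runs_for hqm hqb (fun h s' => Frame [15, 25, 26, 27] s s' ∧
    ((∀ e : Fin q, (2 * e.val < h → (G.ends e).1 ∈ L → (G.ends e).2 ∈ L) ∧
      (2 * e.val + 1 < h → (G.ends e).2 ∈ L → (G.ends e).1 ∈ L)) ∨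
      ∃ e x y, G.Joins e x y ∧ x ∈ L ∧ y ∉ L ∧ s' 25 0 = Fin.val y ∧ s' 26 0 = Fin.val x ∧
        s' 27 0 = Fin.val e)) ?_ ?_ ?_ ?_
  · exact ⟨(Frame.refl _ s).set (by decide) _ _, Or.inl fun e => ⟨by omega, by omega⟩⟩
  · rintro i s' ⟨hF, -⟩
    simp only [Term.eval_mul, Term.eval_read, Term.eval_ofNat, hF 0 (by decide), hI.size]
  · rintro i s' hi hsi ⟨hF, h⟩
    have hI' := hI.of_frame hF (by decide)
    obtain ⟨e, he⟩ : ∃ e : Fin q, e.val = i / 2 := ⟨⟨i / 2, by omega⟩, rfl⟩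
    have hstep : ∃ x y, G.Joins e x y ∧ s' 0 (3 + 2 * n + 4 * (i / 2) + (i - 2 * (i / 2))) =
        Fin.val x ∧ s' 0 (3 + 2 * n + 4 * (i / 2) + (1 - (i - 2 * (i / 2)))) = Fin.val y ∧
        (¬ (x ∈ L ∧ y ∉ L) → (2 * e.val = i → (G.ends e).1 ∈ L → (G.ends e).2 ∈ L) ∧
          (2 * e.val + 1 = i → (G.ends e).2 ∈ L → (G.ends e).1 ∈ L)) := by
      rcases Nat.even_or_odd' i with ⟨j, rfl | rfl⟩
      · refine ⟨(G.ends e).1, (G.ends e).2, Or.inl rfl, ?_, ?_, fun hn => ⟨fun _ => ?_, by omega⟩⟩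
        · rw [← he, ← hI'.fst e]
          congr 1
          omega
        · rw [← he, ← hI'.snd e]
          congr 1
          omega
        · tauto
      · refine ⟨(G.ends e).2, (G.ends e).1, Or.inr rfl, ?_, ?_, fun hn => ⟨by omega, fun _ => ?_⟩⟩
        · rw [← he, ← hI'.snd e]
          congr 1
          omega
        · rw [← he, ← hI'.fst e]
          congr 1
          omega
        · tauto
    obtain ⟨x, y, hj, hx, hy, hno⟩ := hstep
    have hX : (Term.read 0 (edgeT + (var 15 - 2 * (var 15 / 2)))).eval s' = x := by
      simp only [edgeT, Term.eval_add, Term.eval_sub, Term.eval_mul, Term.eval_div, Term.eval_read,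
        Term.eval_ofNat, eval_var, hsi, hI'.card, hx]
    have hY : (Term.read 0 (edgeT + (1 - (var 15 - 2 * (var 15 / 2))))).eval s' = y := by
      simp only [edgeT, Term.eval_add, Term.eval_sub, Term.eval_mul, Term.eval_div, Term.eval_read,
        Term.eval_ofNat, eval_var, hsi, hI'.card, hy]
    have hcond : (Term.read 9 (.read 0 (edgeT + (var 15 - 2 * (var 15 / 2)))) *
        (1 - .read 9 (.read 0 (edgeT + (1 - (var 15 - 2 * (var 15 / 2))))))).eval s' ≠ 0 ↔
        x ∈ L ∧ y ∉ L := by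
      rw [Term.eval_mul, Term.eval_sub, Term.eval_read _ _ 9, Term.eval_read _ _ 9, hX, hY,
        hF 9 (by decide), hseen, hseen]
      by_cases h1 : x ∈ L <;> by_cases h2 : y ∈ L <;> simp [h1, h2, Term.eval_ofNat]
    have hyb : y.val.size ≤ b := (Nat.size_le_size y.isLt.le).trans hnb
    have hxb : x.val.size ≤ b := (Nat.size_le_size x.isLt.le).trans hnb
    have heb : e.val.size ≤ b := (Nat.size_le_size (by omega)).trans hqb
    refine runs_ite (fun hc => ?_) fun hc => ?_
    · obtain ⟨hxL, hyL⟩ := hcond.1 hc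
      refine runs_seq (runs_assign (x := y) hY hyb ?_)
      refine runs_seq (runs_assign (x := x) ?_ hxb ?_)
      · rw [← hX]
        simp [edgeT, Term.eval_add, Term.eval_sub, Term.eval_mul, Term.eval_div, Term.eval_read,
          Term.eval_ofNat, eval_var, Mem.set_apply]
      refine runs_assign (x := e) ?_ heb ?_
      · simp [Term.eval_div, Term.eval_ofNat, eval_var, Mem.set_apply, hsi, he]
      refine ⟨by simp [Mem.set_apply, hsi], (((hF.set (by decide) _ _).set (by decide) _ _).set
        (by decide) _ _).set (by decide) _ _, Or.inr ⟨e, x, y, hj, hxL, hyL, ?_, ?_, ?_⟩⟩ <;>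
      simp [Mem.set_apply]
    · refine runs_skip ⟨hsi, hF.set (by decide) _ _, ?_⟩
      rcases h with h | ⟨e', x', y', h⟩
      · left
        have hno' := hno fun h => hcond.2 h hc
        intro e'
        by_cases hee : e' = e
        · subst hee
          refine ⟨fun hlt => ?_, fun hlt => ?_⟩
          · rcases Nat.lt_succ_iff_lt_or_eq.1 hlt with h1 | h1
            exacts [(h e').1 h1, hno'.1 h1]
          · rcases Nat.lt_succ_iff_lt_or_eq.1 hlt with h1 | h1
            exacts [(h e').2 h1, hno'.2 h1]
        · have : e'.val ≠ e.val := fun h => hee (Fin.ext h)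
          exact ⟨fun hlt => (h e').1 (by omega), fun hlt => (h e').2 (by omega)⟩
      · refine Or.inr ⟨e', x', y', ?_⟩
        simpa [Mem.set_apply] using h
  · rintro s' ⟨hF, h⟩
    refine ⟨hF, h.resolve_left fun h => ?_⟩
    obtain ⟨e, x, y, hj, hx, hy⟩ := hex
    have := e.isLt
    rcases hj with hj | hj
    · have := (h e).1 (by omega)
      rw [hj] at this
      exact hy (this hx)
    · have := (h e).2 (by omega)
      rw [hj] at this
      exact hy (this hx)

/-- The vertices in `L` have been found, in this order. -/
structure Explored (G : Network (Fin n) (Fin q)) (p : Fin n → ℕ) (c : Fin q → ℕ)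
    (L : List (Fin n)) (s : Mem) : Prop where
  nodup : L.Nodup
  head : L[0]? = some G.root
  seen : ∀ x : Fin n, s 9 x = if x ∈ L then 1 else 0
  ord : ∀ k (h : k < L.length), s 8 k = L[k]
  tree : ∀ x ∈ L, x ≠ G.root → ∃ (y : Fin n) (e : Fin q), s 4 x = y ∧ s 5 x = e ∧ G.Joins e y x ∧
    L.idxOf y < L.idxOf x ∧ s 6 x = p x ∧ s 7 x = c e
  rest : ∀ x, x ∉ L ∨ x = G.root → s 6 x = 0 ∧ s 7 x = 0

lemma Explored.root_mem {p : Fin n → ℕ} {c : Fin q → ℕ} {L : List (Fin n)}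
    (h : Explored G p c L s) : G.root ∈ L := List.mem_of_getElem? h.head

lemma runs_append {p : Fin n → ℕ} {c : Fin q → ℕ} {L : List (Fin n)} {D i : ℕ} {e : Fin q}
    {x y : Fin n} (hnb : n.size ≤ b) (hqb : q.size ≤ b) (hI : Input G pa pb ca cb s)
    (hD : s 3 0 = D) (hp : ∀ v, p v = pa v * (D / pb v)) (hc : ∀ e, c e = ca e * (D / cb e))
    (hpb : ∀ v, (p v).size ≤ b) (hcb : ∀ e, (c e).size ≤ b) (hE : Explored G p c L s)
    (hlen : L.length = i + 1) (hi : s 13 0 = i) (hj : G.Joins e x y) (hx : x ∈ L) (hy : y ∉ L)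
    (h25 : s 25 0 = y) (h26 : s 26 0 = x) (h27 : s 27 0 = e) :
    Runs m b appendProg s fun s' => Frame [4, 5, 6, 7, 8, 9] s s' ∧
      Explored G p c (L ++ [y]) s' := by
  have hyb : y.val.size ≤ b := (Nat.size_le_size y.isLt.le).trans hnb
  have hxb : x.val.size ≤ b := (Nat.size_le_size x.isLt.le).trans hnb
  have heb : e.val.size ≤ b := (Nat.size_le_size e.isLt.le).trans hqb
  have h1b : Nat.size 1 ≤ b := (Nat.size_le_size (Nat.succ_le_of_lt y.pos)).trans hnb
  have hyr : y ≠ G.root := fun h => hy (h ▸ hE.root_mem)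
  refine runs_seq (runs_write' (y := y) (x := x) ?_ ?_ hxb ?_)
  · simp [eval_var, h25]
  · simp [eval_var, h26]
  refine runs_seq (runs_write' (y := y) (x := e) ?_ ?_ heb ?_)
  · simp [eval_var, Mem.set_apply, h25]
  · simp [eval_var, Mem.set_apply, h27]
  refine runs_seq (runs_write' (y := y) (x := p y) ?_ ?_ (hpb y) ?_)
  · simp [eval_var, Mem.set_apply, h25]
  · simp [Term.eval_add, Term.eval_mul, Term.eval_div, Term.eval_read, Term.eval_ofNat, eval_var,
      Mem.set_apply, h25, hI.pnum, hI.pden, hD, hp]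
  refine runs_seq (runs_write' (y := y) (x := c e) ?_ ?_ (hcb e) ?_)
  · simp [eval_var, Mem.set_apply, h25]
  · simp [Term.eval_add, Term.eval_mul, Term.eval_div, Term.eval_read, Term.eval_ofNat, eval_var,
      Mem.set_apply, h27, hI.card, hI.cnum, hI.cden, hD, hc]
  refine runs_seq (runs_write' (y := y) (x := 1) ?_ rfl h1b ?_)
  · simp [eval_var, Mem.set_apply, h25]
  refine runs_write' (y := i + 1) (x := y) ?_ ?_ hyb ?_
  · simp [Term.eval_add, Term.eval_ofNat, eval_var, Mem.set_apply, hi]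
  · simp [eval_var, Mem.set_apply, h25]
  refine ⟨((((((Frame.refl _ s).set (by decide) _ _).set (by decide) _ _).set (by decide) _ _).set
    (by decide) _ _).set (by decide) _ _).set (by decide) _ _, ?_, ?_, fun z => ?_,
    fun k hk => ?_, fun z hz hzr => ?_, fun z hz => ?_⟩
  · exact List.Nodup.append hE.nodup (by simp) (by simpa using hy)
  · rw [List.getElem?_append_left (by omega), hE.head]
  · simp only [Mem.set_apply]
    norm_num
    by_cases hzy : z = y
    · simp [hzy]
    · have : z.val ≠ y.val := fun h => hzy (Fin.ext h)
      simp [hzy, this, hE.seen]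
  · simp only [Mem.set_apply]
    norm_num
    rw [List.length_append, List.length_singleton] at hk
    by_cases hki : k = i + 1
    · subst hki
      simp [← hlen]
    · rw [if_neg hki, List.getElem_append_left (by omega)]
      exact hE.ord k (by omega)
  · by_cases hzy : z = y
    · subst hzy
      refine ⟨x, e, by simp [Mem.set_apply], by simp [Mem.set_apply], hj, ?_,
        by simp [Mem.set_apply], by simp [Mem.set_apply]⟩
      rw [List.idxOf_append_of_mem hx, List.idxOf_append_of_notMem hy]
      have := List.idxOf_lt_length_iff.2 hx
      omega
    · have hzv : z.val ≠ y.val := fun h => hzy (Fin.ext h)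
      have hzL : z ∈ L := by simpa [hzy] using hz
      obtain ⟨y', e', h1, h2, h3, h4, h5, h6⟩ := hE.tree z hzL hzr
      refine ⟨y', e', by simpa [Mem.set_apply, hzv] using h1, by simpa [Mem.set_apply, hzv] using h2,
        h3, ?_, by simpa [Mem.set_apply, hzv] using h5, by simpa [Mem.set_apply, hzv] using h6⟩
      have hy'L : y' ∈ L := by
        rw [← List.idxOf_lt_length_iff]
        exact h4.trans (List.idxOf_lt_length_iff.2 hzL)
      rwa [List.idxOf_append_of_mem hzL, List.idxOf_append_of_mem hy'L]
  · have hzy : z ≠ y := by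
      rintro rfl
      rcases hz with hz | hz
      · simp at hz
      · exact hyr hz
    have hzv : z.val ≠ y.val := fun h => hzy (Fin.ext h)
    have := hE.rest z (by
      rcases hz with hz | hz
      · left
        simp only [List.mem_append, not_or] at hz
        exact hz.1
      · exact Or.inr hz)
    simpa [Mem.set_apply, hzv] using this

/-- Otherwise `L` would contain everything connected to the root, which is more than its length
permits. -/
lemma exists_crossing {L : List (Fin n)}
    (hconn : ∀ v, Relation.ReflTransGen (fun u w => ∃ e, G.Joins e u w) G.root v)
    (hroot : G.root ∈ L) (hlen : L.length < n) : ∃ e x y, G.Joins e x y ∧ x ∈ L ∧ y ∉ L := by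
  by_contra! hc
  have hall : ∀ v, v ∈ L := by
    intro v
    induction hconn v with
    | refl => exact hroot
    | tail _ h ih =>
      obtain ⟨e, he⟩ := h
      exact hc e _ _ he ih
  have h1 : Fintype.card (Fin n) ≤ L.toFinset.card := by
    rw [← Finset.card_univ]
    exact Finset.card_le_card fun v _ => by simpa using hall v
  have h2 := L.toFinset_card_le
  rw [Fintype.card_fin] at h1
  omega

lemma runs_explore {p : Fin n → ℕ} {c : Fin q → ℕ} {D : ℕ} (hnm : n ≤ m) (hqm : 2 * q ≤ m)
    (hqb : (2 * q).size ≤ b) (hnb : n.size ≤ b) (hI : Input G pa pb ca cb s) (hD : s 3 0 = D)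
    (hp : ∀ v, p v = pa v * (D / pb v)) (hc : ∀ e, c e = ca e * (D / cb e))
    (hpb : ∀ v, (p v).size ≤ b) (hcb : ∀ e, (c e).size ≤ b)
    (hconn : ∀ v, Relation.ReflTransGen (fun u w => ∃ e, G.Joins e u w) G.root v)
    (h6 : ∀ x, s 6 x = 0) (h7 : ∀ x, s 7 x = 0) (h9 : ∀ x, s 9 x = 0) :
    Runs m b exploreProg s fun s' => Frame [4, 5, 6, 7, 8, 9, 13, 15, 25, 26, 27] s s' ∧
      ∃ L, L.length = n ∧ Explored G p c L s' := by
  have hn := G.root.pos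
  have h1b : Nat.size 1 ≤ b := (Nat.size_le_size (Nat.succ_le_of_lt hn)).trans hnb
  have hrb : G.root.val.size ≤ b := (Nat.size_le_size G.root.isLt.le).trans hnb
  refine runs_seq (runs_write' (y := G.root) (x := 1) ?_ rfl h1b ?_)
  · simp [Term.eval_read, Term.eval_ofNat, hI.root]
  refine runs_seq (runs_write' (y := 0) (x := G.root) rfl ?_ hrb ?_)
  · simp [Term.eval_read, Term.eval_ofNat, Mem.set_apply, hI.root]
  refine runs_for (n := n - 1) (by omega) ((Nat.size_le_size (Nat.sub_le _ _)).trans hnb)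
    (fun i s' => Frame [4, 5, 6, 7, 8, 9, 13, 15, 25, 26, 27] s s' ∧
      ∃ L, L.length = i + 1 ∧ Explored G p c L s') ?_ ?_ ?_ ?_
  · refine ⟨(((Frame.refl _ s).set (by decide) _ _).set (by decide) _ _).set (by decide) _ _,
      [G.root], rfl, by simp, by simp, fun x => ?_, fun k hk => ?_, fun x hx hxr => ?_, fun x _ => ?_⟩
    · by_cases hx : x = G.root
      · simp [Mem.set_apply, hx]
      · have : x.val ≠ G.root.val := fun h => hx (Fin.ext h)
        simp [Mem.set_apply, hx, this, h9]
    · obtain rfl : k = 0 := by simpa using hk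
      simp [Mem.set_apply]
    · exact absurd (List.mem_singleton.1 hx) hxr
    · simp [Mem.set_apply, h6, h7]
  · rintro i s' ⟨hF, -⟩
    simp only [Term.eval_sub, Term.eval_read, Term.eval_ofNat, hF 0 (by decide), hI.card]
  · rintro i s' hi hsi ⟨hF, L, hlen, hE⟩
    have hI' := hI.of_frame hF (by decide)
    refine runs_seq ((runs_cross hqm hqb hnb hI' hE.seen
      (exists_crossing hconn hE.root_mem (by omega))).mono ?_)
    rintro s'' ⟨hF', e, x, y, hj, hx, hy, g1, g2, g3⟩
    have hFF := hF.trans hF' (by decide)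
    have hE' : Explored G p c L s'' := by
      obtain ⟨k1, k2, k3, k4, k5, k6⟩ := hE
      refine ⟨k1, k2, ?_, ?_, ?_, ?_⟩
      · rwa [hF' 9 (by decide)]
      · rwa [hF' 8 (by decide)]
      · rwa [hF' 4 (by decide), hF' 5 (by decide), hF' 6 (by decide), hF' 7 (by decide)]
      · rwa [hF' 6 (by decide), hF' 7 (by decide)]
    refine (runs_append hnb ((Nat.size_le_size (by omega)).trans hqb) (hI.of_frame hFF (by decide))
      (by rw [hFF 3 (by decide), hD]) hp hc hpb hcb hE' hlen (by rw [hF' 13 (by decide), hsi])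
      hj hx hy g1 g2 g3).mono ?_
    rintro t ⟨hF'', hE''⟩
    refine ⟨by rw [hF'' 13 (by decide), hF' 13 (by decide), hsi],
      (hFF.trans hF'' (by decide)).set (by decide) _ _, L ++ [y], by simp [hlen], ?_⟩
    obtain ⟨k1, k2, k3, k4, k5, k6⟩ := hE''
    have hF3 : Frame [13] t (t.set 13 0 (i + 1)) := (Frame.refl _ t).set (by decide) _ _
    refine ⟨k1, k2, ?_, ?_, ?_, ?_⟩
    · rwa [hF3 9 (by decide)]
    · rwa [hF3 8 (by decide)]
    · rwa [hF3 4 (by decide), hF3 5 (by decide), hF3 6 (by decide), hF3 7 (by decide)]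
    · rwa [hF3 6 (by decide), hF3 7 (by decide)]
  · rintro s' ⟨hF, L, hlen, hE⟩
    exact ⟨hF, L, by omega, hE⟩

end Explore

/-! ### Correctness and running time of the implementation -/

section Implementation

variable {n q m b : ℕ} {s : Mem} {G : Network (Fin n) (Fin q)}

/-- The position in the order of discovery serves as rank: parents are found before their children,
the root has position `0`, and positions are distinct. -/
lemma Explored.exists_arbor {p : Fin n → ℕ} {c : Fin q → ℕ} {L : List (Fin n)} {D : ℝ}
    (hE : Explored G p c L s) (hlen : L.length = n) (hG : G.IsTree) (hV : G.verts = Finset.univ)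
    (hEd : G.edges = Finset.univ) (hD : 0 < D) (hp : ∀ v, (p v : ℝ) = D * G.prize v)
    (hc : ∀ e, (c e : ℝ) = D * G.cost e) (h0 : s 0 0 = n) :
    ∃ (A : Arbor (Fin n)) (lab : Fin n → ℕ), A.verts = Finset.univ.erase G.root ∧
      Scaled A (fun v => s 6 v) (fun v => s 7 v) D ∧
      Layout A lab (fun v => s 6 v) (fun v => s 7 v) s ∧
      (∀ k < n, ∃ u : Fin n, s 8 k = u ∧ A.rank u = k) ∧ Function.Injective A.rank ∧
      A.rank G.root = 0 ∧ ∀ vs, A.IsGreedy G.root vs →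
        (∀ y ∈ A.frontier (insert G.root vs.toFinset), A.dens y ≤ 0) →
        ∃ π : List (Fin q), G.IsGreedyOutput π ∧ π.map Fin.val = vs.map lab := by
  have hall : ∀ x, x ∈ L := by
    intro x
    have h1 : L.toFinset = Finset.univ := by
      rw [← Finset.card_eq_iff_eq_univ, List.toFinset_card_of_nodup hE.nodup, hlen,
        Fintype.card_fin]
    have := Finset.mem_univ x
    rwa [← h1, List.mem_toFinset] at this
  have hord : ∀ k < n, ∃ u : Fin n, s 8 k = u ∧ L.idxOf u = k := fun k hk =>
    ⟨L[k], hE.ord k (by omega), hE.nodup.idxOf_getElem k (by omega)⟩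
  have hinj : Function.Injective fun v => L.idxOf v := fun v w h =>
    (List.idxOf_inj (hall v)).1 h
  have hroot : L.idxOf G.root = 0 := by
    have h1 : L[0]'(hlen.symm ▸ G.root.pos) = G.root :=
      (List.getElem_eq_iff _).2 hE.head
    rw [← h1]
    exact hE.nodup.idxOf_getElem 0 _
  have hcard : G.edges.card + 1 = G.verts.card := hG.2.2.2
  -- Without edges there is no `Rooting`; the root is then the only vertex, and the empty forest
  -- does.
  rcases Nat.eq_zero_or_pos q with rfl | hq
  · have hn : n = 1 := by
      rw [hV, Finset.card_univ, Fintype.card_fin, Finset.eq_empty_of_isEmpty G.edges] at hcard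
      simpa using hcard.symm
    subst hn
    have hv : (Finset.univ.erase G.root : Finset (Fin 1)) = ∅ := by
      ext x
      simp [Subsingleton.elim x G.root]
    refine ⟨⟨∅, id, fun v => L.idxOf v, fun _ => 0, fun _ => 1, by simp, by simp, by simp⟩, fun _ => 0,
      hv.symm, ⟨hD, by simp, by simp⟩, ⟨h0, by simp, by simp, fun _ => rfl, fun _ => rfl⟩, hord,
      hinj, hroot, fun vs hvs _ => ⟨[], Network.isGreedyOutput_of_isEmpty hG [], ?_⟩⟩
    have h1 : vs = [] := List.eq_nil_iff_forall_not_mem.2 fun x hx => by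
      simpa using hvs.mem_verts (List.mem_toFinset.2 hx)
    simp [h1]
  · have : Nonempty (Fin n) := ⟨G.root⟩
    have : Nonempty (Fin q) := ⟨⟨0, hq⟩⟩
    choose! par up h using hE.tree
    have hne : ∀ v ∈ G.verts.erase G.root, v ≠ G.root := fun v hv => (Finset.mem_erase.1 hv).1
    let R : G.Rooting := Network.Rooting.ofCard par up (fun v => L.idxOf v)
      (fun v _ => hV ▸ Finset.mem_univ _) (fun v _ => hEd ▸ Finset.mem_univ _)
      (fun v hv => (h v (hall v) (hne v hv)).2.2.1)
      (fun v hv => (h v (hall v) (hne v hv)).2.2.2.1) hcard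
    refine ⟨R.arbor, fun v => (up v).val, by rw [← hV]; rfl, ⟨hD, fun v hv => ?_, fun v hv => ?_⟩,
      ⟨h0, fun v hv => (h v (hall v) (hne v hv)).1, fun v hv => (h v (hall v) (hne v hv)).2.1,
        fun _ => rfl, fun _ => rfl⟩, hord, hinj, hroot, fun vs hvs hend =>
        ⟨vs.map R.up, Network.Rooting.isGreedyOutput_of_frontier hvs hend, ?_⟩⟩
    · rw [(h v (hall v) (hne v hv)).2.2.2.2.1, hp]
      rfl
    · rw [(h v (hall v) (hne v hv)).2.2.2.2.2, hc]
      rfl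
    · rw [List.map_map]
      rfl

/-- Total correctness of the implementation. -/
theorem runs_treeProg {pa pb : Fin n → ℕ} {ca cb : Fin q → ℕ} {D k K : ℕ}
    (hI : Input G pa pb ca cb s) (hs : ∀ j, j ≠ 0 → ∀ i, s j i = 0) (hG : G.IsTree)
    (hV : G.verts = Finset.univ) (hEd : G.edges = Finset.univ)
    (hk : 3 + 2 * n + 4 * q = k) (hkm : k ≤ m) (hkb : k.size ≤ b)
    (hD : ∏ i ∈ Finset.range k, (s 0 i + (1 - s 0 i)) = D) (hDb : D.size ≤ b) (hDpos : 0 < D)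
    (hp : ∀ v, ((pa v * (D / pb v) : ℕ) : ℝ) = D * G.prize v)
    (hc : ∀ e, ((ca e * (D / cb e) : ℕ) : ℝ) = D * G.cost e)
    (hpK : ∀ v, pa v * (D / pb v) ≤ K) (hcK : ∀ e, ca e * (D / cb e) ≤ K)
    (hK : (n * K).size ≤ b) :
    Runs m b treeProg s fun s' =>
      ∃ π : List (Fin q), IsOutput s' (π.map Fin.val) ∧ G.IsGreedyOutput π := by
  have hn := G.root.pos
  have hK' : K.size ≤ b := (Nat.size_le_size (Nat.le_mul_of_pos_left K hn)).trans hK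
  have hnb : n.size ≤ b := (Nat.size_le_size (by omega)).trans hkb
  refine runs_seq ((runs_scale (k := k) (by rw [hI.card, hI.size, hk]) hkm hkb hD hDb).mono ?_)
  rintro s₁ ⟨hF₁, hs₁⟩
  have hI₁ := hI.of_frame hF₁ (by decide)
  have hconn : ∀ v, Relation.ReflTransGen (fun u w => ∃ e, G.Joins e u w) G.root v := fun v =>
    (hG.2.2.1 v (by rw [hV]; exact Finset.mem_univ v)).lift id fun _ _ ⟨e, _, he⟩ => ⟨e, he⟩
  refine runs_seq ((runs_explore (by omega) (by omega) ((Nat.size_le_size (by omega)).trans hkb)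
    hnb hI₁ hs₁ (p := fun v => pa v * (D / pb v)) (c := fun e => ca e * (D / cb e))
    (fun _ => rfl) (fun _ => rfl)
    (fun v => (Nat.size_le_size (hpK v)).trans hK') (fun e => (Nat.size_le_size (hcK e)).trans hK')
    hconn (fun x => ?_) (fun x => ?_) fun x => ?_).mono ?_)
  · rw [hF₁ 6 (by decide), hs 6 (by decide)]
  · rw [hF₁ 7 (by decide), hs 7 (by decide)]
  · rw [hF₁ 9 (by decide), hs 9 (by decide)]
  rintro s₂ ⟨hF₂, L, hlen, hE⟩
  obtain ⟨A, lab, hA, hsc, hL, hord, hinj, hr, hout⟩ := hE.exists_arbor hlen hG hV hEd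
    (Nat.cast_pos.2 hDpos) hp hc (hI₁.of_frame hF₂ (by decide)).card
  have hle : ∀ v : Fin n, s₂ 6 v ≤ K ∧ s₂ 7 v ≤ K := by
    intro v
    by_cases hv : v ∉ L ∨ v = G.root
    · obtain ⟨h1, h2⟩ := hE.rest v hv
      rw [h1, h2]
      exact ⟨Nat.zero_le _, Nat.zero_le _⟩
    · push Not at hv
      obtain ⟨y, e, -, -, -, -, h1, h2⟩ := hE.tree v hv.1 hv.2
      rw [h1, h2]
      exact ⟨hpK v, hcK e⟩
  have hsum : ∀ f : Fin n → ℕ, (∀ v, f v ≤ K) → (∑ v, f v).size ≤ b := fun f hf => by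
    refine (Nat.size_le_size ?_).trans hK
    simpa using Finset.sum_le_card_nsmul Finset.univ f K fun v _ => hf v
  refine (runs_order (by omega) hnb hA hsc (hsum _ fun v => (hle v).1) (hsum _ fun v => (hle v).2)
    hL hord hinj hr ?_ fun x => ?_).mono ?_
  · rw [hF₂ 10 (by decide), hF₁ 10 (by decide), hs 10 (by decide)]
  · rw [hF₂ 12 (by decide), hF₁ 12 (by decide), hs 12 (by decide)]
  · rintro s' ⟨vs, h1, h2, h3, h4⟩
    obtain ⟨π, h5, h6⟩ := hout vs h1 h2
    refine ⟨π, ?_, h5⟩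
    rw [h6]
    exact ⟨by rw [h3, List.length_map], fun i => by
      simpa using h4 i (by simpa using i.isLt)⟩

end Implementation

/-! ### Encoding of instances -/

lemma length_flatMap_finRange {k n : ℕ} (f : Fin n → List ℕ) (hf : ∀ v, (f v).length = k) :
    ((List.finRange n).flatMap f).length = k * n := by
  simp [List.length_flatMap, hf, mul_comm]

lemma getD_flatMap_finRange {k n : ℕ} (f : Fin n → List ℕ) (hf : ∀ v, (f v).length = k) (v : Fin n)
    {j : ℕ} (hj : j < k) (r : List ℕ) :
    ((List.finRange n).flatMap f ++ r).getD (k * v + j) 0 = (f v).getD j 0 := by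
  induction n with
  | zero => exact v.elim0
  | succ n ih =>
    rw [List.finRange_succ, List.flatMap_cons, List.flatMap_map, List.append_assoc]
    rcases Fin.eq_zero_or_eq_succ v with rfl | ⟨w, rfl⟩
    · rw [List.getD_append _ _ _ _ (by rw [hf]; simpa using hj)]
      simp
    · rw [List.getD_append_right _ _ _ _ (by rw [hf, Fin.val_succ, mul_add]; omega), hf]
      have h := ih (fun w => f w.succ) (fun w => hf _) w
      rw [← h]
      congr 1
      rw [Fin.val_succ, mul_add]
      omega

lemma input_initial {n q : ℕ} {G : Network (Fin n) (Fin q)} {pa pb : Fin n → ℕ} {ca cb : Fin q → ℕ}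
    {x : List ℕ} (hx : x = [n, q, G.root.val] ++
      (List.finRange n).flatMap (fun v => [pa v, pb v]) ++
      (List.finRange q).flatMap
        (fun e => [(G.ends e).1.val, (G.ends e).2.val, ca e, cb e])) :
    Input G pa pb ca cb (initial x) ∧ x.length = 3 + 2 * n + 4 * q := by
  have h1 := length_flatMap_finRange (k := 2) (fun v => [pa v, pb v]) fun _ => rfl
  have h2 := length_flatMap_finRange (k := 4)
    (fun e => [(G.ends e).1.val, (G.ends e).2.val, ca e, cb e]) fun _ => rfl
  have hV : ∀ (v : Fin n) (j : ℕ), j < 2 → x.getD (3 + (2 * v + j)) 0 = [pa v, pb v].getD j 0 := by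
    intro v j hj
    rw [hx, List.append_assoc, List.getD_append_right _ _ _ _ (by simp)]
    simpa using getD_flatMap_finRange (k := 2) (fun v => [pa v, pb v]) (fun _ => rfl) v hj _
  have hE : ∀ (e : Fin q) (j : ℕ), j < 4 → x.getD (3 + 2 * n + (4 * e + j)) 0 =
      [(G.ends e).1.val, (G.ends e).2.val, ca e, cb e].getD j 0 := by
    intro e j hj
    have h3 : ([n, q, G.root.val] ++ (List.finRange n).flatMap fun v => [pa v, pb v]).length =
        3 + 2 * n := by
      rw [List.length_append, h1, List.length_cons, List.length_cons, List.length_cons,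
        List.length_nil]
    rw [hx, List.getD_append_right _ _ _ _ (by rw [h3]; omega), h3, Nat.add_sub_cancel_left]
    have := getD_flatMap_finRange (k := 4)
      (fun e => [(G.ends e).1.val, (G.ends e).2.val, ca e, cb e]) (fun _ => rfl) e hj []
    rwa [List.append_nil] at this
  have hi : ∀ i, initial x 0 i = x.getD i 0 := fun i => if_pos rfl
  refine ⟨⟨?_, ?_, ?_, fun v => ?_, fun v => ?_, fun e => ?_, fun e => ?_, fun e => ?_,
    fun e => ?_⟩, ?_⟩
  · rw [hi, hx]
    rfl
  · rw [hi, hx]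
    rfl
  · rw [hi, hx]
    rfl
  · simpa [hi] using hV v 0 (by norm_num)
  · rw [hi, show 4 + 2 * v.val = 3 + (2 * v + 1) by ring]
    simpa using hV v 1 (by norm_num)
  · rw [hi]
    simpa using hE e 0 (by norm_num)
  · rw [hi, show 4 + 2 * n + 4 * e.val = 3 + 2 * n + (4 * e + 1) by ring]
    simpa using hE e 1 (by norm_num)
  · rw [hi, show 5 + 2 * n + 4 * e.val = 3 + 2 * n + (4 * e + 2) by ring]
    simpa using hE e 2 (by norm_num)
  · rw [hi, show 6 + 2 * n + 4 * e.val = 3 + 2 * n + (4 * e + 3) by ring]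
    simpa using hE e 3 (by norm_num)
  · rw [hx, List.length_append, List.length_append, h1, h2]
    rfl

lemma length_le_inputSize (x : List ℕ) : x.length ≤ inputSize x := by
  induction x with
  | nil => simp
  | cons a x ih =>
    simp only [inputSize, List.map_cons, List.sum_cons, List.length_cons] at ih ⊢
    omega

lemma size_getD_le_inputSize (x : List ℕ) (i : ℕ) : (x.getD i 0).size ≤ inputSize x := by
  induction x generalizing i with
  | nil => simp
  | cons a x ih =>
    simp only [inputSize, List.map_cons, List.sum_cons] at ih ⊢
    cases i with
    | zero => simp; omega
    | succ i =>
      have := ih i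
      simp only [List.getD_cons_succ]
      omega

/-- Each factor is at most `2 ^ (a.size + 1)`, and these exponents add up to the input size. -/
lemma prod_le_two_pow_inputSize (x : List ℕ) :
    ∏ i ∈ Finset.range x.length, (x.getD i 0 + (1 - x.getD i 0)) ≤ 2 ^ inputSize x := by
  induction x with
  | nil => simp [inputSize]
  | cons a x ih =>
    rw [List.length_cons, Finset.prod_range_succ']
    simp only [inputSize, List.map_cons, List.sum_cons, List.getD_cons_succ, List.getD_cons_zero]
    rw [pow_add, mul_comm]
    refine Nat.mul_le_mul ?_ ih
    have h1 := Nat.lt_size_self a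
    have h2 : 1 ≤ 2 ^ a.size := Nat.one_le_two_pow
    rw [pow_succ]
    omega

/-- The density-greedy algorithm runs in polynomial time. -/
theorem greedyOnTreesInPolyTime : GreedyOnTreesInPolyTime := by
  -- The second factor is `b + 1` for words of `b = 3 * N + 1` bits, with `N` the input size, which
  -- also bounds the rounds of every loop.
  refine ⟨treeProg, treeProg.bound * (3 * Polynomial.X + 2), ?_⟩
  rintro n q G x hG ⟨hV, hEd, pa, pb, ca, cb, hpr, hco, hx⟩
  obtain ⟨hI, hlen⟩ := input_initial hx
  have hi : ∀ i, initial x 0 i = x.getD i 0 := fun i => if_pos rfl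
  set N := inputSize x with hN
  have hNlen := length_le_inputSize x
  have hsize : ∀ i, initial x 0 i ≤ 2 ^ N := fun i => by
    rw [hi]
    exact (Nat.size_le.1 (size_getD_le_inputSize x i)).le
  let D := ∏ i ∈ Finset.range x.length, (initial x 0 i + (1 - initial x 0 i))
  have hD : D ≤ 2 ^ N := by
    simp only [D, hi]
    exact prod_le_two_pow_inputSize x
  have hDpos : 0 < D := Finset.prod_pos fun i _ => by omega
  -- Every denominator divides the scaling factor, so the divisions of the machine are exact.
  have hdvd : ∀ i < x.length, initial x 0 i ≠ 0 → initial x 0 i ∣ D := by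
    intro i hil h0
    have h1 := Finset.dvd_prod_of_mem (fun i => initial x 0 i + (1 - initial x 0 i))
      (Finset.mem_range.2 hil)
    have h2 : initial x 0 i + (1 - initial x 0 i) = initial x 0 i := by omega
    simp only [h2] at h1
    exact h1
  have hpow : ∀ {a c : ℕ}, a ≤ 2 ^ c → a.size ≤ c + 1 := fun {a c} h =>
    Nat.size_le.2 (h.trans_lt (Nat.pow_lt_pow_right (by norm_num) (Nat.lt_succ_self c)))
  have hNN : N < 2 ^ N := Nat.lt_two_pow_self
  have hscale : ∀ a d : ℕ, d ∣ D → d ≠ 0 → ((a * (D / d) : ℕ) : ℝ) = D * ((a : ℝ) / d) := by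
    intro a d hd h0
    rw [Nat.cast_mul, Nat.cast_div hd (by exact_mod_cast h0)]
    ring
  have hb : Bounded (3 * N + 1) (initial x) := by
    intro j i
    by_cases hj : j = 0
    · subst hj
      rw [hi]
      exact (size_getD_le_inputSize x i).trans (by omega)
    · simp [initial, hj]
  have h2N : ∀ a d : ℕ, a ≤ 2 ^ N → a * (D / d) ≤ 2 ^ N * 2 ^ N := fun a d ha =>
    Nat.mul_le_mul ha ((Nat.div_le_self _ _).trans hD)
  have hp : ∀ v, ((pa v * (D / pb v) : ℕ) : ℝ) = D * G.prize v := fun v => by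
    have h := hdvd (4 + 2 * v) (by have := v.isLt; omega)
    rw [hI.pden] at h
    rw [(hpr v).2, hscale _ _ (h (hpr v).1) (hpr v).1]
  have hc : ∀ e, ((ca e * (D / cb e) : ℕ) : ℝ) = D * G.cost e := fun e => by
    have h := hdvd (6 + 2 * n + 4 * e) (by have := e.isLt; omega)
    rw [hI.cden] at h
    rw [(hco e).2, hscale _ _ (h (hco e).1) (hco e).1]
  -- A scaled number is at most `2 ^ N * 2 ^ N`, and `n ≤ 2 ^ N` of them are added; this fixes the
  -- word length.
  have hK : (n * (2 ^ N * 2 ^ N)).size ≤ 3 * N + 1 := by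
    refine hpow ?_
    have h5 : n ≤ 2 ^ N := by omega
    calc n * (2 ^ N * 2 ^ N) ≤ 2 ^ N * (2 ^ N * 2 ^ N) := Nat.mul_le_mul_right _ h5
      _ = 2 ^ (3 * N) := by rw [← pow_add, ← pow_add]; congr 1; ring
  obtain ⟨t, s', h1, h2, -, π, h3, h4⟩ := runs_treeProg (m := N) (b := 3 * N + 1) (D := D)
    hI (fun j hj i => by simp [initial, hj]) hG hV hEd hlen.symm hNlen
    ((hpow (hNlen.trans hNN.le)).trans (by omega)) rfl ((hpow hD).trans (by omega)) hDpos
    hp hc (fun v => h2N _ _ (hI.pnum v ▸ hsize _)) (fun e => h2N _ _ (hI.cnum e ▸ hsize _)) hK hb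
  refine ⟨t, s', π, h1, h2.trans_eq ?_, h3, h4⟩
  simp

end PCST

end

theorem theorem1 :
    -- on trees, every partial execution can be completed, and every output is an incremental solution
    (∀ (V E : Type) [DecidableEq V] [DecidableEq E] (G : PCST.Network V E), G.IsTree →
      (∀ σ, G.GreedyTrace σ → ∃ τ, G.IsGreedyOutput (σ ++ τ)) ∧
      (∀ π, G.IsGreedyOutput π → G.IsIncrementalSolution π)) ∧
    -- polynomial running time
    PCST.GreedyOnTreesInPolyTime ∧
    -- competitiveness, for every rule of choosing among the min-max subtrees
    (∀ A : PCST.Algorithm, A.IsDensityGreedy → ∀ χ : ℝ, 0 ≤ χ →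
      (∀ α : ℝ, 0 ≤ α →
        (∀ μ : ℝ, 1 ≤ μ → (A.IsCompetitiveOnTrees χ α μ ↔ χ ≤ α)) ∧
        ((∃ μ : ℝ, 1 ≤ μ ∧ A.IsCompetitiveOnTrees χ α μ) ↔ χ ≤ α)) ∧
      A.IsCompetitiveOnTrees χ χ 1) := by
  refine ⟨fun V E _ _ G hG => ⟨fun σ hσ => PCST.Network.exists_greedyOutput hG hσ,
    fun π hπ => PCST.Network.isIncrementalSolution hG hπ⟩, ?_, fun A hA χ _ => ⟨fun α hα =>
      ⟨fun μ hμ => hA.isCompetitiveOnTrees_iff hα hμ, ?_⟩, ?_⟩⟩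
  · exact PCST.greedyOnTreesInPolyTime
  · exact ⟨fun ⟨μ, hμ, h⟩ => (hA.isCompetitiveOnTrees_iff hα hμ).1 h,
      fun h => ⟨1, le_rfl, (hA.isCompetitiveOnTrees_iff hα le_rfl).2 h⟩⟩
  · exact (hA.isCompetitiveOnTrees_iff ‹0 ≤ χ› le_rfl).2 le_rfl
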